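/- **Setting.** Let $\mathcal N$ be a set of $n\ge 1$ items. A ranking (type) is a permutation $\pi$ of $\mathcal N$, $\pi(i)$ being the $i$-th most preferred item; a consumer of type $\pi$ who is offered $S\ne\emptyset$ chooses the item of $S$ that $\pi$ ranks highest. The types of the consumers are i.i.d. from an unknown distribution $p$ on rankings, and each consumer is queried once; an algorithm chooses each assortment $S$ adaptively and only observes the choice. For $A\subseteq\mathcal N$, $z\notin A$, let $p(A)$ be the probability that the set of the top $|A|$ items of a random type is $A$, and $e_{A\oplus z}$ the probability that moreover the next item is $z$. **$(\kappa,\rho)$ models** ($\kappa\in(0,1)$, $\rho\in[0,1)$). There are a set $\Pi^F_0$ of at most $K$ candidate rankings, a set $\Pi^F\subseteq\Pi^F_0$ of frequent types, and $p$ with $p(\pi)\ge\kappa$ for $\pi\in\Pi^F$, $p(\pi)<\kappa$ for every rare type (those $\pi\notin\Pi^F$ with $p(\pi)>0$), and total probability of the rare types at most $\rho$. In the *general model* $\Pi^F_0$ is arbitrary. In the *random model* $\Pi^F_0$ is the set of $K$ i.i.d. uniformly random rankings, and an adversary who sees $\Pi_0^F$ chooses $\Pi^F$ and $p$. Let $V^F_m$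 be the set of all $\{\pi(1),\dots,\pi(i)\}$ with $\pi\in\Pi^F$, $0\le i\le m$, and $E^F_m$ the set of all pairs $(\{\pi(1),\dots,\pi(i)\},\{\pi(1),\dots,\pi(i+1)\})$ with $\pi\in\Pi^F$, $0\le i<m$. **AlgDAG** (parameters $\alpha,\varepsilon,\delta$, given $\kappa,K$; $n_0=\alpha n$). Start with $\widehat V_0=\{\emptyset\}$, $\widehat p(\emptyset)=1$, no edges. For $j=0,\dots,n_0-1$, for every $A\in\widehat V_j$ with $|A|=j$ and every $z\notin A$: let $\widehat e_{A\oplus z}$ be the output of AlgIE on $(\widehat V_j,A,z)$ with parameters $\varepsilon'=\min(\varepsilon/n_0,\kappa/4)$, $\delta'=\delta/(\alpha n^2K)$; if $\widehat e_{A\oplus z}\ge\kappa/2$, add the node $A\cup\{z\}$ on level $j+1$ (with $\widehat p=0$) unless it is already there, add $\widehat e_{A\oplus z}$ to $\widehat p(A\cup\{z\})$, and add the edge $(A,A\cup\{z\})$. Here $\widehat V_j$, $\widehat E_j$ contain all nodes and edges up to level $j$. **AlgIE** (with parameters $\varepsilon',\delta'$). Let $\widehat{\mathcal P}=\{A'\in\widehat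 V_j: A'\subsetneq A,\ A'\cup\{z\}\in\widehat V_j\}$. Compute a greedy set cover $\widehat{\mathcal C}$: repeatedly select a set $A\setminus\{x\}$, $x\in A$, containing the largest number of members of $\widehat{\mathcal P}$ not yet contained in a selected set (ties are broken by the smallest $x$), until all are covered. Let $m=\lceil 2^{2|\widehat{\mathcal C}|-1}(\ln(1/\delta')+(|\widehat{\mathcal C}|+1)\ln 2)/\varepsilon'^2\rceil$. For $S=\mathcal N\setminus A$ and, for each nonempty $\mathcal B\subseteq\widehat{\mathcal C}$, for $S=\mathcal N\setminus\bigcap_{B\in\mathcal B}B$, offer $S$ to $m$ new consumers and let $\widehat q_z(S)$ be the fraction choosing $z$. Return $\widehat q_z(\mathcal N\setminus A)-\sum_{\emptyset\ne\mathcal B\subseteq\widehat{\mathcal C}}(-1)^{|\mathcal B|+1}\widehat q_z(\mathcal N\setminus\bigcap_{B\in\mathcal B}B)$. Computation time is counted in elementary steps (arithmetic operations and comparisons of real numbers, accesses to array entries, queries); sets are bit arrays of length $n$. **Theorem.** Let $\alpha\in(0,1)$ be a constant, $n_0=\alpha n$ an integer, $\varepsilon>0$, $\delta\in(0,1)$ and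 $\rho<\kappa/4$. 1. Under the general $(\kappa,\rho)$ model, with probability at least $1-\delta$, the output of AlgDAG satisfies all of: $\widehat V_{n_0}=V^F_{n_0}$; $\widehat E_{n_0}=E^F_{n_0}$; $|\widehat p(A)-p(A)|\le\varepsilon+n_0\rho$ for all $A\in V^F_{n_0}$; and $|\widehat e_{A\oplus z}-e_{A\oplus z}|\le\varepsilon/n_0+\rho$ for all $A\in V^F_{n_0}$ and $z\notin A$ with $A\cup\{z\}\in V^F_{n_0}$. 2. Let $\nu=\log_\alpha(1/2)>0$. There is a constant $c$ depending only on $\alpha$ such that, under the random $(\kappa,\rho)$ model, with probability at least $1-2\delta$ (over the random candidates and the consumers), both the total number of queries and the total computation time of AlgDAG are at most $$c\cdot\frac{K^{1+4\nu}\,n^{4+2\nu}\,\log(nK/\delta)}{\delta^{2\nu}\,\min(\varepsilon,\kappa)^2}.$$ -/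

import Mathlib

open Finset

noncomputable section

namespace ChoiceDAG

/-! ## Choice models and their DAG -/

/-- A ranking of the items `0, …, n-1`: `π i` is the item in (0-based) position `i`, so that
`π.symm x` is the position of the item `x`. -/
abbrev Ranking (n : ℕ) := Equiv.Perm (Fin n)

/-- The item that a consumer of type `π` chooses from the assortment `S`: the first item in the
order of `π` that belongs to `S` (`none` exactly when `S` is empty). -/
def choice {n : ℕ} (π : Ranking n) (S : Finset (Fin n)) : Option (Fin n) :=
  (List.ofFn π).find? (fun x => decide (x ∈ S))

/-- The set of the `j` most preferred items of `π`. -/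
def prefixSet {n : ℕ} (π : Ranking n) (j : ℕ) : Finset (Fin n) :=
  univ.filter fun x => (π.symm x : ℕ) < j

/-- `p(A)`: the probability that the `|A|` most preferred items are exactly those of `A`. -/
def nodeProb {n : ℕ} (p : PMF (Ranking n)) (A : Finset (Fin n)) : ℝ :=
  ∑ π ∈ univ.filter (fun π : Ranking n => prefixSet π A.card = A), (p π).toReal

/-- The edge probability from `A` to `A ∪ {z}`: the probability that the `|A|` most preferred
items are exactly those of `A` and that the next one is `z`. -/
def edgeProb {n : ℕ} (p : PMF (Ranking n)) (A : Finset (Fin n)) (z : Fin n) : ℝ :=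
  ∑ π ∈ univ.filter
    (fun π : Ranking n => prefixSet π A.card = A ∧ (π.symm z : ℕ) = A.card), (p π).toReal

/-- The nodes up to level `m` of the DAG of the rankings in `F`. -/
def frequentNodes {n : ℕ} (F : Finset (Ranking n)) (m : ℕ) : Set (Finset (Fin n)) :=
  {A | ∃ π ∈ F, ∃ j ≤ m, A = prefixSet π j}

/-- The edges up to level `m` of the DAG of the rankings in `F`. -/
def frequentEdges {n : ℕ} (F : Finset (Ranking n)) (m : ℕ) :
    Set (Finset (Fin n) × Finset (Fin n)) :=
  {e | ∃ π ∈ F, ∃ j < m, e = (prefixSet π j, prefixSet π (j + 1))}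

/-- The rare types: those of positive probability that are not frequent. -/
def rareTypes {n : ℕ} (F : Finset (Ranking n)) (p : PMF (Ranking n)) : Finset (Ranking n) :=
  univ.filter fun π => 0 < (p π).toReal ∧ π ∉ F

/-- The constraints on a choice model `p` with candidate frequent types `F₀` and frequent
types `F`. -/
structure IsModel {n : ℕ} (κ ρ : ℝ) (F₀ F : Finset (Ranking n)) (p : PMF (Ranking n)) : Prop where
  subset : F ⊆ F₀
  frequent : ∀ π ∈ F, κ ≤ (p π).toReal
  rare : ∀ π ∈ rareTypes F p, (p π).toReal < κ
  rare_total : ∑ π ∈ rareTypes F p, (p π).toReal ≤ ρ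

/-! ## Computations, with their steps, and programs that query consumers -/

/-- A deterministic computation: its value and the number of elementary steps it takes.
Elementary steps are those of a RAM with real registers (an arithmetic operation or a comparison
of two numbers, reading or writing one entry of an array). A set of items is an array of `n` bits:
testing whether an item belongs to it is one step; copying it or comparing it with another set
takes `n` steps. -/
structure Timed (α : Type) where
  val : α
  steps : ℕ

instance : Monad Timed where
  pure a := ⟨a, 0⟩
  bind t f := ⟨(f t.val).val, t.steps + (f t.val).steps⟩

/-- Go through a list and keep the entries that pass a test. -/
def Timed.filter {α : Type} (f : α → Timed Bool) : List α → Timed (List α)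
  | [] => ⟨[], 1⟩
  | a :: l =>
    ⟨if (f a).val then a :: (Timed.filter f l).val else (Timed.filter f l).val,
      (f a).steps + (Timed.filter f l).steps + 1⟩

/-- Adaptive programs: such a program halts with a value, makes an elementary step, or offers an
assortment to the next consumer and continues depending on her choice. -/
inductive Prog (n : ℕ) (α : Type) : Type
  | done (a : α)
  | step (k : Prog n α)
  | offer (S : Finset (Fin n)) (k : Option (Fin n) → Prog n α)

def Prog.bind {n : ℕ} {α β : Type} (x : Prog n α) (f : α → Prog n β) : Prog n β :=
  match x with
  | .done a => f a
  | .step k => .step (k.bind f)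
  | .offer S k => .offer S fun a => (k a).bind f

instance (n : ℕ) : Monad (Prog n) where
  pure := Prog.done
  bind := Prog.bind

/-- The result of a run: the value, the number of queries and the number of steps. -/
structure Outcome (α : Type) where
  val : α
  queries : ℕ
  steps : ℕ

/-- The law of the outcome when the types of the consumers are drawn independently from `p`, every
consumer being queried once. A query also counts as one step. -/
def Prog.run {n : ℕ} {α : Type} (p : PMF (Ranking n)) : Prog n α → PMF (Outcome α)
  | .done a => PMF.pure ⟨a, 0, 0⟩
  | .step k => (k.run p).map fun o => ⟨o.val, o.queries, o.steps + 1⟩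
  | .offer S k => p.bind fun π =>
      ((k (choice π S)).run p).map fun o => ⟨o.val, o.queries + 1, o.steps + 1⟩

/-- A deterministic computation as a program without queries. -/
def Timed.toProg {n : ℕ} {α : Type} (t : Timed α) : Prog n α :=
  Prog.step^[t.steps] (Prog.done t.val)

/-- Spend `k` steps. -/
def charge {n : ℕ} (k : ℕ) : Prog n Unit :=
  (⟨(), k⟩ : Timed Unit).toProg

/-- The probability of an event. -/
def prob {Ω : Type} (μ : PMF Ω) (E : Set Ω) : ℝ :=
  (μ.toOuterMeasure E).toReal

/-! ## The inclusion-exclusion algorithm -/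

/-- Is `A` a proper subset of `B`? -/
def properSubset {n : ℕ} (A B : Finset (Fin n)) : Timed Bool :=
  ⟨decide (A ⊂ B), n + 1⟩

/-- Is `B` a node of the graph whose nodes on level `i` form the `i`-th list of `levels`? The set
`B` is written down, its size is computed, and `B` is compared with all nodes on that level. -/
def findNode {n : ℕ} (levels : List (List (Finset (Fin n)))) (B : Finset (Fin n)) : Timed Bool :=
  ⟨decide (B ∈ levels.getD B.card []), n * ((levels.getD B.card []).length + 2) + 1⟩

/-- The nodes `A' ⊊ A` of the graph for which `A' ∪ {z}` is a node too. -/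
def interferers {n : ℕ} (levels : List (List (Finset (Fin n)))) (A : Finset (Fin n)) (z : Fin n) :
    Timed (List (Finset (Fin n))) :=
  Timed.filter
    (fun A' => do
      if ← properSubset A' A then findNode levels (insert z A') else pure false)
    levels.flatten

/-- An item `x` of `A` for which `A \ {x}` contains the largest number of the sets in `U` (the
smallest such item). The sets in `U` are subsets of `A`, so that `A'` is contained in `A \ {x}` if
and only if `x ∉ A'`. -/
def bestItem {n : ℕ} (A : Finset (Fin n)) (U : List (Finset (Fin n))) : Timed (Option (Fin n)) :=
  ⟨((List.finRange n).filter (fun x => x ∈ A)).argmax (fun x => U.countP (fun A' => x ∉ A')),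
    n * (2 * U.length + 2) + 1⟩

/-- Repeat at most `k` times, while `U` is not empty: select the set `A \ {x}` that covers the
largest number of the sets in `U` and remove these from `U`. -/
def greedyAux {n : ℕ} (A : Finset (Fin n)) :
    ℕ → List (Finset (Fin n)) → Timed (List (Finset (Fin n)))
  | 0, _ => ⟨[], 1⟩
  | _ + 1, [] => ⟨[], 1⟩
  | k + 1, B :: U => do
    match ← bestItem A (B :: U) with
    | none => pure []
    | some x =>
      let U' ← Timed.filter (fun A' => ⟨decide (x ∈ A'), 1⟩) (B :: U)
      let C ← greedyAux A k U'
      ⟨A.erase x :: C, n + 1⟩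

/-- The greedy set cover of `P` (a list of proper subsets of `A`) by sets `A \ {x}` with `x ∈ A`.
Every selected set covers at least one new set in `P`, so that `P.length` rounds suffice. -/
def greedyMinCover {n : ℕ} (A : Finset (Fin n)) (P : List (Finset (Fin n))) :
    Timed (List (Finset (Fin n))) :=
  greedyAux A P.length P

/-- Offer `S` to `m` consumers and count those who choose `z`. -/
def countChoices {n : ℕ} (S : Finset (Fin n)) (z : Fin n) : ℕ → Prog n ℕ
  | 0 => .done 0
  | m + 1 => .offer S fun a => .step
      ((countChoices S z m).bind fun c => .done (if a = some z then c + 1 else c))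

/-- The fraction of `m` consumers that choose `z` when they are offered `S`. -/
def frequency {n : ℕ} (S : Finset (Fin n)) (z : Fin n) (m : ℕ) : Prog n ℝ := do
  charge (n + 1)
  let c ← countChoices S z m
  return (c : ℝ) / (m : ℝ)

/-- The number of consumers per assortment for a set cover of size `c`. -/
def sampleSize (c : ℕ) (ε δ : ℝ) : ℕ :=
  ⌈(2 : ℝ) ^ (2 * (c : ℤ) - 1) * (Real.log (1 / δ) + (c + 1) * Real.log 2) / ε ^ 2⌉₊

/-- The estimate of the probability of the edge from `A` to `A ∪ {z}`: inclusion-exclusion over the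
nonempty subfamilies of a greedy set cover, with fresh consumers for every assortment. -/
def algIE {n : ℕ} (levels : List (List (Finset (Fin n)))) (A : Finset (Fin n)) (z : Fin n)
    (ε δ : ℝ) : Prog n ℝ := do
  let P ← (interferers levels A z).toProg
  let C ← (greedyMinCover A P).toProg
  charge (C.length + 1)
  let m := sampleSize C.length ε δ
  let q ← frequency (univ \ A) z m
  let s ← (C.sublists.filter (fun B => B ≠ [])).foldlM
    (fun (s : ℝ) B => do
      charge ((C.length + 1) * (n + 1))
      let qB ← frequency (univ \ B.foldr (· ∩ ·) univ) z m
      return s + (-1) ^ (B.length + 1) * qB) 0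
  return q - s

/-! ## The main algorithm -/

/-- An estimated DAG: the lists of nodes on the levels `0, 1, …`, the edges (the edge from `A` to
`A ∪ {z}` is recorded as `(A, z)`), the estimates of the node probabilities, and all computed
estimates of edge probabilities. -/
structure EstDAG (n : ℕ) where
  levels : List (List (Finset (Fin n)))
  edges : List (Finset (Fin n) × Fin n)
  nodeEst : Finset (Fin n) → ℝ
  edgeEst : Finset (Fin n) → Fin n → ℝ

def EstDAG.nodeSet {n : ℕ} (G : EstDAG n) : Set (Finset (Fin n)) :=
  {A | ∃ L ∈ G.levels, A ∈ L}

def EstDAG.edgeSet {n : ℕ} (G : EstDAG n) : Set (Finset (Fin n) × Finset (Fin n)) :=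
  {e | ∃ a ∈ G.edges, e = (a.1, insert a.2 a.1)}

/-- The graph with the empty set as its only node, of probability `1`, and without edges. -/
def EstDAG.start (n : ℕ) : EstDAG n where
  levels := [[∅]]
  edges := []
  nodeEst := fun A => if A = ∅ then 1 else 0
  edgeEst := fun _ _ => 0

/-- Record the estimate `e` for the edge from `A` to `A ∪ {z}`. If `e ≥ κ / 2`, then add `A ∪ {z}`
to the nodes `L` of the level under construction unless it is there already, add `e` to the
estimate for the node, and add the edge. -/
def addEdge {n : ℕ} (κ : ℝ) (A : Finset (Fin n)) (z : Fin n) (e : ℝ)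
    (s : EstDAG n × List (Finset (Fin n))) : EstDAG n × List (Finset (Fin n)) :=
  let G : EstDAG n :=
    { s.1 with edgeEst := Function.update s.1.edgeEst A (Function.update (s.1.edgeEst A) z e) }
  let L := s.2
  let B := insert z A
  if κ / 2 ≤ e then
    ({ G with
        edges := (A, z) :: G.edges
        nodeEst := Function.update G.nodeEst B ((if B ∈ L then G.nodeEst B else 0) + e) },
      if B ∈ L then L else B :: L)
  else (G, L)

/-- The adaptive algorithm for the levels `0, …, n₀` of the DAG of the frequent types. -/
def algDAG (n n₀ K : ℕ) (α κ ε δ : ℝ) : Prog n (EstDAG n) :=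
  (List.range n₀).foldlM
    (fun (G : EstDAG n) j => do
      let s ← (G.levels.getD j []).foldlM
        (fun (s : EstDAG n × List (Finset (Fin n))) A => do
          charge (n + 1)
          ((List.finRange n).filter (fun z => z ∉ A)).foldlM
            (fun (s : EstDAG n × List (Finset (Fin n))) z => do
              let e ← algIE G.levels A z (min (ε / n₀) (κ / 4)) (δ / (α * n ^ 2 * K))
              charge (n * (s.2.length + 2) + 1)
              return addEdge κ A z e s) s)
        (G, [])
      charge (j + 1)
      return { s.1 with levels := s.1.levels ++ [s.2] })
    (EstDAG.start n)

/-- The estimated DAG has exactly the nodes and edges of the frequent types up to level `n₀`, and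
its estimates for them are accurate. -/
structure IsAccurate {n : ℕ} (n₀ : ℕ) (ε ρ : ℝ) (F : Finset (Ranking n)) (p : PMF (Ranking n))
    (G : EstDAG n) : Prop where
  nodes : G.nodeSet = frequentNodes F n₀
  edges : G.edgeSet = frequentEdges F n₀
  nodeEst : ∀ A ∈ frequentNodes F n₀, |G.nodeEst A - nodeProb p A| ≤ ε + n₀ * ρ
  edgeEst : ∀ A ∈ frequentNodes F n₀, ∀ z ∉ A, insert z A ∈ frequentNodes F n₀ →
    |G.edgeEst A z - edgeProb p A z| ≤ ε / n₀ + ρ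

end ChoiceDAG

end

open ChoiceDAG

/-!
The choice probability of `z` under an assortment with complement `A` is the probability that all
items preferred to `z` belong to `A`. For sets `A \ {x}` that cover the interferers, that is, the
nodes `A' ⊊ A` for which `A' ∪ {z}` is a node too, inclusion-exclusion over these sets removes the
contributions of all edges from `A'` to `A' ∪ {z}`; what remains is the probability of the edge
from `A` to `A ∪ {z}`, up to the total probability `ρ` of the rare types
(`isGoodEstimate_inclExclValue`). The sampling error is controlled by Hoeffding's inequality
(`ensures_frequency`). Since `ρ < κ / 4` and the sampling error is at most `κ / 4`, the threshold
`κ / 2` recognizes the frequent edges, so that the levels are found exactly, one after the other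
(`LoopInv`, `LevelInv`). A union bound over the at most `n₀ · K · n` estimates, in the form of a
program logic with failure probabilities (`Prog.Ensures`), gives the first part. The same logic
bounds the steps of a successful run in terms of an upper bound for the sizes of the greedy set
covers (`ensures_algDAG`, `dagSteps_le_real`).

For the second part, a cover of size `c` costs about `8 ^ c` queries, so that `8 ^ c` must be of
order `X ^ (2 ν)` with `X = K² n / δ`; that is, `c` must be at most `(2 / 3) log X` in base `1 / α`,
up to a constant. A union bound for the largest interferer only gives `log X`, since one interferer
of that size may well exist. Five of them are much less likely: with `u = log X / 5`, it is unlikely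
that five further candidates have their first `3 u` items among the first `n₀` items of one
candidate and one further item, and it is unlikely that one candidate has its first `5 u` items
there (`toOuterMeasure_overlaps_le`). After `3 u` rounds of the greedy algorithm, all remaining sets
contain the `3 u` selected items, hence belong to at most four types, and form at most four chains of
at most `5 u` sets each. From then on every round removes at least a quarter of the remaining sets,
because an item outside the largest set of the longest chain is missing from that entire chain. So
the number of further rounds is logarithmic in `u`, and at most `u / 3` up to a constant
(`coverBound_of_fewOverlaps`, `exists_log_bound`); in total `3 c ≤ 10 u + O(1)`. A factor `1 / κ²`
of the time bound pays for the square of the number of frequent types, which is at most `1 / κ`.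
-/

namespace ChoiceDAG

open scoped ENNReal

/-! ### Expectations under discrete laws -/

/-- The expectation of a nonnegative function under a discrete law. -/
noncomputable def expect {Ω : Type} (μ : PMF Ω) (g : Ω → ℝ≥0∞) : ℝ≥0∞ := ∑' a, μ a * g a

lemma expect_pure {Ω : Type} (a : Ω) (g : Ω → ℝ≥0∞) : expect (PMF.pure a) g = g a := by
  classical
  unfold expect
  rw [tsum_eq_single a]
  · simp
  · intro b hb
    simp [PMF.pure_apply, hb]

lemma expect_bind {Ω Ω' : Type} (μ : PMF Ω) (f : Ω → PMF Ω') (g : Ω' → ℝ≥0∞) :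
    expect (μ.bind f) g = expect μ fun a => expect (f a) g := by
  unfold expect
  simp only [PMF.bind_apply, ← ENNReal.tsum_mul_right, ← ENNReal.tsum_mul_left]
  rw [ENNReal.tsum_comm]
  simp only [mul_assoc]

lemma expect_map {Ω Ω' : Type} (μ : PMF Ω) (f : Ω → Ω') (g : Ω' → ℝ≥0∞) :
    expect (μ.map f) g = expect μ fun a => g (f a) := by
  rw [← PMF.bind_pure_comp, expect_bind]
  simp only [Function.comp, expect_pure]

lemma expect_mono {Ω : Type} (μ : PMF Ω) {g h : Ω → ℝ≥0∞} (H : ∀ a, g a ≤ h a) :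
    expect μ g ≤ expect μ h :=
  ENNReal.tsum_le_tsum fun a => by gcongr; exact H a

lemma expect_const {Ω : Type} (μ : PMF Ω) (c : ℝ≥0∞) : expect μ (fun _ => c) = c := by
  unfold expect
  rw [ENNReal.tsum_mul_right, μ.tsum_coe, one_mul]

lemma expect_mul_right {Ω : Type} (μ : PMF Ω) (g : Ω → ℝ≥0∞) (c : ℝ≥0∞) :
    expect μ (fun a => g a * c) = expect μ g * c := by
  unfold expect
  rw [← ENNReal.tsum_mul_right]
  simp only [mul_assoc]

lemma expect_add {Ω : Type} (μ : PMF Ω) (g h : Ω → ℝ≥0∞) :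
    expect μ (fun a => g a + h a) = expect μ g + expect μ h := by
  unfold expect
  rw [← ENNReal.tsum_add]
  simp only [mul_add]

lemma toOuterMeasure_eq_expect {Ω : Type} (μ : PMF Ω) (E : Set Ω) :
    μ.toOuterMeasure E = expect μ (E.indicator 1) := by
  classical
  rw [PMF.toOuterMeasure_apply]
  refine tsum_congr fun a => ?_
  by_cases h : a ∈ E <;> simp [h]

lemma toOuterMeasure_le_expect {Ω : Type} (μ : PMF Ω) {E : Set Ω} {g : Ω → ℝ≥0∞}
    (h : ∀ a ∈ E, 1 ≤ g a) : μ.toOuterMeasure E ≤ expect μ g := by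
  classical
  rw [toOuterMeasure_eq_expect]
  refine expect_mono μ fun a => ?_
  by_cases ha : a ∈ E
  · simpa [ha] using h a ha
  · simp [ha]

lemma toOuterMeasure_le_one {Ω : Type} (μ : PMF Ω) (E : Set Ω) : μ.toOuterMeasure E ≤ 1 := by
  rw [← expect_const μ 1]
  exact toOuterMeasure_le_expect μ fun _ _ => le_rfl

lemma one_sub_le_prob {Ω : Type} (μ : PMF Ω) {E : Set Ω} {η : ℝ} (hη : 0 ≤ η)
    (h : μ.toOuterMeasure Eᶜ ≤ ENNReal.ofReal η) : 1 - η ≤ prob μ E := by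
  have h1 : (1 : ℝ≥0∞) ≤ μ.toOuterMeasure E + μ.toOuterMeasure Eᶜ := by
    rw [toOuterMeasure_eq_expect, toOuterMeasure_eq_expect, ← expect_add]
    refine (expect_const μ 1).symm.le.trans (expect_mono μ fun a => ?_)
    by_cases ha : a ∈ E <;> simp [ha]
  have hE : μ.toOuterMeasure E ≠ ⊤ :=
    ne_top_of_le_ne_top ENNReal.one_ne_top (toOuterMeasure_le_one μ E)
  have h2 : (1 : ℝ≥0∞) ≤ μ.toOuterMeasure E + ENNReal.ofReal η := h1.trans (by gcongr)
  have h3 := ENNReal.toReal_mono (by simp [hE]) h2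
  rw [ENNReal.toReal_add hE (by simp), ENNReal.toReal_ofReal hη] at h3
  unfold prob
  simpa [sub_le_iff_le_add] using h3

/-! ### A program logic with failure probabilities -/

lemma Prog.run_bind {n : ℕ} {α β : Type} (p : PMF (Ranking n)) (x : Prog n α)
    (f : α → Prog n β) :
    (x.bind f).run p = (x.run p).bind fun o =>
      ((f o.val).run p).map fun o' => ⟨o'.val, o.queries + o'.queries, o.steps + o'.steps⟩ := by
  induction x with
  | done a =>
    simp only [Prog.bind, Prog.run, PMF.pure_bind]
    simp only [zero_add]
    exact (PMF.map_id _).symm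
  | step k ih =>
    simp only [Prog.bind, Prog.run, ih, PMF.map_bind, PMF.bind_map, PMF.map_comp,
      Function.comp_def]
    simp only [add_right_comm]
  | offer S k ih =>
    simp only [Prog.bind, Prog.run, ih, PMF.map_bind, PMF.bind_bind, PMF.bind_map, PMF.map_comp,
      Function.comp_def]
    simp only [add_right_comm]

/-- The event that a run returns a value with the property `Q` within `T` steps and makes at most
as many queries as steps. -/
def Success {α : Type} (Q : α → Prop) (T : ℕ) : Set (Outcome α) :=
  {o | Q o.val ∧ o.queries ≤ o.steps ∧ o.steps ≤ T}

/-- Except with probability at most `η`, the program `x` returns a value with the property `Q`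
within `T` steps (and makes at most as many queries as steps). -/
def Prog.Ensures {n : ℕ} {α : Type} (p : PMF (Ranking n)) (x : Prog n α) (Q : α → Prop) (T : ℕ)
    (η : ℝ≥0∞) : Prop :=
  (x.run p).toOuterMeasure (Success Q T)ᶜ ≤ η

namespace Prog.Ensures

variable {n : ℕ} {α β : Type} {p : PMF (Ranking n)}

lemma mono {x : Prog n α} {Q Q' : α → Prop} {T T' : ℕ} {η η' : ℝ≥0∞}
    (h : x.Ensures p Q T η) (hQ : ∀ a, Q a → Q' a) (hT : T ≤ T') (hη : η ≤ η') :
    x.Ensures p Q' T' η' := by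
  refine le_trans (MeasureTheory.measure_mono ?_) (h.trans hη)
  intro o ho ho'
  exact ho ⟨hQ _ ho'.1, ho'.2.1, ho'.2.2.trans hT⟩

lemma of_eq {x : Prog n α} {Q : α → Prop} {T : ℕ} {o : Outcome α} (hx : x.run p = PMF.pure o)
    (hQ : Q o.val) (hq : o.queries ≤ o.steps) (hT : o.steps ≤ T) : x.Ensures p Q T 0 := by
  unfold Prog.Ensures
  rw [hx, PMF.toOuterMeasure_pure_apply, if_neg]
  exact fun h => h ⟨hQ, hq, hT⟩

lemma pure {a : α} {Q : α → Prop} (h : Q a) : (Pure.pure a : Prog n α).Ensures p Q 0 0 :=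
  of_eq (o := ⟨a, 0, 0⟩) rfl h le_rfl le_rfl

lemma toProg {t : Timed α} {T : ℕ} (hT : t.steps ≤ T) :
    (t.toProg : Prog n α).Ensures p (fun a => a = t.val) T 0 := by
  have key : ∀ k : ℕ, (Prog.step^[k] (Prog.done t.val) : Prog n α).run p
      = PMF.pure ⟨t.val, 0, k⟩ := by
    intro k
    induction k with
    | zero => rfl
    | succ k ih =>
      rw [Function.iterate_succ_apply', Prog.run, ih, PMF.pure_map]
  exact of_eq (key _) rfl (Nat.zero_le _) hT

lemma bind {x : Prog n α} {f : α → Prog n β} {Q : α → Prop} {R : β → Prop} {T T' : ℕ}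
    {η η' : ℝ≥0∞} (hx : x.Ensures p Q T η) (hf : ∀ a, Q a → (f a).Ensures p R T' η') :
    (x >>= f).Ensures p R (T + T') (η + η') := by
  classical
  change (x.bind f).Ensures p R (T + T') (η + η')
  unfold Prog.Ensures at *
  rw [Prog.run_bind, PMF.toOuterMeasure_bind_apply]
  have h1 : ∀ o : Outcome α,
      (((f o.val).run p).map fun o' =>
        (⟨o'.val, o.queries + o'.queries, o.steps + o'.steps⟩ : Outcome β)).toOuterMeasure
          (Success R (T + T'))ᶜ ≤ (Success Q T)ᶜ.indicator 1 o + η' := by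
    intro o
    by_cases ho : o ∈ Success Q T
    · rw [PMF.toOuterMeasure_map_apply]
      refine le_trans (le_trans (MeasureTheory.measure_mono ?_) (hf o.val ho.1)) le_add_self
      intro o' h h'
      refine h ⟨h'.1, ?_, ?_⟩
      · exact add_le_add ho.2.1 h'.2.1
      · exact add_le_add ho.2.2 h'.2.2
    · refine (toOuterMeasure_le_one _ _).trans ?_
      simp [ho]
  refine (expect_mono (x.run p) h1).trans ?_
  rw [expect_add, expect_const, ← toOuterMeasure_eq_expect]
  gcongr

/-- The rule for loops. The invariant may depend on the entries that were processed already. -/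
lemma foldlM {σ : Type} {f : σ → β → Prog n σ} {T : ℕ} {η : ℝ≥0∞} (I : List β → σ → Prop)
    (l : List β)
    (h : ∀ l₁ b l₂ s, l = l₁ ++ b :: l₂ → I l₁ s → (f s b).Ensures p (I (l₁ ++ [b])) T η)
    {s : σ} (hs : I [] s) :
    (l.foldlM f s).Ensures p (I l) (l.length * T) (l.length * η) := by
  have key : ∀ (l₂ l₁ : List β) (s : σ), l = l₁ ++ l₂ → I l₁ s →
      (l₂.foldlM f s).Ensures p (I l) (l₂.length * T) (l₂.length * η) := by
    intro l₂
    induction l₂ with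
    | nil =>
      intro l₁ s hl hI
      have : l₁ = l := by simpa using hl.symm
      subst this
      simpa using pure (n := n) (p := p) hI
    | cons b l₂ ih =>
      intro l₁ s hl hI
      rw [List.foldlM_cons]
      refine (bind (h l₁ b l₂ s hl hI) fun s' hs' => ih (l₁ ++ [b]) s' (by simp [hl]) hs').mono
        (fun _ h => h) ?_ ?_
      · simp only [List.length_cons]; ring_nf; exact le_rfl
      · simp only [List.length_cons, Nat.cast_add, Nat.cast_one]; ring_nf; exact le_rfl
  exact key l [] s rfl hs

end Prog.Ensures

lemma ensures_charge {n : ℕ} {p : PMF (Ranking n)} {k T : ℕ} (h : k ≤ T) :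
    (charge k : Prog n Unit).Ensures p (fun _ => True) T 0 :=
  (Prog.Ensures.toProg (t := ⟨(), k⟩) h).mono (fun _ _ => trivial) le_rfl le_rfl

/-! ### Choice frequencies -/

/-- The probability that a random consumer who is offered `S` chooses `z`. -/
noncomputable def choiceProb {n : ℕ} (p : PMF (Ranking n)) (S : Finset (Fin n)) (z : Fin n) : ℝ :=
  ∑ π : Ranking n, (p π).toReal * (if choice π S = some z then 1 else 0)

lemma sum_toReal_eq_one {n : ℕ} (p : PMF (Ranking n)) : ∑ π, (p π).toReal = 1 := by
  rw [← ENNReal.toReal_sum fun π _ => p.apply_ne_top π]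
  have h := p.tsum_coe
  rw [tsum_fintype] at h
  rw [h, ENNReal.toReal_one]

/-- Hoeffding's lemma for an indicator. -/
lemma expect_exp_le {n : ℕ} (p : PMF (Ranking n)) (S : Finset (Fin n)) (z : Fin n) (s : ℝ) :
    expect p (fun π => ENNReal.ofReal
      (Real.exp (s * ((if choice π S = some z then 1 else 0) - choiceProb p S z))))
      ≤ ENNReal.ofReal (Real.exp (s ^ 2 / 8)) := by
  let _ : MeasurableSpace (Ranking n) := ⊤
  have _ : MeasurableSingletonClass (Ranking n) := ⟨fun _ => trivial⟩
  set X : Ranking n → ℝ := fun π => if choice π S = some z then 1 else 0 with hX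
  have hm : Measurable X := fun _ _ => trivial
  have hint : ∀ f : Ranking n → ℝ, ∫ π, f π ∂p.toMeasure = ∑ π, (p π).toReal * f π := by
    intro f
    rw [PMF.integral_eq_sum]
    simp
  have h := ProbabilityTheory.hasSubgaussianMGF_of_mem_Icc (μ := p.toMeasure) (X := X)
    (a := 0) (b := 1) hm.aemeasurable
    (Filter.Eventually.of_forall fun π => by
      by_cases h : choice π S = some z <;> simp [hX, h])
  have h2 := h.mgf_le s
  rw [ProbabilityTheory.mgf, hint, hint] at h2
  have h3 : expect p (fun π => ENNReal.ofReal (Real.exp (s * (X π - choiceProb p S z))))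
      = ENNReal.ofReal (∑ π, (p π).toReal * Real.exp (s * (X π - choiceProb p S z))) := by
    unfold expect
    rw [tsum_fintype, ENNReal.ofReal_sum_of_nonneg fun _ _ => by positivity]
    refine Finset.sum_congr rfl fun π _ => ?_
    rw [ENNReal.ofReal_mul ENNReal.toReal_nonneg, ENNReal.ofReal_toReal (p.apply_ne_top π)]
  change expect p (fun π => ENNReal.ofReal (Real.exp (s * (X π - choiceProb p S z)))) ≤ _
  rw [h3]
  refine ENNReal.ofReal_le_ofReal (h2.trans (le_of_eq ?_))
  congr 1
  simp
  ring

/-- Hoeffding's bound on the moment generating function of the number of choices. -/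
lemma expect_countChoices_le {n : ℕ} (p : PMF (Ranking n)) (S : Finset (Fin n)) (z : Fin n)
    (s : ℝ) (m : ℕ) :
    expect ((countChoices S z m).run p) (fun o => ENNReal.ofReal
      (Real.exp (s * ((o.val : ℝ) - m * choiceProb p S z))))
      ≤ ENNReal.ofReal (Real.exp (m * (s ^ 2 / 8))) := by
  induction m with
  | zero => simp [countChoices, Prog.run, expect_pure]
  | succ m ih =>
    simp only [countChoices, Prog.run, Prog.run_bind, expect_bind, expect_map, expect_pure]
    have h1 : ∀ (π : Ranking n) (o : Outcome ℕ),
        ENNReal.ofReal (Real.exp (s *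
          (((if choice π S = some z then o.val + 1 else o.val : ℕ) : ℝ)
            - (m + 1 : ℕ) * choiceProb p S z)))
        = ENNReal.ofReal (Real.exp (s * ((o.val : ℝ) - m * choiceProb p S z))) *
          ENNReal.ofReal (Real.exp
            (s * ((if choice π S = some z then 1 else 0) - choiceProb p S z))) := by
      intro π o
      rw [← ENNReal.ofReal_mul (Real.exp_pos _).le, ← Real.exp_add]
      congr 2
      split_ifs <;> push_cast <;> ring
    simp only [h1, expect_mul_right]
    simp only [mul_comm (expect ((countChoices S z m).run p) _), expect_mul_right]
    refine (mul_le_mul' (expect_exp_le p S z s) ih).trans (le_of_eq ?_)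
    rw [← ENNReal.ofReal_mul (Real.exp_pos _).le, ← Real.exp_add]
    congr 2
    push_cast
    ring

lemma ensures_countChoices_steps {n : ℕ} (p : PMF (Ranking n)) (S : Finset (Fin n)) (z : Fin n)
    (m : ℕ) : (countChoices S z m).Ensures p (fun _ => True) (2 * m) 0 := by
  induction m with
  | zero => exact Prog.Ensures.pure (n := n) (p := p) trivial
  | succ m ih =>
    unfold Prog.Ensures at *
    simp only [countChoices, Prog.run, Prog.run_bind, PMF.toOuterMeasure_bind_apply,
      PMF.map_bind, PMF.pure_map]
    simp only [nonpos_iff_eq_zero, ENNReal.tsum_eq_zero, mul_eq_zero] at *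
    intro π
    right
    intro o
    by_cases ho : o ∈ Success (fun _ => True) (2 * m)
    · right
      rw [PMF.toOuterMeasure_pure_apply, if_neg]
      obtain ⟨-, h1, h2⟩ := ho
      simp only [Success, Set.mem_compl_iff, Set.mem_ofPred_eq, not_not, true_and]
      omega
    · left
      rw [PMF.toOuterMeasure_apply, ENNReal.tsum_eq_zero] at ih
      simpa [ho] using ih o

/-- Hoeffding's inequality for the observed choice frequency. -/
lemma ensures_frequency {n : ℕ} (p : PMF (Ranking n)) (S : Finset (Fin n)) (z : Fin n)
    {m : ℕ} (hm : 0 < m) {η : ℝ} (hη : 0 < η) :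
    (frequency S z m).Ensures p (fun v => |v - choiceProb p S z| ≤ η) (n + 1 + 2 * m)
      (ENNReal.ofReal (2 * Real.exp (-(2 * m * η ^ 2)))) := by
  have hm' : (0 : ℝ) < m := by exact_mod_cast hm
  have hcount : (countChoices S z m).Ensures p
      (fun c => |(c : ℝ) - m * choiceProb p S z| ≤ m * η) (2 * m)
      (ENNReal.ofReal (2 * Real.exp (-(2 * m * η ^ 2)))) := by
    -- one side of Chernoff's bound, with the optimal parameter `± 4 η`
    have side : ∀ s : ℝ, s ^ 2 = 16 * η ^ 2 → ((countChoices S z m).run p).toOuterMeasure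
        {o | 4 * (m * η ^ 2) < s * ((o.val : ℝ) - m * choiceProb p S z)}
          ≤ ENNReal.ofReal (Real.exp (-(2 * m * η ^ 2))) := by
      intro s hs
      refine (toOuterMeasure_le_expect (g := fun o => ENNReal.ofReal
        (Real.exp (s * ((o.val : ℝ) - m * choiceProb p S z))) *
          ENNReal.ofReal (Real.exp (-(4 * (m * η ^ 2))))) _ ?_).trans ?_
      · intro o ho
        rw [← ENNReal.ofReal_mul (Real.exp_pos _).le, ← Real.exp_add, ENNReal.one_le_ofReal]
        refine Real.one_le_exp ?_
        have : 4 * (m * η ^ 2) < s * ((o.val : ℝ) - m * choiceProb p S z) := ho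
        linarith
      · rw [expect_mul_right]
        refine (mul_le_mul' (expect_countChoices_le p S z s m) le_rfl).trans (le_of_eq ?_)
        rw [← ENNReal.ofReal_mul (Real.exp_pos _).le, ← Real.exp_add, hs]
        congr 2
        ring
    have htime := ensures_countChoices_steps p S z m
    unfold Prog.Ensures at *
    have hsub : (Success (fun c : ℕ => |(c : ℝ) - m * choiceProb p S z| ≤ m * η) (2 * m))ᶜ ⊆
        (Success (fun _ : ℕ => True) (2 * m))ᶜ ∪
        ({o | 4 * (m * η ^ 2) < (4 * η) * ((o.val : ℝ) - m * choiceProb p S z)} ∪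
         {o | 4 * (m * η ^ 2) < (-(4 * η)) * ((o.val : ℝ) - m * choiceProb p S z)}) := by
      intro o ho
      by_contra hc
      simp only [Set.mem_union, Set.mem_compl_iff, not_or, not_not, Set.mem_ofPred_eq,
        not_lt] at hc
      obtain ⟨⟨-, h1, h2⟩, h3, h4⟩ := hc
      refine ho ⟨?_, h1, h2⟩
      change |(o.val : ℝ) - m * choiceProb p S z| ≤ m * η
      rw [abs_le]
      constructor
      · by_contra h; push Not at h; nlinarith
      · by_contra h; push Not at h; nlinarith
    refine (MeasureTheory.measure_mono hsub).trans ((MeasureTheory.measure_union_le _ _).trans ?_)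
    refine (add_le_add htime ((MeasureTheory.measure_union_le _ _).trans
      (add_le_add (side _ (by ring)) (side _ (by ring))))).trans (le_of_eq ?_)
    rw [zero_add, ← ENNReal.ofReal_add (Real.exp_pos _).le (Real.exp_pos _).le]
    congr 1
    ring
  unfold frequency
  refine (Prog.Ensures.bind (ensures_charge (le_refl (n + 1))) fun _ _ =>
    Prog.Ensures.bind hcount fun c hc => Prog.Ensures.pure (Q := fun v =>
      |v - choiceProb p S z| ≤ η) ?_).mono (fun _ h => h) (by omega) (by simp)
  have : (c : ℝ) / m - choiceProb p S z = ((c : ℝ) - m * choiceProb p S z) / m := by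
    field_simp
  rw [this, abs_div, abs_of_pos hm', div_le_iff₀ hm']
  linarith

/-! ### Prefixes of rankings and choices -/

lemma mem_prefixSet {n : ℕ} {π : Ranking n} {j : ℕ} {x : Fin n} :
    x ∈ prefixSet π j ↔ (π.symm x : ℕ) < j := by
  simp [prefixSet]

lemma card_prefixSet {n : ℕ} (π : Ranking n) {j : ℕ} (hj : j ≤ n) : (prefixSet π j).card = j := by
  have : prefixSet π j = ((univ : Finset (Fin n)).filter fun i : Fin n => (i : ℕ) < j).map
      π.toEmbedding := by
    ext x
    simp only [mem_prefixSet, Finset.mem_map_equiv, Finset.mem_filter, Finset.mem_univ, true_and]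
  rw [this, Finset.card_map, Fin.card_filter_val_lt]
  exact min_eq_right hj

lemma prefixSet_mono {n : ℕ} (π : Ranking n) {i j : ℕ} (h : i ≤ j) :
    prefixSet π i ⊆ prefixSet π j := by
  intro x
  simp only [mem_prefixSet]
  omega

lemma prefixSet_zero {n : ℕ} (π : Ranking n) : prefixSet π 0 = ∅ := by
  ext x; simp [mem_prefixSet]

lemma prefixSet_succ {n : ℕ} (π : Ranking n) {z : Fin n} {j : ℕ} (h : (π.symm z : ℕ) = j) :
    prefixSet π (j + 1) = insert z (prefixSet π j) := by
  ext x
  simp only [mem_prefixSet, Finset.mem_insert]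
  constructor
  · intro hx
    by_cases hxj : (π.symm x : ℕ) < j
    · exact Or.inr hxj
    · left
      apply π.symm.injective
      apply Fin.ext
      omega
  · rintro (rfl | hx) <;> omega

lemma choice_eq_some_iff {n : ℕ} {π : Ranking n} {S : Finset (Fin n)} {z : Fin n} :
    choice π S = some z ↔ z ∈ S ∧ ∀ y ∈ prefixSet π (π.symm z), y ∉ S := by
  unfold choice
  rw [List.find?_eq_some_iff_getElem]
  simp only [decide_eq_true_eq, List.getElem_ofFn, Bool.not_eq_true', decide_eq_false_iff_not,
    List.length_ofFn, mem_prefixSet]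
  refine and_congr_right fun _ => ?_
  constructor
  · rintro ⟨i, hi, rfl, h⟩ y hy
    have := h (π.symm y) (by simpa using hy)
    simpa using this
  · intro h
    refine ⟨π.symm z, (π.symm z).2, by simp, fun j hj => h _ ?_⟩
    simpa using hj

lemma choice_sdiff_eq_some_iff {n : ℕ} {π : Ranking n} {A : Finset (Fin n)} {z : Fin n}
    (hz : z ∉ A) : choice π (univ \ A) = some z ↔ prefixSet π (π.symm z) ⊆ A := by
  rw [choice_eq_some_iff]
  simp [hz, Finset.subset_iff]

/-! ### Timed computations -/

section Timed

variable {α β : Type}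

lemma Timed.val_bind (t : Timed α) (f : α → Timed β) : (t >>= f).val = (f t.val).val := rfl

lemma Timed.steps_bind (t : Timed α) (f : α → Timed β) :
    (t >>= f).steps = t.steps + (f t.val).steps := rfl

lemma Timed.val_pure (a : α) : (pure a : Timed α).val = a := rfl

lemma Timed.steps_pure (a : α) : (pure a : Timed α).steps = 0 := rfl

lemma Timed.val_filter (f : α → Timed Bool) (l : List α) :
    (Timed.filter f l).val = l.filter fun a => (f a).val := by
  induction l with
  | nil => rfl
  | cons a l ih => simp [Timed.filter, List.filter_cons, ih]

lemma Timed.steps_filter_le (f : α → Timed Bool) {s : ℕ} (hf : ∀ a, (f a).steps ≤ s)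
    (l : List α) : (Timed.filter f l).steps ≤ l.length * (s + 1) + 1 := by
  induction l with
  | nil => simp [Timed.filter]
  | cons a l ih =>
    have := hf a
    simp only [Timed.filter, List.length_cons]
    nlinarith

end Timed

lemma mem_interferers {n : ℕ} {levels : List (List (Finset (Fin n)))} {A A' : Finset (Fin n)}
    {z : Fin n} : A' ∈ (interferers levels A z).val ↔ A' ∈ levels.flatten ∧ A' ⊂ A ∧
      insert z A' ∈ levels.getD (insert z A').card [] := by
  unfold interferers
  rw [Timed.val_filter, List.mem_filter]
  refine and_congr_right fun _ => ?_
  by_cases h : A' ⊂ A <;> simp [Timed.val_bind, properSubset, findNode, h, Timed.val_pure]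

lemma length_interferers_le {n : ℕ} (levels : List (List (Finset (Fin n))))
    (A : Finset (Fin n)) (z : Fin n) :
    (interferers levels A z).val.length ≤ levels.flatten.length := by
  unfold interferers
  rw [Timed.val_filter]
  exact List.length_filter_le _ _

lemma steps_interferers_le {n : ℕ} {levels : List (List (Finset (Fin n)))} {f : ℕ}
    (hf : ∀ i, (levels.getD i []).length ≤ f) (A : Finset (Fin n)) (z : Fin n) :
    (interferers levels A z).steps ≤ levels.flatten.length * (n * (f + 3) + 3) + 1 := by
  refine (Timed.steps_filter_le _ (s := n * (f + 3) + 2) (fun A' => ?_) _).trans (le_refl _)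
  have h := Nat.mul_le_mul_left n (Nat.add_le_add_right (hf (insert z A').card) 2)
  rw [Timed.steps_bind]
  by_cases hA : A' ⊂ A <;> simp only [properSubset, hA, decide_true, decide_false, if_true,
    Bool.false_eq_true, if_false, findNode, Timed.steps_pure] <;> nlinarith

/-! ### The greedy set cover -/

/-- As long as sets remain, the selected item exists, is optimal, and is missing from some set. -/
lemma bestItem_spec {n : ℕ} {A : Finset (Fin n)} {U : List (Finset (Fin n))}
    (hU : ∀ A' ∈ U, A' ⊂ A) (hne : U ≠ []) :
    ∃ x ∈ A, (bestItem A U).val = some x ∧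
      (∀ y ∈ A, U.countP (fun A' => y ∉ A') ≤ U.countP (fun A' => x ∉ A')) ∧
      ∃ A' ∈ U, x ∉ A' := by
  obtain ⟨B, hB⟩ := List.exists_mem_of_ne_nil U hne
  obtain ⟨y, hyA, hyB⟩ := Finset.exists_of_ssubset (hU B hB)
  have hmem : ∀ {y}, y ∈ A → y ∈ (List.finRange n).filter (fun x => x ∈ A) := by
    intro y hy; simp [hy]
  cases h : (bestItem A U).val with
  | none =>
    have h' := List.argmax_eq_none.1 h
    have := hmem hyA
    rw [h'] at this
    simp at this
  | some x =>
    have hx : x ∈ A := by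
      have := List.argmax_mem h
      simpa using this
    have hbest : ∀ y ∈ A, U.countP (fun A' => y ∉ A') ≤ U.countP (fun A' => x ∉ A') :=
      fun y hy => List.le_of_mem_argmax (hmem hy) h
    refine ⟨x, hx, rfl, hbest, ?_⟩
    have h1 : 0 < U.countP (fun A' => y ∉ A') := List.countP_pos_iff.2 ⟨B, hB, by simpa using hyB⟩
    obtain ⟨A', hA', hxA'⟩ := List.countP_pos_iff.1 (h1.trans_le (hbest y hyA))
    exact ⟨A', hA', by simpa using hxA'⟩

lemma greedyAux_of_bestItem {n : ℕ} {A : Finset (Fin n)} {U : List (Finset (Fin n))} {k : ℕ}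
    {x : Fin n} (hne : U ≠ []) (hx : (bestItem A U).val = some x) :
    (greedyAux A (k + 1) U).val
      = A.erase x :: (greedyAux A k (U.filter fun A' => x ∈ A')).val ∧
    (greedyAux A (k + 1) U).steps
      ≤ (n * (2 * U.length + 3) + 2 * U.length + 3)
        + (greedyAux A k (U.filter fun A' => x ∈ A')).steps := by
  obtain ⟨B, U, rfl⟩ := List.exists_cons_of_ne_nil hne
  rw [greedyAux, Timed.val_bind, Timed.steps_bind, hx]
  simp only [Timed.val_bind, Timed.steps_bind, Timed.val_filter, true_and]
  have h := Timed.steps_filter_le (fun A' => (⟨decide (x ∈ A'), 1⟩ : Timed Bool)) (s := 1)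
    (fun _ => le_rfl) (B :: U)
  have hb : (bestItem A (B :: U)).steps = n * (2 * (B :: U).length + 2) + 1 := rfl
  rw [hb]
  nlinarith

lemma greedyAux_nil {n : ℕ} (A : Finset (Fin n)) (k : ℕ) : greedyAux A k [] = ⟨[], 1⟩ := by
  cases k <;> rfl

lemma length_filter_lt {n : ℕ} {U : List (Finset (Fin n))} {x : Fin n}
    (h : ∃ A' ∈ U, x ∉ A') : (U.filter fun A' => x ∈ A').length < U.length := by
  obtain ⟨A', hA', hx⟩ := h
  exact List.length_filter_lt_length_iff_exists.2 ⟨A', hA', by simpa using hx⟩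

lemma greedyAux_spec {n : ℕ} {A : Finset (Fin n)} (k : ℕ) (U : List (Finset (Fin n)))
    (hU : ∀ A' ∈ U, A' ⊂ A) (hk : U.length ≤ k) :
    (∀ C ∈ (greedyAux A k U).val, ∃ x ∈ A, C = A.erase x) ∧
    (∀ A' ∈ U, ∃ C ∈ (greedyAux A k U).val, A' ⊆ C) ∧
    (∀ N, U.length ≤ N → (greedyAux A k U).steps ≤
      (greedyAux A k U).val.length * (n * (2 * N + 3) + 2 * N + 3) + 1) := by
  induction k generalizing U with
  | zero =>
    obtain rfl : U = [] := List.length_eq_zero_iff.1 (by omega)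
    simp [greedyAux_nil]
  | succ k ih =>
    by_cases hne : U = []
    · subst hne
      simp [greedyAux_nil]
    · obtain ⟨x, hxA, hx, -, hex⟩ := bestItem_spec hU hne
      obtain ⟨hval, hsteps⟩ := greedyAux_of_bestItem (k := k) hne hx
      have hlt := length_filter_lt hex
      obtain ⟨h1, h2, h3⟩ := ih (U.filter fun A' => x ∈ A')
        (fun A' hA' => hU A' (List.mem_filter.1 hA').1) (by omega)
      rw [hval]
      refine ⟨?_, ?_, ?_⟩
      · intro C hC
        rcases List.mem_cons.1 hC with rfl | hC
        · exact ⟨x, hxA, rfl⟩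
        · exact h1 C hC
      · intro A' hA'
        by_cases hxA' : x ∈ A'
        · obtain ⟨C, hC, h⟩ := h2 A' (List.mem_filter.2 ⟨hA', by simpa using hxA'⟩)
          exact ⟨C, List.mem_cons_of_mem _ hC, h⟩
        · exact ⟨_, List.mem_cons_self, Finset.subset_erase.2 ⟨(hU A' hA').1, hxA'⟩⟩
      · intro N hN
        have h4 := h3 N (by omega)
        have h5 : n * (2 * U.length + 3) ≤ n * (2 * N + 3) := Nat.mul_le_mul_left _ (by omega)
        rw [List.length_cons, add_one_mul]
        omega

/-! ### Inclusion-exclusion -/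

lemma foldr_inter_subset_iff {n : ℕ} {B : List (Finset (Fin n))} {D : Finset (Fin n)} :
    D ⊆ B.foldr (· ∩ ·) univ ↔ ∀ C ∈ B, D ⊆ C := by
  induction B with
  | nil => simp
  | cons C B ih => simp [Finset.subset_inter_iff, ih]

/-- Inclusion-exclusion: the alternating sum over all subfamilies of `C` of the indicators that
`D` is contained in all members vanishes if `D` is contained in some member of `C`, and is `1`
otherwise. -/
lemma sum_sublists_indicator {n : ℕ} (C : List (Finset (Fin n))) (D : Finset (Fin n)) :
    (C.sublists.map fun B => (-1 : ℝ) ^ B.length * (if ∀ E ∈ B, D ⊆ E then 1 else 0)).sum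
      = if ∃ E ∈ C, D ⊆ E then 0 else 1 := by
  rw [(C.sublists_perm_sublists'.map _).sum_eq]
  induction C with
  | nil => simp
  | cons E C ih =>
    rw [List.sublists'_cons, List.map_append, List.sum_append, ih, List.map_map]
    by_cases hE : D ⊆ E
    · have : (fun B : List (Finset (Fin n)) =>
          (-1 : ℝ) ^ B.length * (if ∀ E ∈ B, D ⊆ E then 1 else 0)) ∘ List.cons E
          = fun B => -1 * ((-1 : ℝ) ^ B.length * (if ∀ E ∈ B, D ⊆ E then 1 else 0)) := by
        funext B
        simp [hE, pow_succ]
      rw [this, List.sum_map_mul_left, ih]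
      by_cases h : ∃ E ∈ C, D ⊆ E <;> simp [hE, h]
    · have : (fun B : List (Finset (Fin n)) =>
          (-1 : ℝ) ^ B.length * (if ∀ E ∈ B, D ⊆ E then 1 else 0)) ∘ List.cons E
          = fun _ => 0 := by
        funext B
        simp [hE]
      rw [this]
      simp [hE]

/-- The probability of the edge from `A` to `A ∪ {z}`, restricted to the types in `F`. -/
noncomputable def freqEdgeProb {n : ℕ} (F : Finset (Ranking n)) (p : PMF (Ranking n))
    (A : Finset (Fin n)) (z : Fin n) : ℝ :=
  ∑ π ∈ F.filter (fun π : Ranking n => prefixSet π A.card = A ∧ (π.symm z : ℕ) = A.card),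
    (p π).toReal

/-- The estimate `v` of an edge probability exceeds the contribution of the types in `F` by at
most the total probability `ρ` of the other types, up to a sampling error of at most `ε`. -/
def IsGoodEstimate {n : ℕ} (F : Finset (Ranking n)) (p : PMF (Ranking n)) (ρ ε : ℝ)
    (A : Finset (Fin n)) (z : Fin n) (v : ℝ) : Prop :=
  freqEdgeProb F p A z - ε ≤ v ∧ v ≤ freqEdgeProb F p A z + ρ + ε

/-- The exact value of the inclusion-exclusion formula. -/
noncomputable def inclExclValue {n : ℕ} (p : PMF (Ranking n)) (A : Finset (Fin n)) (z : Fin n)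
    (C : List (Finset (Fin n))) : ℝ :=
  choiceProb p (univ \ A) z - ((C.sublists.filter (fun B => B ≠ [])).map fun B =>
    (-1) ^ (B.length + 1) * choiceProb p (univ \ B.foldr (· ∩ ·) univ) z).sum

lemma list_sum_finset_sum {ι β : Type} (l : List β) (s : Finset ι) (f : β → ι → ℝ) :
    (l.map fun b => ∑ i ∈ s, f b i).sum = ∑ i ∈ s, (l.map fun b => f b i).sum := by
  induction l with
  | nil => simp
  | cons b l ih => simp [ih, Finset.sum_add_distrib]

lemma sublists_perm_cons_filter {β : Type} [DecidableEq β] (C : List β) :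
    ∃ l, C.sublists.Perm ([] :: l) ∧ (∀ B ∈ l, B ≠ []) ∧
      (C.sublists.filter (fun B => B ≠ [])).Perm l := by
  refine ⟨C.sublists'.filter (fun B => B ≠ []), ?_, ?_, ?_⟩
  · refine C.sublists_perm_sublists'.trans ?_
    induction C with
    | nil => simp
    | cons a C ih =>
      rw [List.sublists'_cons, List.filter_append, ← List.cons_append]
      refine List.Perm.append ih ?_
      rw [List.filter_eq_self.2]
      intro B hB
      obtain ⟨B', -, rfl⟩ := List.mem_map.1 hB
      simp
  · intro B hB
    simpa using (List.mem_filter.1 hB).2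
  · exact C.sublists_perm_sublists'.filter _

lemma inclExclValue_eq {n : ℕ} (p : PMF (Ranking n)) {A : Finset (Fin n)} {z : Fin n}
    (hz : z ∉ A) {C : List (Finset (Fin n))} (hC : ∀ E ∈ C, ∃ x ∈ A, E = A.erase x) :
    inclExclValue p A z C = ∑ π : Ranking n, (p π).toReal *
      (if prefixSet π (π.symm z) ⊆ A ∧ ¬ ∃ E ∈ C, prefixSet π (π.symm z) ⊆ E then 1 else 0) := by
  classical
  have hCA : ∀ E ∈ C, E ⊆ A := by
    intro E hE
    obtain ⟨x, -, rfl⟩ := hC E hE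
    exact Finset.erase_subset _ _
  unfold inclExclValue choiceProb
  simp only [Finset.mul_sum]
  rw [list_sum_finset_sum, ← Finset.sum_sub_distrib]
  refine Finset.sum_congr rfl fun π _ => ?_
  set D := prefixSet π (π.symm z) with hD
  obtain ⟨l, hl, hne, hperm⟩ := sublists_perm_cons_filter C
  have hsum := sum_sublists_indicator C D
  rw [(hl.map _).sum_eq, List.map_cons, List.sum_cons] at hsum
  simp only [List.length_nil, pow_zero, List.not_mem_nil, false_imp_iff, implies_true, if_true,
    mul_one] at hsum
  rw [(hperm.map _).sum_eq]
  have hterm : ∀ B ∈ l, (-1 : ℝ) ^ (B.length + 1) * ((p π).toReal *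
      (if choice π (univ \ B.foldr (· ∩ ·) univ) = some z then 1 else 0))
      = -(p π).toReal * ((-1) ^ B.length * (if ∀ E ∈ B, D ⊆ E then 1 else 0)) := by
    intro B hB
    have hmem : B ∈ C.sublists := hl.mem_iff.2 (List.mem_cons_of_mem _ hB)
    have hzB : z ∉ B.foldr (· ∩ ·) univ := by
      intro h
      obtain ⟨E, hE⟩ := List.exists_mem_of_ne_nil B (hne B hB)
      have h1 := foldr_inter_subset_iff.1 (Finset.singleton_subset_iff.2 h) E hE
      exact hz (hCA E ((List.mem_sublists.1 hmem).subset hE) (Finset.singleton_subset_iff.1 h1))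
    rw [if_congr (choice_sdiff_eq_some_iff hzB) rfl rfl,
      if_congr foldr_inter_subset_iff rfl rfl]
    ring
  rw [List.map_congr_left hterm, List.sum_map_mul_left, eq_sub_of_add_eq' hsum,
    if_congr (choice_sdiff_eq_some_iff hz) rfl rfl, ← hD]
  by_cases h : ∃ E ∈ C, D ⊆ E
  · have hDA : D ⊆ A := by
      obtain ⟨E, hE, h'⟩ := h
      exact h'.trans (hCA E hE)
    simp [h, hDA]
  · simp only [h, if_false, not_false_eq_true, and_true]
    ring

/-- If the family `C` covers everything that the frequent types contribute to the choice
probability besides the edge itself, then inclusion-exclusion is exact up to the rare types. -/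
lemma isGoodEstimate_inclExclValue {n : ℕ} {F : Finset (Ranking n)} {p : PMF (Ranking n)} {ρ : ℝ}
    (hρ : ∑ π ∈ Fᶜ, (p π).toReal ≤ ρ) {A : Finset (Fin n)} {z : Fin n} (hz : z ∉ A)
    {C : List (Finset (Fin n))} (hC : ∀ E ∈ C, ∃ x ∈ A, E = A.erase x)
    (hcov : ∀ π ∈ F, prefixSet π (π.symm z) ⊂ A → ∃ E ∈ C, prefixSet π (π.symm z) ⊆ E) :
    IsGoodEstimate F p ρ 0 A z (inclExclValue p A z C) := by
  classical
  rw [IsGoodEstimate, inclExclValue_eq p hz hC, ← Finset.sum_add_sum_compl F]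
  have hF : ∑ π ∈ F, (p π).toReal *
      (if prefixSet π (π.symm z) ⊆ A ∧ ¬ ∃ E ∈ C, prefixSet π (π.symm z) ⊆ E then (1 : ℝ) else 0)
      = freqEdgeProb F p A z := by
    unfold freqEdgeProb
    rw [Finset.sum_filter]
    refine Finset.sum_congr rfl fun π hπ => ?_
    have hcard : (prefixSet π (π.symm z)).card = (π.symm z : ℕ) :=
      card_prefixSet π (π.symm z).2.le
    have hiff : (prefixSet π (π.symm z) ⊆ A ∧ ¬ ∃ E ∈ C, prefixSet π (π.symm z) ⊆ E) ↔
        (prefixSet π A.card = A ∧ (π.symm z : ℕ) = A.card) := by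
      constructor
      · rintro ⟨h1, h2⟩
        have h3 : prefixSet π (π.symm z) = A := by
          by_contra hne
          exact h2 (hcov π hπ (Finset.ssubset_iff_subset_ne.2 ⟨h1, hne⟩))
        have h4 : (π.symm z : ℕ) = A.card := by rw [← hcard, h3]
        exact ⟨by rw [← h4, h3], h4⟩
      · rintro ⟨h1, h2⟩
        rw [h2, h1]
        refine ⟨subset_rfl, ?_⟩
        rintro ⟨E, hE, hAE⟩
        obtain ⟨x, hx, rfl⟩ := hC E hE
        exact Finset.notMem_erase x A (hAE hx)
    rw [if_congr hiff rfl rfl]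
    split_ifs <;> simp
  rw [hF]
  have h0 : 0 ≤ ∑ π ∈ Fᶜ, (p π).toReal *
      (if prefixSet π (π.symm z) ⊆ A ∧ ¬ ∃ E ∈ C, prefixSet π (π.symm z) ⊆ E then (1 : ℝ) else 0) :=
    Finset.sum_nonneg fun π _ => mul_nonneg ENNReal.toReal_nonneg (by split_ifs <;> norm_num)
  have h1 : ∑ π ∈ Fᶜ, (p π).toReal *
      (if prefixSet π (π.symm z) ⊆ A ∧ ¬ ∃ E ∈ C, prefixSet π (π.symm z) ⊆ E then (1 : ℝ) else 0)
      ≤ ∑ π ∈ Fᶜ, (p π).toReal :=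
    Finset.sum_le_sum fun π _ => mul_le_of_le_one_right ENNReal.toReal_nonneg
      (by split_ifs <;> norm_num)
  constructor <;> linarith

/-! ### The estimate of a single edge -/

lemma sampleSize_pos {c : ℕ} {ε δ : ℝ} (hε : 0 < ε) (hδ : 0 < δ) (hδ1 : δ < 1) :
    0 < sampleSize c ε δ := by
  unfold sampleSize
  rw [Nat.ceil_pos]
  have h1 : 0 < Real.log (1 / δ) := Real.log_pos (by rw [lt_div_iff₀ hδ]; linarith)
  have h2 : 0 < Real.log 2 := Real.log_pos (by norm_num)
  positivity

lemma hoeffding_sampleSize_le {c : ℕ} {ε δ : ℝ} (hε : 0 < ε) (hδ : 0 < δ) :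
    2 * Real.exp (-(2 * (sampleSize c ε δ : ℝ) * (ε / 2 ^ c) ^ 2)) ≤ δ / 2 ^ c := by
  have h1 : (2 : ℝ) ^ (2 * (c : ℤ) - 1) * (Real.log (1 / δ) + (c + 1) * Real.log 2) / ε ^ 2
      ≤ sampleSize c ε δ := Nat.le_ceil _
  have h2 : (2 : ℝ) ^ (2 * (c : ℤ) - 1) = (2 ^ c) ^ 2 / 2 := by
    rw [zpow_sub₀ (by norm_num), zpow_one, ← pow_mul, mul_comm c 2]
    congr 1
  have h3 : Real.log (1 / δ) + (c + 1) * Real.log 2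
      ≤ 2 * (sampleSize c ε δ : ℝ) * (ε / 2 ^ c) ^ 2 := by
    rw [h2, div_le_iff₀ (by positivity)] at h1
    rw [div_pow, mul_div_assoc', le_div_iff₀ (by positivity)]
    linarith
  have h4 : δ / 2 ^ c = 2 * Real.exp (-(Real.log (1 / δ) + (c + 1) * Real.log 2)) := by
    have : -(Real.log (1 / δ) + (c + 1) * Real.log 2)
        = Real.log δ - (c + 1 : ℕ) * Real.log 2 := by
      rw [one_div, Real.log_inv]; push_cast; ring
    rw [this, Real.exp_sub, Real.exp_log hδ, ← Real.log_pow, Real.exp_log (by positivity), pow_succ]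
    field_simp
  rw [h4]
  have := Real.exp_le_exp.2 (neg_le_neg h3)
  linarith

/-- A bound for the number of steps of the estimate of a single edge, when the graph has `N` nodes
and at most `f` per level, the set cover has size `c` and `m` consumers are queried per
assortment. -/
def edgeSteps (n N f c m : ℕ) : ℕ :=
  (N * (n * (f + 3) + 3) + 1) + (c * (n * (2 * N + 3) + 2 * N + 3) + 1) + (c + 1)
    + (n + 1 + 2 * m) + 2 ^ c * ((c + 1) * (n + 1) + (n + 1 + 2 * m))

lemma edgeSteps_mono {n N f c m N' c' m' : ℕ} (hN : N ≤ N') (hc : c ≤ c') (hm : m ≤ m') :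
    edgeSteps n N f c m ≤ edgeSteps n N' f c' m' := by
  unfold edgeSteps
  have : 2 ^ c ≤ 2 ^ c' := Nat.pow_le_pow_right (by norm_num) hc
  gcongr

lemma sampleSize_mono {c c' : ℕ} {ε δ : ℝ} (hδ : 0 < δ) (hδ1 : δ < 1) (h : c ≤ c') :
    sampleSize c ε δ ≤ sampleSize c' ε δ := by
  unfold sampleSize
  refine Nat.ceil_le_ceil ?_
  have h1 : 0 < Real.log (1 / δ) := Real.log_pos (by rw [lt_div_iff₀ hδ]; linarith)
  have h2 : 0 < Real.log 2 := Real.log_pos (by norm_num)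
  have h3 : (2 : ℝ) ^ (2 * (c : ℤ) - 1) ≤ (2 : ℝ) ^ (2 * (c' : ℤ) - 1) :=
    zpow_le_zpow_right₀ (by norm_num) (by omega)
  gcongr

/-- The error of a signed sum grows by the error of one estimate in every round. -/
lemma ensures_signed_sum {n : ℕ} {β : Type} {p : PMF (Ranking n)} {k T : ℕ} {ξ : ℝ} {η : ℝ≥0∞}
    {g : β → Prog n ℝ} {q w : β → ℝ} (hg : ∀ B, (g B).Ensures p (fun v => |v - q B| ≤ ξ) T η)
    (hw : ∀ B, |w B| = 1) (l : List β) :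
    (l.foldlM (fun (s : ℝ) B => do
      charge k
      let v ← g B
      return s + w B * v) 0 : Prog n ℝ).Ensures p
      (fun s => |s - (l.map fun B => w B * q B).sum| ≤ l.length * ξ)
      (l.length * (k + T)) (l.length * η) := by
  refine Prog.Ensures.foldlM (T := k + T) (η := η)
    (fun l₁ s => |s - (l₁.map fun B => w B * q B).sum| ≤ l₁.length * ξ) l ?_ (by simp)
  intro l₁ B l₂ s _ hs
  refine Prog.Ensures.mono (Q := fun s => |s - ((l₁ ++ [B]).map fun B => w B * q B).sum|
    ≤ (l₁ ++ [B]).length * ξ) (T := k + (T + 0)) (η := 0 + (η + 0)) ?_ (fun _ h => h)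
    (by omega) (by simp)
  refine Prog.Ensures.bind (ensures_charge le_rfl) fun _ _ =>
    Prog.Ensures.bind (hg B) fun v hv => Prog.Ensures.pure ?_
  simp only [List.map_append, List.sum_append, List.length_append, List.map_cons, List.map_nil,
    List.sum_cons, List.sum_nil, List.length_cons, List.length_nil]
  have h1 : s + w B * v - ((l₁.map fun B => w B * q B).sum + (w B * q B + 0))
      = (s - (l₁.map fun B => w B * q B).sum) + w B * (v - q B) := by ring
  rw [h1]
  refine (abs_add_le _ _).trans ?_
  rw [abs_mul, hw, one_mul]
  push_cast
  linarith

/-- Each of the `2 ^ c` frequencies has error at most `ε / 2 ^ c`, except with probability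
`δ / 2 ^ c`. -/
lemma ensures_algIE {n : ℕ} {F : Finset (Ranking n)} {p : PMF (Ranking n)} {ρ : ℝ}
    (hρ : ∑ π ∈ Fᶜ, (p π).toReal ≤ ρ) {levels : List (List (Finset (Fin n)))}
    {A : Finset (Fin n)} {z : Fin n} (hz : z ∉ A)
    (hlev : ∀ π ∈ F, prefixSet π (π.symm z) ⊂ A → prefixSet π (π.symm z) ∈ levels.flatten ∧
      insert z (prefixSet π (π.symm z))
        ∈ levels.getD (insert z (prefixSet π (π.symm z))).card [])
    {N f c : ℕ} (hN : levels.flatten.length ≤ N) (hf : ∀ i, (levels.getD i []).length ≤ f)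
    (hc : (greedyMinCover A (interferers levels A z).val).val.length ≤ c)
    {ε δ : ℝ} (hε : 0 < ε) (hδ : 0 < δ) (hδ1 : δ < 1) :
    (algIE levels A z ε δ).Ensures p (IsGoodEstimate F p ρ ε A z)
      (edgeSteps n N f c (sampleSize c ε δ)) (ENNReal.ofReal δ) := by
  classical
  set P := (interferers levels A z).val with hP
  set C := (greedyMinCover A P).val with hCdef
  have hPA : ∀ A' ∈ P, A' ⊂ A := fun A' h => (mem_interferers.1 h).2.1
  obtain ⟨hC1, hC2, hC3⟩ := greedyAux_spec P.length P hPA le_rfl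
  have hPN : P.length ≤ N := (length_interferers_le levels A z).trans hN
  have hgood := isGoodEstimate_inclExclValue (p := p) hρ hz hC1 fun π hπ h =>
    hC2 _ (mem_interferers.2 ⟨(hlev π hπ h).1, h, (hlev π hπ h).2⟩)
  set m := sampleSize C.length ε δ with hm
  have hmpos : 0 < m := sampleSize_pos hε hδ hδ1
  have h2c : (0 : ℝ) < 2 ^ C.length := by positivity
  have hηpos : 0 < ε / 2 ^ C.length := by positivity
  have hfreq : ∀ S, (frequency S z m).Ensures p
      (fun v => |v - choiceProb p S z| ≤ ε / 2 ^ C.length) (n + 1 + 2 * m)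
      (ENNReal.ofReal (δ / 2 ^ C.length)) := fun S =>
    (ensures_frequency p S z hmpos hηpos).mono (fun _ h => h) le_rfl
      (ENNReal.ofReal_le_ofReal (hoeffding_sampleSize_le hε hδ))
  obtain ⟨l, hl⟩ : ∃ l, l = C.sublists.filter (fun B => B ≠ []) := ⟨_, rfl⟩
  have hllen : l.length + 1 = 2 ^ C.length := by
    obtain ⟨l', h1, -, h3⟩ := sublists_perm_cons_filter C
    rw [hl, h3.length_eq, ← List.length_sublists, h1.length_eq, List.length_cons]
  have hfold := ensures_signed_sum (k := (C.length + 1) * (n + 1))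
    (g := fun B : List (Finset (Fin n)) => frequency (univ \ B.foldr (· ∩ ·) univ) z m)
    (w := fun B => (-1) ^ (B.length + 1)) (fun B => hfreq _) (fun B => by simp) l
  unfold algIE
  refine (Prog.Ensures.bind (Prog.Ensures.toProg (steps_interferers_le hf A z)) ?_
    (T' := (C.length * (n * (2 * N + 3) + 2 * N + 3) + 1) + ((C.length + 1)
      + ((n + 1 + 2 * m) + (l.length * ((C.length + 1) * (n + 1) + (n + 1 + 2 * m)) + 0))))
    (R := IsGoodEstimate F p ρ ε A z)
    (η' := 0 + (0 + (ENNReal.ofReal (δ / 2 ^ C.length)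
      + (l.length * ENNReal.ofReal (δ / 2 ^ C.length) + 0))))).mono (fun _ h => h) ?_ ?_
  · rintro _ rfl
    refine Prog.Ensures.bind (Prog.Ensures.toProg (hC3 N hPN)) ?_
    rintro _ rfl
    refine Prog.Ensures.bind (ensures_charge le_rfl) fun _ _ => ?_
    refine Prog.Ensures.bind (hfreq (univ \ A)) fun q hq => ?_
    rw [← hm, ← hl]
    refine Prog.Ensures.bind hfold fun s hs => Prog.Ensures.pure ?_
    have hsum : ε / 2 ^ C.length + l.length * (ε / 2 ^ C.length) = ε := by
      have : (l.length : ℝ) + 1 = 2 ^ C.length := by exact_mod_cast hllen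
      rw [← one_add_mul, add_comm, this]
      field_simp
    rw [abs_le] at hq hs
    obtain ⟨hg1, hg2⟩ := hgood
    unfold inclExclValue at hg1 hg2
    change freqEdgeProb F p A z - 0 ≤ _ - (List.map _ (List.filter _ C.sublists)).sum at hg1
    change _ - (List.map _ (List.filter _ C.sublists)).sum ≤ _ at hg2
    rw [← hl] at hg1 hg2
    constructor <;> linarith [hq.1, hq.2, hs.1, hs.2]
  · have hm' : m ≤ sampleSize c ε δ := sampleSize_mono hδ hδ1 hc
    refine le_trans ?_ (edgeSteps_mono le_rfl hc hm')
    have h1 : l.length ≤ 2 ^ C.length := by omega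
    have h2 := Nat.mul_le_mul_right ((C.length + 1) * (n + 1) + (n + 1 + 2 * m)) h1
    have h3 := Nat.mul_le_mul_right (n * (f + 3) + 3) hN
    unfold edgeSteps
    omega
  · have : (2 : ℝ≥0∞) ^ C.length = ((2 ^ C.length : ℕ) : ℝ≥0∞) := by norm_cast
    calc 0 + (0 + (0 + (ENNReal.ofReal (δ / 2 ^ C.length)
      + (l.length * ENNReal.ofReal (δ / 2 ^ C.length) + 0))))
        = ((2 ^ C.length : ℕ) : ℝ≥0∞) * ENNReal.ofReal (δ / 2 ^ C.length) := by
          rw [← hllen]; push_cast; ring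
      _ = ENNReal.ofReal δ := by
          rw [← ENNReal.ofReal_natCast, ← ENNReal.ofReal_mul (by positivity)]
          congr 1
          push_cast
          field_simp
      _ ≤ _ := le_rfl

/-! ### Frequent nodes and edges -/

/-- The edge from `A` to `A ∪ {z}` belongs to the DAG of the types in `F`. -/
def FreqEdge {n : ℕ} (F : Finset (Ranking n)) (A : Finset (Fin n)) (z : Fin n) : Prop :=
  ∃ π ∈ F, prefixSet π A.card = A ∧ (π.symm z : ℕ) = A.card

/-- The set `A` is a node on level `i` of the DAG of the types in `F`. -/
def FreqNode {n : ℕ} (F : Finset (Ranking n)) (i : ℕ) (A : Finset (Fin n)) : Prop :=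
  ∃ π ∈ F, A = prefixSet π i

section

variable {n : ℕ} {F : Finset (Ranking n)} {p : PMF (Ranking n)} {κ ρ ε : ℝ}

lemma FreqNode.card_eq {i : ℕ} (hi : i ≤ n) {A : Finset (Fin n)} (h : FreqNode F i A) :
    A.card = i := by
  obtain ⟨π, -, rfl⟩ := h
  exact card_prefixSet π hi

lemma FreqEdge.notMem {A : Finset (Fin n)} {z : Fin n} (h : FreqEdge F A z) : z ∉ A := by
  obtain ⟨π, -, h1, h2⟩ := h
  intro hz
  rw [← h1, mem_prefixSet] at hz
  omega

lemma FreqEdge.freqNode_insert {A : Finset (Fin n)} {z : Fin n} (h : FreqEdge F A z) :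
    FreqNode F (A.card + 1) (insert z A) := by
  obtain ⟨π, hπ, h1, h2⟩ := h
  exact ⟨π, hπ, by rw [prefixSet_succ π h2, h1]⟩

lemma FreqEdge.freqNode {A : Finset (Fin n)} {z : Fin n} (h : FreqEdge F A z) :
    FreqNode F A.card A := by
  obtain ⟨π, hπ, h1, h2⟩ := h
  exact ⟨π, hπ, h1.symm⟩

lemma prefixSet_edge {π : Ranking n} (hπ : π ∈ F) {j : ℕ} (hj : j < n) :
    FreqEdge F (prefixSet π j) (π ⟨j, hj⟩) ∧
      prefixSet π (j + 1) = insert (π ⟨j, hj⟩) (prefixSet π j) := by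
  have h : (π.symm (π ⟨j, hj⟩) : ℕ) = j := by simp
  refine ⟨⟨π, hπ, ?_, ?_⟩, prefixSet_succ π h⟩
  · rw [card_prefixSet π hj.le]
  · rw [card_prefixSet π hj.le, h]

lemma length_le_card_of_freqNode {i : ℕ} {l : List (Finset (Fin n))} (hl : l.Nodup)
    (h : ∀ A ∈ l, FreqNode F i A) : l.length ≤ F.card := by
  classical
  rw [← List.toFinset_card_of_nodup hl]
  refine (Finset.card_le_card (t := F.image fun π => prefixSet π i) ?_).trans
    Finset.card_image_le
  intro A hA
  obtain ⟨π, hπ, rfl⟩ := h A (List.mem_toFinset.1 hA)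
  exact Finset.mem_image_of_mem _ hπ

/-- The rare types contribute at most `ρ` to the probability of any event. -/
lemma sum_filter_bounds (hρ : ∑ π ∈ Fᶜ, (p π).toReal ≤ ρ) (q : Ranking n → Prop)
    [DecidablePred q] :
    ∑ π ∈ F.filter q, (p π).toReal ≤ ∑ π ∈ univ.filter q, (p π).toReal ∧
      ∑ π ∈ univ.filter q, (p π).toReal ≤ ∑ π ∈ F.filter q, (p π).toReal + ρ := by
  classical
  have h0 : ∑ π ∈ univ.filter q, (p π).toReal
      = ∑ π ∈ F.filter q, (p π).toReal + ∑ π ∈ Fᶜ.filter q, (p π).toReal := by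
    simp only [Finset.sum_filter]
    exact (Finset.sum_add_sum_compl F _).symm
  have h1 : ∑ π ∈ Fᶜ.filter q, (p π).toReal ≤ ∑ π ∈ Fᶜ, (p π).toReal :=
    Finset.sum_le_sum_of_subset_of_nonneg (Finset.filter_subset _ _)
      fun _ _ _ => ENNReal.toReal_nonneg
  have h2 : 0 ≤ ∑ π ∈ Fᶜ.filter q, (p π).toReal :=
    Finset.sum_nonneg fun _ _ => ENNReal.toReal_nonneg
  constructor <;> linarith

lemma le_freqEdgeProb (hF : ∀ π ∈ F, κ ≤ (p π).toReal) {A : Finset (Fin n)} {z : Fin n}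
    (h : FreqEdge F A z) : κ ≤ freqEdgeProb F p A z := by
  obtain ⟨π, hπ, h1⟩ := h
  exact (hF π hπ).trans (Finset.single_le_sum (f := fun π => (p π).toReal)
    (fun _ _ => ENNReal.toReal_nonneg) (Finset.mem_filter.2 ⟨hπ, h1⟩))

lemma freqEdgeProb_eq_zero {A : Finset (Fin n)} {z : Fin n} (h : ¬ FreqEdge F A z) :
    freqEdgeProb F p A z = 0 := by
  unfold freqEdgeProb
  rw [Finset.filter_false_of_mem, Finset.sum_empty]
  intro π hπ h'
  exact h ⟨π, hπ, h'⟩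

/-- The threshold `κ / 2` separates the estimates for frequent edges from all others. -/
lemma IsGoodEstimate.threshold (hF : ∀ π ∈ F, κ ≤ (p π).toReal) (hρ : ρ < κ / 4)
    (hε : ε ≤ κ / 4) (hκ : 0 < κ) {A : Finset (Fin n)} {z : Fin n} {v : ℝ}
    (h : IsGoodEstimate F p ρ ε A z v) : κ / 2 ≤ v ↔ FreqEdge F A z := by
  obtain ⟨h1, h2⟩ := h
  constructor
  · intro hv
    by_contra hn
    rw [freqEdgeProb_eq_zero hn] at h2
    linarith
  · intro hn
    have := le_freqEdgeProb hF hn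
    linarith

/-! ### The invariant of the main loop -/

open Classical in
/-- The state of the algorithm while it builds level `j + 1`: `D` is the set of the pairs `(A, z)`
that have been processed, `lev` are the levels `0, …, j`, and the second component of the state is
the part of level `j + 1` found so far. -/
structure LoopInv (F : Finset (Ranking n)) (p : PMF (Ranking n)) (ρ ε : ℝ)
    (lev : List (List (Finset (Fin n)))) (j : ℕ) (D : Finset (Finset (Fin n) × Fin n))
    (s : EstDAG n × List (Finset (Fin n))) : Prop where
  good : ∀ a ∈ D, IsGoodEstimate F p ρ ε a.1 a.2 (s.1.edgeEst a.1 a.2)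
  edges : ∀ a, a ∈ s.1.edges ↔ a ∈ D ∧ FreqEdge F a.1 a.2
  nodeEst_empty : s.1.nodeEst ∅ = 1
  nodeEst : ∀ B, (∃ a ∈ D, FreqEdge F a.1 a.2 ∧ insert a.2 a.1 = B) →
    s.1.nodeEst B = ∑ a ∈ D.filter (fun a => FreqEdge F a.1 a.2 ∧ insert a.2 a.1 = B),
      s.1.edgeEst a.1 a.2
  nodup : s.2.Nodup
  mem : ∀ B, B ∈ s.2 ↔ ∃ a ∈ D, a.1.card = j ∧ FreqEdge F a.1 a.2 ∧ insert a.2 a.1 = B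
  levels : s.1.levels = lev

/-- A good estimate of a new pair preserves the invariant. The node `A ∪ {z}` may have been reached
before, but only by pairs of the same level, so that it is on the list of new nodes exactly when its
estimate is the sum of the edge estimates processed so far. -/
lemma LoopInv.addEdge {lev : List (List (Finset (Fin n)))} {j : ℕ}
    {D : Finset (Finset (Fin n) × Fin n)} {s : EstDAG n × List (Finset (Fin n))}
    (hF : ∀ π ∈ F, κ ≤ (p π).toReal) (hρ : ρ < κ / 4) (hε : ε ≤ κ / 4) (hκ : 0 < κ)
    (h : LoopInv F p ρ ε lev j D s) {A : Finset (Fin n)} {z : Fin n} (hA : A.card = j)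
    (hD : (A, z) ∉ D) {v : ℝ} (hv : IsGoodEstimate F p ρ ε A z v) :
    LoopInv F p ρ ε lev j (insert (A, z) D) (addEdge κ A z v s) := by
  classical
  have hthr := hv.threshold hF hρ hε hκ
  set e' : Finset (Fin n) → Fin n → ℝ :=
    Function.update s.1.edgeEst A (Function.update (s.1.edgeEst A) z v) with he'
  have he1 : e' A z = v := by simp [he']
  have he2 : ∀ a ∈ D, e' a.1 a.2 = s.1.edgeEst a.1 a.2 := by
    rintro ⟨B, y⟩ ha
    by_cases h1 : B = A
    · subst h1
      have h2 : y ≠ z := by rintro rfl; exact hD ha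
      simp [he', h2]
    · simp [he', h1]
  have hgood : ∀ a ∈ insert (A, z) D, IsGoodEstimate F p ρ ε a.1 a.2 (e' a.1 a.2) := by
    intro a ha
    rcases Finset.mem_insert.1 ha with rfl | ha
    · simpa [he1] using hv
    · rw [he2 a ha]; exact h.good a ha
  by_cases hE : FreqEdge F A z
  · have hs : ChoiceDAG.addEdge κ A z v s = ({ levels := s.1.levels
                                               edges := (A, z) :: s.1.edges
                                               nodeEst := Function.update s.1.nodeEst (insert z A)
                                                ((if insert z A ∈ s.2 then s.1.nodeEst (insert z A)
                                                  else 0) + v)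
                                               edgeEst := e' },
        if insert z A ∈ s.2 then s.2 else insert z A :: s.2) := by
      simp only [ChoiceDAG.addEdge, if_pos (hthr.2 hE), he']
    rw [hs]
    refine ⟨hgood, ?_, ?_, ?_, ?_, ?_, h.levels⟩
    · intro a
      simp only [List.mem_cons, Finset.mem_insert, h.edges]
      constructor
      · rintro (rfl | ⟨h1, h2⟩)
        · exact ⟨Or.inl rfl, hE⟩
        · exact ⟨Or.inr h1, h2⟩
      · rintro ⟨rfl | h1, h2⟩
        · exact Or.inl rfl
        · exact Or.inr ⟨h1, h2⟩
    · have : (∅ : Finset (Fin n)) ≠ insert z A := (Finset.insert_ne_empty _ _).symm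
      simpa [Function.update_of_ne this] using h.nodeEst_empty
    · intro B hB
      by_cases hBA : insert z A = B
      · subst hBA
        have hnot : (A, z) ∉ D.filter
            (fun a => FreqEdge F a.1 a.2 ∧ insert a.2 a.1 = insert z A) :=
          fun h => hD (Finset.mem_filter.1 h).1
        have hfil : (insert (A, z) D).filter
            (fun a => FreqEdge F a.1 a.2 ∧ insert a.2 a.1 = insert z A) = insert (A, z)
              (D.filter fun a => FreqEdge F a.1 a.2 ∧ insert a.2 a.1 = insert z A) := by
          rw [Finset.filter_insert, if_pos ⟨hE, rfl⟩]
        rw [hfil, Finset.sum_insert hnot]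
        simp only [he1]
        rw [Finset.sum_congr rfl fun a ha => he2 a (Finset.mem_filter.1 ha).1]
        simp only [Function.update_self]
        rw [add_comm v]
        congr 1
        split_ifs with hL
        · obtain ⟨a, ha, -, h1, h2⟩ := (h.mem _).1 hL
          exact h.nodeEst _ ⟨a, ha, h1, h2⟩
        · rw [Finset.filter_false_of_mem, Finset.sum_empty]
          rintro a ha ⟨h1, h2⟩
          refine hL ((h.mem _).2 ⟨a, ha, ?_, h1, h2⟩)
          have h3 := congrArg Finset.card h2
          rw [Finset.card_insert_of_notMem h1.notMem, Finset.card_insert_of_notMem hE.notMem] at h3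
          omega
      · have hex : ∃ a ∈ D, FreqEdge F a.1 a.2 ∧ insert a.2 a.1 = B := by
          obtain ⟨a, ha, h1, h2⟩ := hB
          rcases Finset.mem_insert.1 ha with rfl | ha
          · exact absurd h2 hBA
          · exact ⟨a, ha, h1, h2⟩
        have hfil : (insert (A, z) D).filter
            (fun a => FreqEdge F a.1 a.2 ∧ insert a.2 a.1 = B)
              = D.filter fun a => FreqEdge F a.1 a.2 ∧ insert a.2 a.1 = B := by
          rw [Finset.filter_insert, if_neg (fun h => hBA h.2)]
        rw [hfil, Finset.sum_congr rfl fun a ha => he2 a (Finset.mem_filter.1 ha).1]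
        simp only [Function.update_of_ne (Ne.symm hBA)]
        exact h.nodeEst B hex
    · simp only
      split_ifs with hL
      · exact h.nodup
      · exact List.nodup_cons.2 ⟨hL, h.nodup⟩
    · intro B
      have h1 : B ∈ (if insert z A ∈ s.2 then s.2 else insert z A :: s.2) ↔
          B = insert z A ∨ B ∈ s.2 := by
        split_ifs with hL
        · constructor
          · exact Or.inr
          · rintro (rfl | h) <;> assumption
        · exact List.mem_cons
      refine h1.trans ?_
      rw [h.mem]
      constructor
      · rintro (rfl | ⟨a, ha, h2⟩)
        · exact ⟨(A, z), Finset.mem_insert_self _ _, hA, hE, rfl⟩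
        · exact ⟨a, Finset.mem_insert_of_mem ha, h2⟩
      · rintro ⟨a, ha, h2, h3, h4⟩
        rcases Finset.mem_insert.1 ha with rfl | ha
        · exact Or.inl h4.symm
        · exact Or.inr ⟨a, ha, h2, h3, h4⟩
  · have hs : ChoiceDAG.addEdge κ A z v s = ({ levels := s.1.levels
                                               edges := s.1.edges
                                               nodeEst := s.1.nodeEst
                                               edgeEst := e' }, s.2) := by
      simp only [ChoiceDAG.addEdge, if_neg (fun h => hE (hthr.1 h)), he']
    rw [hs]
    have hne : ∀ a, FreqEdge F a.1 a.2 → (a ∈ insert (A, z) D ↔ a ∈ D) := by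
      intro a ha
      rw [Finset.mem_insert, or_iff_right]
      rintro rfl
      exact hE ha
    refine ⟨hgood, ?_, h.nodeEst_empty, ?_, h.nodup, ?_, h.levels⟩
    · intro a
      simp only [h.edges]
      exact ⟨fun ⟨h1, h2⟩ => ⟨(hne a h2).2 h1, h2⟩, fun ⟨h1, h2⟩ => ⟨(hne a h2).1 h1, h2⟩⟩
    · intro B hB
      obtain ⟨a, ha, h1, h2⟩ := hB
      rw [Finset.filter_insert, if_neg (fun h => hE h.1),
          Finset.sum_congr rfl fun a ha => he2 a (Finset.mem_filter.1 ha).1]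
      exact h.nodeEst B ⟨a, (hne a h1).1 ha, h1, h2⟩
    · intro B
      simp only [h.mem]
      exact ⟨fun ⟨a, h1, h2, h3, h4⟩ => ⟨a, (hne a h3).2 h1, h2, h3, h4⟩,
        fun ⟨a, h1, h2, h3, h4⟩ => ⟨a, (hne a h3).1 h1, h2, h3, h4⟩⟩

open Classical in
/-- The pairs `(A, z)` that have been processed when the levels `0, …, j` are complete. -/
noncomputable def donePairs (F : Finset (Ranking n)) (j : ℕ) : Finset (Finset (Fin n) × Fin n) :=
  univ.filter fun a => a.1.card < j ∧ a.2 ∉ a.1 ∧ FreqNode F a.1.card a.1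

lemma mem_donePairs {j : ℕ} {a : Finset (Fin n) × Fin n} :
    a ∈ donePairs F j ↔ a.1.card < j ∧ a.2 ∉ a.1 ∧ FreqNode F a.1.card a.1 := by
  classical
  simp [donePairs]

/-- The state of the algorithm when the levels `0, …, j` are complete. -/
structure LevelInv (F : Finset (Ranking n)) (p : PMF (Ranking n)) (ρ ε : ℝ) (j : ℕ)
    (G : EstDAG n) : Prop where
  loop : LoopInv F p ρ ε G.levels j (donePairs F j) (G, [])
  length : G.levels.length = j + 1
  nodup : ∀ i, (G.levels.getD i []).Nodup
  mem : ∀ i ≤ j, ∀ A, A ∈ G.levels.getD i [] ↔ FreqNode F i A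

lemma levelInv_start (hne : F.Nonempty) : LevelInv F p ρ ε 0 (EstDAG.start n) := by
  have hD : donePairs F 0 = ∅ := by
    ext a; simp [mem_donePairs]
  refine ⟨?_, rfl, ?_, ?_⟩
  · rw [hD]
    refine ⟨by simp, by simp [EstDAG.start], by simp [EstDAG.start], by simp, by simp, by simp, rfl⟩
  · intro i
    rcases i with _ | i <;> simp [EstDAG.start]
  · intro i hi A
    obtain rfl : i = 0 := by omega
    obtain ⟨π, hπ⟩ := hne
    simp only [EstDAG.start, List.getD_cons_zero, List.mem_singleton, FreqNode, prefixSet_zero]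
    exact ⟨fun h => ⟨π, hπ, h⟩, fun ⟨_, _, h⟩ => h⟩

lemma LevelInv.length_getD_le {j : ℕ} {G : EstDAG n} (h : LevelInv F p ρ ε j G) (i : ℕ) :
    (G.levels.getD i []).length ≤ F.card := by
  by_cases hi : i ≤ j
  · exact length_le_card_of_freqNode (h.nodup i) fun A hA => (h.mem i hi A).1 hA
  · rw [List.getD_eq_default _ _ (by rw [h.length]; omega)]
    exact Nat.zero_le _

lemma LevelInv.mem_flatten {j : ℕ} {G : EstDAG n} (h : LevelInv F p ρ ε j G)
    {A : Finset (Fin n)} : A ∈ G.levels.flatten ↔ ∃ i ≤ j, FreqNode F i A := by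
  rw [List.mem_flatten]
  constructor
  · rintro ⟨l, hl, hA⟩
    obtain ⟨i, hi, rfl⟩ := List.mem_iff_getElem.1 hl
    have hij : i ≤ j := by rw [h.length] at hi; omega
    exact ⟨i, hij, (h.mem i hij A).1 (by rwa [List.getD_eq_getElem _ _ hi])⟩
  · rintro ⟨i, hi, hA⟩
    have hlt : i < G.levels.length := by rw [h.length]; omega
    refine ⟨G.levels[i], List.getElem_mem _, ?_⟩
    rw [← List.getD_eq_getElem _ [] hlt]
    exact (h.mem i hi A).2 hA

lemma LevelInv.length_flatten_le {j : ℕ} {G : EstDAG n} (h : LevelInv F p ρ ε j G) :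
    G.levels.flatten.length ≤ (j + 1) * F.card := by
  rw [List.length_flatten, ← h.length]
  refine (List.sum_le_card_nsmul _ F.card ?_).trans (by simp)
  intro x hx
  obtain ⟨l, hl, rfl⟩ := List.mem_map.1 hx
  obtain ⟨i, hi, rfl⟩ := List.mem_iff_getElem.1 hl
  rw [← List.getD_eq_getElem _ [] hi]
  exact h.length_getD_le i

lemma LevelInv.nodup_flatten {j : ℕ} {G : EstDAG n} (h : LevelInv F p ρ ε j G) (hj : j ≤ n) :
    G.levels.flatten.Nodup := by
  rw [List.nodup_flatten]
  constructor
  · intro l hl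
    obtain ⟨i, hi, rfl⟩ := List.mem_iff_getElem.1 hl
    rw [← List.getD_eq_getElem _ [] hi]
    exact h.nodup i
  · rw [List.pairwise_iff_getElem]
    intro i k hi hk hik
    rw [← List.getD_eq_getElem _ [] hi, ← List.getD_eq_getElem _ [] hk]
    have := h.length
    intro A h1 h2
    have h3 := ((h.mem i (by omega) A).1 h1).card_eq (by omega)
    have h4 := ((h.mem k (by omega) A).1 h2).card_eq (by omega)
    omega

/-- The completed list becomes the next level: every frequent node on level `j + 1` is reached by a
frequent edge from level `j`. -/
lemma LevelInv.next {j : ℕ} (hj : j < n) {G : EstDAG n} (hG : LevelInv F p ρ ε j G)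
    {s : EstDAG n × List (Finset (Fin n))}
    (h : LoopInv F p ρ ε G.levels j (donePairs F (j + 1)) s) :
    LevelInv F p ρ ε (j + 1) { s.1 with levels := s.1.levels ++ [s.2] } := by
  have hmem : ∀ B, B ∈ s.2 ↔ FreqNode F (j + 1) B := by
    intro B
    rw [h.mem]
    constructor
    · rintro ⟨a, -, h1, h2, rfl⟩
      rw [← h1]
      exact h2.freqNode_insert
    · rintro ⟨π, hπ, rfl⟩
      obtain ⟨h1, h2⟩ := prefixSet_edge hπ hj
      refine ⟨(prefixSet π j, π ⟨j, hj⟩), mem_donePairs.2 ⟨?_, h1.notMem, h1.freqNode⟩,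
        card_prefixSet π hj.le, h1, h2.symm⟩
      simp [card_prefixSet π hj.le]
  have hget : ∀ i, (s.1.levels ++ [s.2]).getD i [] =
      if i ≤ j then G.levels.getD i [] else if i = j + 1 then s.2 else [] := by
    intro i
    have := hG.length
    rw [h.levels]
    split_ifs with h1 h2
    · rw [List.getD_append _ _ _ _ (by omega)]
    · rw [List.getD_append_right _ _ _ _ (by omega), this, h2]
      simp
    · rw [List.getD_eq_default]
      simp; omega
  refine ⟨⟨h.good, h.edges, h.nodeEst_empty, h.nodeEst, List.nodup_nil, ?_, rfl⟩, ?_, ?_, ?_⟩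
  · intro B
    simp only [List.not_mem_nil, false_iff]
    rintro ⟨a, ha, h1, -⟩
    have := (mem_donePairs.1 ha).1
    omega
  · simp [h.levels, hG.length]
  · intro i
    simp only [hget]
    split_ifs
    · exact hG.nodup i
    · exact h.nodup
    · exact List.nodup_nil
  · intro i hi A
    simp only [hget]
    split_ifs with h1 h2
    · exact hG.mem i h1 A
    · rw [h2]; exact hmem A
    · omega

/-! ### Accuracy of the final estimates -/

/-- An edge into `B` is determined by the item it adds. -/
lemma card_edges_into_le (B : Finset (Fin n)) (D : Finset (Finset (Fin n) × Fin n))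
    [DecidablePred fun a : Finset (Fin n) × Fin n => FreqEdge F a.1 a.2 ∧ insert a.2 a.1 = B] :
    (D.filter (fun a => FreqEdge F a.1 a.2 ∧ insert a.2 a.1 = B)).card ≤ B.card := by
  refine Finset.card_le_card_of_injOn (fun a => a.2) ?_ ?_
  · intro a ha
    obtain ⟨-, -, rfl⟩ := Finset.mem_filter.1 ha
    exact Finset.mem_insert_self _ _
  · intro a ha b hb hab
    obtain ⟨-, ha1, ha2⟩ := Finset.mem_filter.1 ha
    obtain ⟨-, hb1, hb2⟩ := Finset.mem_filter.1 hb
    have hab' : a.2 = b.2 := hab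
    refine Prod.ext ?_ hab'
    rw [← Finset.erase_insert ha1.notMem, ← Finset.erase_insert hb1.notMem, ha2, hb2, hab']

/-- A frequent type that starts with the items of `B` passes through exactly one frequent edge
into `B`. -/
lemma sum_freqEdgeProb {j m : ℕ} (hj : j < m) (hjn : j < n) {B : Finset (Fin n)}
    (hB : B.card = j + 1)
    [DecidablePred fun a : Finset (Fin n) × Fin n => FreqEdge F a.1 a.2 ∧ insert a.2 a.1 = B] :
    ∑ a ∈ (donePairs F m).filter (fun a => FreqEdge F a.1 a.2 ∧ insert a.2 a.1 = B),
      freqEdgeProb F p a.1 a.2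
      = ∑ π ∈ F.filter (fun π => prefixSet π B.card = B), (p π).toReal := by
  classical
  rw [← Finset.sum_fiberwise_of_maps_to
    (g := fun π : Ranking n => (prefixSet π j, π ⟨j, hjn⟩))
    (t := (donePairs F m).filter (fun a => FreqEdge F a.1 a.2 ∧ insert a.2 a.1 = B))]
  · refine Finset.sum_congr rfl fun a ha => ?_
    obtain ⟨-, h1, h2⟩ := Finset.mem_filter.1 ha
    have hcard : a.1.card = j := by
      have := congrArg Finset.card h2
      rw [Finset.card_insert_of_notMem h1.notMem] at this
      omega
    unfold freqEdgeProb
    rw [Finset.filter_filter]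
    refine Finset.sum_congr (Finset.filter_congr fun π _ => ?_) fun _ _ => rfl
    rw [hcard, hB]
    constructor
    · rintro ⟨h3, h4⟩
      refine ⟨by rw [prefixSet_succ π h4, h3, h2], Prod.ext h3 ?_⟩
      change π ⟨j, hjn⟩ = a.2
      rw [← Equiv.eq_symm_apply]
      exact Fin.ext h4.symm
    · rintro ⟨-, h4⟩
      subst h4
      exact ⟨rfl, by simp⟩
  · intro π hπ
    obtain ⟨h1, h2⟩ := Finset.mem_filter.1 hπ
    obtain ⟨h3, h4⟩ := prefixSet_edge h1 hjn
    refine Finset.mem_filter.2 ⟨mem_donePairs.2 ⟨?_, h3.notMem, h3.freqNode⟩, h3, ?_⟩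
    · simpa [card_prefixSet π hjn.le] using hj
    · rw [← h4, ← hB, h2]

/-- The estimate of a node is the sum of at most `n₀` estimates of frequent edges into it. Each of
them may exceed the truth by `ρ`, whereas all nonfrequent edges together contribute at most `ρ`. -/
lemma LevelInv.isAccurate {n₀ : ℕ} (hn₀ : 0 < n₀) (hn : n₀ ≤ n)
    (hρ : ∑ π ∈ Fᶜ, (p π).toReal ≤ ρ) {ε₀ : ℝ} (hε₀ : 0 ≤ ε₀) (hε : ε ≤ ε₀ / n₀)
    {G : EstDAG n} (h : LevelInv F p ρ ε n₀ G) : IsAccurate n₀ ε₀ ρ F p G := by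
  classical
  have hn₀' : (0 : ℝ) < n₀ := by exact_mod_cast hn₀
  have hρ0 : 0 ≤ ρ := le_trans (Finset.sum_nonneg fun _ _ => ENNReal.toReal_nonneg) hρ
  refine ⟨?_, ?_, ?_, ?_⟩
  · ext A
    have h1 : A ∈ G.nodeSet ↔ A ∈ G.levels.flatten := by
      simp [EstDAG.nodeSet, List.mem_flatten]
    rw [h1, h.mem_flatten]
    constructor
    · rintro ⟨i, hi, π, hπ, hA⟩; exact ⟨π, hπ, i, hi, hA⟩
    · rintro ⟨π, hπ, i, hi, hA⟩; exact ⟨i, hi, π, hπ, hA⟩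
  · ext e
    constructor
    · rintro ⟨a, ha, rfl⟩
      obtain ⟨h1, π, hπ, h2, h3⟩ := (h.loop.edges a).1 ha
      refine ⟨π, hπ, a.1.card, (mem_donePairs.1 h1).1, ?_⟩
      rw [prefixSet_succ π h3, h2]
    · rintro ⟨π, hπ, j, hj, rfl⟩
      obtain ⟨h1, h2⟩ := prefixSet_edge hπ (hj.trans_le hn)
      refine ⟨(prefixSet π j, π ⟨j, hj.trans_le hn⟩), (h.loop.edges _).2
        ⟨mem_donePairs.2 ⟨?_, h1.notMem, h1.freqNode⟩, h1⟩, by rw [h2]⟩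
      simpa [card_prefixSet π (hj.le.trans hn)] using hj
  · rintro A ⟨π, hπ, i, hi, rfl⟩
    rcases i with _ | j
    · have h1 := h.loop.nodeEst_empty
      have h2 : nodeProb p (∅ : Finset (Fin n)) = 1 := by
        unfold nodeProb
        rw [Finset.filter_true_of_mem, sum_toReal_eq_one]
        intro π _
        exact prefixSet_zero π
      simp only at h1
      rw [prefixSet_zero, h1, h2, sub_self, abs_zero]
      positivity
    · have hjn : j < n := by omega
      set B := prefixSet π (j + 1) with hBdef
      have hB : B.card = j + 1 := card_prefixSet π (by omega)
      obtain ⟨h1, h2⟩ := prefixSet_edge hπ hjn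
      have hmem : (prefixSet π j, π ⟨j, hjn⟩) ∈ donePairs F n₀ :=
        mem_donePairs.2 ⟨by simpa [card_prefixSet π hjn.le] using hi, h1.notMem, h1.freqNode⟩
      have h3 := h.loop.nodeEst B ⟨_, hmem, h1, h2.symm⟩
      simp only at h3
      have h4 := sum_freqEdgeProb (F := F) (p := p) (m := n₀) (by omega) hjn hB
      set S := (donePairs F n₀).filter (fun a => FreqEdge F a.1 a.2 ∧ insert a.2 a.1 = B) with hS
      have hSpos : 1 ≤ S.card := Finset.card_pos.2 ⟨_, Finset.mem_filter.2 ⟨hmem, h1, h2.symm⟩⟩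
      have hScard : S.card ≤ n₀ := (card_edges_into_le B _).trans (by omega)
      have hSpos' : (1 : ℝ) ≤ S.card := by exact_mod_cast hSpos
      have hScard' : (S.card : ℝ) ≤ n₀ := by exact_mod_cast hScard
      obtain ⟨h5, h6⟩ := sum_filter_bounds hρ (fun π : Ranking n => prefixSet π B.card = B)
      have h7 : ∑ a ∈ S, freqEdgeProb F p a.1 a.2 - S.card * (ε₀ / n₀)
          ≤ ∑ a ∈ S, G.edgeEst a.1 a.2 := by
        rw [← nsmul_eq_mul, ← Finset.sum_const, ← Finset.sum_sub_distrib]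
        refine Finset.sum_le_sum fun a ha => ?_
        have := (h.loop.good a (Finset.mem_filter.1 ha).1).1
        linarith
      have h8 : ∑ a ∈ S, G.edgeEst a.1 a.2
          ≤ ∑ a ∈ S, freqEdgeProb F p a.1 a.2 + S.card * (ρ + ε₀ / n₀) := by
        rw [← nsmul_eq_mul, ← Finset.sum_const, ← Finset.sum_add_distrib]
        refine Finset.sum_le_sum fun a ha => ?_
        have := (h.loop.good a (Finset.mem_filter.1 ha).1).2
        linarith
      have h9 : (S.card : ℝ) * (ε₀ / n₀) ≤ ε₀ := by
        calc (S.card : ℝ) * (ε₀ / n₀) ≤ n₀ * (ε₀ / n₀) := by gcongr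
          _ = ε₀ := by field_simp
      have h10 : (S.card : ℝ) * ρ ≤ n₀ * ρ := by gcongr
      have h11 : ρ ≤ n₀ * ρ := by nlinarith
      unfold nodeProb
      rw [h3, abs_le]
      constructor <;> nlinarith
  · rintro A ⟨π, hπ, i, hi, hA⟩ z hz ⟨π', hπ', i', hi', hA'⟩
    have hAcard : A.card = i := by rw [hA, card_prefixSet π (by omega)]
    have hcard : A.card + 1 = i' := by
      rw [← Finset.card_insert_of_notMem hz, hA', card_prefixSet π' (by omega)]
    obtain ⟨h1, h2⟩ := h.loop.good (A, z)
      (mem_donePairs.2 ⟨by simp only; omega, hz, π, hπ, by simp only; rw [hAcard, hA]⟩)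
    obtain ⟨h3, h4⟩ := sum_filter_bounds (p := p) hρ
      (fun π : Ranking n => prefixSet π A.card = A ∧ (π.symm z : ℕ) = A.card)
    simp only at h1 h2
    unfold edgeProb
    unfold freqEdgeProb at h1 h2
    rw [abs_le]
    constructor <;> linarith

end

/-! ### The run of the main algorithm -/

/-- The sets of the list `P` are frequent nodes properly contained in `A` that remain frequent
nodes when `z` is added. -/
def IsInterfererList {n : ℕ} (F : Finset (Ranking n)) (A : Finset (Fin n)) (z : Fin n)
    (P : List (Finset (Fin n))) : Prop :=
  P.Nodup ∧ ∀ A' ∈ P, A' ⊂ A ∧ FreqNode F (A'.card + 1) (insert z A')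

/-- A bound for the size of all greedy set covers that occur in the algorithm. -/
def CoverBound {n : ℕ} (F : Finset (Ranking n)) (n₀ c : ℕ) : Prop :=
  ∀ A z P, A.card < n₀ → FreqNode F A.card A → z ∉ A → IsInterfererList F A z P →
    (greedyMinCover A P).val.length ≤ c

/-- A bound for the number of steps of the main algorithm. -/
def dagSteps (n n₀ f c m : ℕ) : ℕ :=
  n₀ * (f * (n + 1 + n * (edgeSteps n (n * f) f c m + (n * (f + 2) + 1))) + n)

section

variable {n : ℕ} {F : Finset (Ranking n)} {p : PMF (Ranking n)} {κ ρ ε δ : ℝ}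

lemma LevelInv.ensures_algIE {j : ℕ} (hj : j < n) (hρ : ∑ π ∈ Fᶜ, (p π).toReal ≤ ρ)
    {n₀ c : ℕ} (hc : CoverBound F n₀ c) (hjn : j < n₀) (hε : 0 < ε) (hδ : 0 < δ) (hδ1 : δ < 1)
    {G : EstDAG n} (hG : LevelInv F p ρ ε j G) {A : Finset (Fin n)} (hA : A ∈ G.levels.getD j [])
    {z : Fin n} (hz : z ∉ A) :
    (algIE G.levels A z ε δ).Ensures p (IsGoodEstimate F p ρ ε A z)
      (edgeSteps n (n * F.card) F.card c (sampleSize c ε δ)) (ENNReal.ofReal δ) := by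
  have hAF := (hG.mem j le_rfl A).1 hA
  have hAcard : A.card = j := hAF.card_eq hj.le
  refine ChoiceDAG.ensures_algIE hρ hz ?_ ?_ hG.length_getD_le ?_ hε hδ hδ1
  · intro π hπ h
    have hlt := Finset.card_lt_card h
    rw [card_prefixSet π (π.symm z).2.le, hAcard] at hlt
    rw [← prefixSet_succ π rfl, card_prefixSet π (by omega)]
    exact ⟨hG.mem_flatten.2 ⟨_, hlt.le, π, hπ, rfl⟩, (hG.mem _ hlt _).2 ⟨π, hπ, rfl⟩⟩
  · exact hG.length_flatten_le.trans (Nat.mul_le_mul_right _ hj)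
  · refine hc A z _ (by omega) (by rwa [hAcard]) hz ⟨?_, ?_⟩
    · unfold interferers
      rw [Timed.val_filter]
      exact (hG.nodup_flatten hj.le).filter _
    · intro A' hA'
      obtain ⟨-, h1, h2⟩ := mem_interferers.1 hA'
      have hzA' : z ∉ A' := fun h => hz (h1.1 h)
      have hlt := Finset.card_lt_card h1
      rw [Finset.card_insert_of_notMem hzA'] at h2
      exact ⟨h1, (hG.mem _ (by omega) _).1 h2⟩

lemma LevelInv.ensures_items {j : ℕ} (hj : j < n) (hρ : ∑ π ∈ Fᶜ, (p π).toReal ≤ ρ)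
    {n₀ c : ℕ} (hc : CoverBound F n₀ c) (hjn : j < n₀) (hε : 0 < ε) (hδ : 0 < δ) (hδ1 : δ < 1)
    (hF : ∀ π ∈ F, κ ≤ (p π).toReal) (hρκ : ρ < κ / 4) (hεκ : ε ≤ κ / 4) (hκ : 0 < κ)
    {G : EstDAG n} (hG : LevelInv F p ρ ε j G) {A : Finset (Fin n)} (hA : A ∈ G.levels.getD j [])
    {D : Finset (Finset (Fin n) × Fin n)} (hD : ∀ z, (A, z) ∉ D)
    {s : EstDAG n × List (Finset (Fin n))} (hs : LoopInv F p ρ ε G.levels j D s)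
    {l : List (Fin n)} (hl : l.Nodup) (hlA : ∀ z ∈ l, z ∉ A) :
    (l.foldlM (fun (s : EstDAG n × List (Finset (Fin n))) z => do
      let e ← algIE G.levels A z ε δ
      charge (n * (s.2.length + 2) + 1)
      return addEdge κ A z e s) s : Prog n _).Ensures p
      (LoopInv F p ρ ε G.levels j (D ∪ l.toFinset.image fun z => (A, z)))
      (l.length * (edgeSteps n (n * F.card) F.card c (sampleSize c ε δ) + (n * (F.card + 2) + 1)))
      (l.length * ENNReal.ofReal δ) := by
  classical
  have hAcard : A.card = j := ((hG.mem j le_rfl A).1 hA).card_eq hj.le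
  refine Prog.Ensures.foldlM
    (T := edgeSteps n (n * F.card) F.card c (sampleSize c ε δ) + (n * (F.card + 2) + 1))
    (η := ENNReal.ofReal δ)
    (fun l₁ s => LoopInv F p ρ ε G.levels j (D ∪ l₁.toFinset.image fun z => (A, z)) s) l ?_
    (by simpa using hs)
  intro l₁ z l₂ s hsplit hs
  have hz : z ∈ l := by rw [hsplit]; simp
  have hz1 : z ∉ l₁ := by
    rw [hsplit] at hl
    intro h
    exact (List.nodup_append.1 hl).2.2 z h z List.mem_cons_self rfl
  have hlen : s.2.length ≤ F.card := by
    refine length_le_card_of_freqNode (i := j + 1) hs.nodup fun B hB => ?_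
    obtain ⟨a, -, h1, h2, rfl⟩ := (hs.mem B).1 hB
    rw [← h1]
    exact h2.freqNode_insert
  refine Prog.Ensures.mono
    (Q := LoopInv F p ρ ε G.levels j (D ∪ (l₁ ++ [z]).toFinset.image fun z => (A, z)))
    (T := edgeSteps n (n * F.card) F.card c (sampleSize c ε δ) + ((n * (F.card + 2) + 1) + 0))
    (η := ENNReal.ofReal δ + (0 + 0)) ?_ (fun _ h => h) (by omega) (by simp)
  refine Prog.Ensures.bind (hG.ensures_algIE hj hρ hc hjn hε hδ hδ1 hA (hlA z hz)) fun e he => ?_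
  refine Prog.Ensures.bind (ensures_charge (by gcongr)) fun _ _ => Prog.Ensures.pure ?_
  have hnew : (A, z) ∉ D ∪ l₁.toFinset.image fun z => (A, z) := by
    simp [hD, hz1]
  have h := hs.addEdge hF hρκ hεκ hκ hAcard hnew he
  have heq : insert (A, z) (D ∪ l₁.toFinset.image fun z => (A, z))
      = D ∪ (l₁ ++ [z]).toFinset.image fun z => (A, z) := by
    ext a
    simp only [Finset.mem_insert, Finset.mem_union, Finset.mem_image, List.mem_toFinset,
      List.mem_append, List.mem_singleton]
    constructor
    · rintro (rfl | h | ⟨y, hy, rfl⟩)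
      · exact Or.inr ⟨z, Or.inr rfl, rfl⟩
      · exact Or.inl h
      · exact Or.inr ⟨y, Or.inl hy, rfl⟩
    · rintro (h | ⟨y, hy | rfl, rfl⟩)
      · exact Or.inr (Or.inl h)
      · exact Or.inr (Or.inr ⟨y, hy, rfl⟩)
      · exact Or.inl rfl
  rwa [heq] at h

lemma LevelInv.ensures_nodes {j : ℕ} (hj : j < n) (hρ : ∑ π ∈ Fᶜ, (p π).toReal ≤ ρ)
    {n₀ c : ℕ} (hc : CoverBound F n₀ c) (hjn : j < n₀) (hε : 0 < ε) (hδ : 0 < δ) (hδ1 : δ < 1)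
    (hF : ∀ π ∈ F, κ ≤ (p π).toReal) (hρκ : ρ < κ / 4) (hεκ : ε ≤ κ / 4) (hκ : 0 < κ)
    {G : EstDAG n} (hG : LevelInv F p ρ ε j G) :
    ((G.levels.getD j []).foldlM
        (fun (s : EstDAG n × List (Finset (Fin n))) A => do
          charge (n + 1)
          ((List.finRange n).filter (fun z => z ∉ A)).foldlM
            (fun (s : EstDAG n × List (Finset (Fin n))) z => do
              let e ← algIE G.levels A z ε δ
              charge (n * (s.2.length + 2) + 1)
              return addEdge κ A z e s) s)
        (G, []) : Prog n _).Ensures p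
      (LoopInv F p ρ ε G.levels j (donePairs F (j + 1)))
      (F.card * (n + 1 + n * (edgeSteps n (n * F.card) F.card c (sampleSize c ε δ)
        + (n * (F.card + 2) + 1))))
      (F.card * (n * ENNReal.ofReal δ)) := by
  classical
  set l := G.levels.getD j [] with hl
  set T := edgeSteps n (n * F.card) F.card c (sampleSize c ε δ) + (n * (F.card + 2) + 1) with hT
  have hlen : l.length ≤ F.card := hG.length_getD_le j
  -- the pairs processed after the nodes of the list `l₁`
  set D : List (Finset (Fin n)) → Finset (Finset (Fin n) × Fin n) := fun l₁ =>
    donePairs F j ∪ univ.filter fun a => a.1 ∈ l₁ ∧ a.2 ∉ a.1 with hD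
  have hcard : ∀ A ∈ l, A.card = j := fun A hA => ((hG.mem j le_rfl A).1 hA).card_eq hj.le
  have hmain := Prog.Ensures.foldlM (p := p) (T := n + 1 + n * T) (η := n * ENNReal.ofReal δ)
    (f := fun (s : EstDAG n × List (Finset (Fin n))) A => do
          charge (n + 1)
          ((List.finRange n).filter (fun z => z ∉ A)).foldlM
            (fun (s : EstDAG n × List (Finset (Fin n))) z => do
              let e ← algIE G.levels A z ε δ
              charge (n * (s.2.length + 2) + 1)
              return addEdge κ A z e s) s)
    (s := (G, []))
    (fun l₁ s => LoopInv F p ρ ε G.levels j (D l₁) s) l ?_ ?_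
  · have hfin : D l = donePairs F (j + 1) := by
      ext a
      simp only [hD, Finset.mem_union, Finset.mem_filter, Finset.mem_univ, true_and, mem_donePairs]
      constructor
      · rintro (⟨h1, h2, h3⟩ | ⟨h1, h2⟩)
        · exact ⟨by omega, h2, h3⟩
        · refine ⟨by rw [hcard _ h1]; omega, h2, ?_⟩
          rw [hcard _ h1]
          exact (hG.mem j le_rfl _).1 h1
      · rintro ⟨h1, h2, h3⟩
        rcases Nat.lt_succ_iff_lt_or_eq.1 h1 with h4 | h4
        · exact Or.inl ⟨h4, h2, h3⟩
        · rw [h4] at h3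
          exact Or.inr ⟨(hG.mem j le_rfl _).2 h3, h2⟩
    rw [hfin] at hmain
    exact hmain.mono (fun _ h => h) (by gcongr) (by gcongr)
  · intro l₁ A l₂ s hsplit hs
    have hA : A ∈ l := by rw [hsplit]; simp
    have hA1 : A ∉ l₁ := by
      have hnd := hG.nodup j
      rw [← hl, hsplit] at hnd
      intro h
      exact (List.nodup_append.1 hnd).2.2 A h A List.mem_cons_self rfl
    have hnew : ∀ z, (A, z) ∉ D l₁ := by
      intro z
      simp only [hD, Finset.mem_union, Finset.mem_filter, Finset.mem_univ, true_and,
        mem_donePairs, hcard A hA, hA1, lt_irrefl, false_and, or_self, not_false_eq_true]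
    have hitems := hG.ensures_items hj hρ hc hjn hε hδ hδ1 hF hρκ hεκ hκ hA hnew hs
      (l := (List.finRange n).filter (fun z => z ∉ A)) ((List.nodup_finRange n).filter _)
      (fun z hz => by simpa using hz)
    have hlen' : ((List.finRange n).filter (fun z => z ∉ A)).length ≤ n :=
      (List.length_filter_le _ _).trans (List.length_finRange (n := n)).le
    have hset : D l₁ ∪ ((List.finRange n).filter (fun z => z ∉ A)).toFinset.image
        (fun z => (A, z)) = D (l₁ ++ [A]) := by
      ext ⟨B, y⟩
      simp only [hD, Finset.mem_union, Finset.mem_filter, Finset.mem_univ, true_and,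
        Finset.mem_image, List.mem_toFinset, List.mem_filter, List.mem_finRange,
        decide_eq_true_eq, Prod.mk.injEq, List.mem_append, List.mem_singleton]
      constructor
      · rintro ((h | ⟨h1, h2⟩) | ⟨z, hz, rfl, rfl⟩)
        · exact Or.inl h
        · exact Or.inr ⟨Or.inl h1, h2⟩
        · exact Or.inr ⟨Or.inr rfl, hz⟩
      · rintro (h | ⟨h1 | rfl, h2⟩)
        · exact Or.inl (Or.inl h)
        · exact Or.inl (Or.inr ⟨h1, h2⟩)
        · exact Or.inr ⟨y, h2, rfl, rfl⟩
    rw [hset] at hitems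
    refine (Prog.Ensures.bind (ensures_charge (le_refl (n + 1))) fun _ _ => hitems).mono
      (fun _ h => h) ?_ ?_
    · gcongr
    · rw [zero_add]
      gcongr
  · have : D [] = donePairs F j := by simp [hD]
    rw [this]
    exact hG.loop

/-- The main algorithm succeeds with probability at least `1 - n₀ · |F| · n · δ`, where `δ` is the
failure probability of a single estimate. -/
lemma ensures_levels {n₀ c : ℕ} (hn : n₀ < n) (hρ : ∑ π ∈ Fᶜ, (p π).toReal ≤ ρ)
    (hc : CoverBound F n₀ c) (hε : 0 < ε) (hδ : 0 < δ) (hδ1 : δ < 1)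
    (hF : ∀ π ∈ F, κ ≤ (p π).toReal) (hρκ : ρ < κ / 4) (hεκ : ε ≤ κ / 4) (hκ : 0 < κ)
    (hne : F.Nonempty) :
    ((List.range n₀).foldlM
    (fun (G : EstDAG n) j => do
      let s ← (G.levels.getD j []).foldlM
        (fun (s : EstDAG n × List (Finset (Fin n))) A => do
          charge (n + 1)
          ((List.finRange n).filter (fun z => z ∉ A)).foldlM
            (fun (s : EstDAG n × List (Finset (Fin n))) z => do
              let e ← algIE G.levels A z ε δ
              charge (n * (s.2.length + 2) + 1)
              return addEdge κ A z e s) s)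
        (G, [])
      charge (j + 1)
      return { s.1 with levels := s.1.levels ++ [s.2] })
    (EstDAG.start n) : Prog n _).Ensures p (LevelInv F p ρ ε n₀)
      (dagSteps n n₀ F.card c (sampleSize c ε δ))
      (n₀ * (F.card * (n * ENNReal.ofReal δ))) := by
  set T := F.card * (n + 1 + n * (edgeSteps n (n * F.card) F.card c (sampleSize c ε δ)
        + (n * (F.card + 2) + 1))) with hT
  have hmain := Prog.Ensures.foldlM (p := p) (T := T + n)
    (η := F.card * (n * ENNReal.ofReal δ))
    (f := fun (G : EstDAG n) j => do
      let s ← (G.levels.getD j []).foldlM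
        (fun (s : EstDAG n × List (Finset (Fin n))) A => do
          charge (n + 1)
          ((List.finRange n).filter (fun z => z ∉ A)).foldlM
            (fun (s : EstDAG n × List (Finset (Fin n))) z => do
              let e ← algIE G.levels A z ε δ
              charge (n * (s.2.length + 2) + 1)
              return addEdge κ A z e s) s)
        (G, [])
      charge (j + 1)
      return { s.1 with levels := s.1.levels ++ [s.2] })
    (s := EstDAG.start n)
    (fun l G => LevelInv F p ρ ε l.length G) (List.range n₀) ?_ (levelInv_start hne)
  · rw [List.length_range] at hmain
    exact hmain
  · intro l₁ j l₂ G hsplit hG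
    have hlen : l₁.length = j ∧ j < n₀ := by
      have h1 := congrArg List.length hsplit
      rw [List.length_range, List.length_append, List.length_cons] at h1
      have h2 : (List.range n₀)[l₁.length]'(by rw [List.length_range]; omega) = j := by
        simp only [hsplit, List.getElem_append_right le_rfl, Nat.sub_self, List.getElem_cons_zero]
      rw [List.getElem_range] at h2
      exact ⟨h2, by omega⟩
    obtain ⟨hlen, hj⟩ := hlen
    rw [hlen] at hG
    refine Prog.Ensures.mono (Q := LevelInv F p ρ ε (l₁ ++ [j]).length)
      (T := T + (n + 0)) (η := F.card * (n * ENNReal.ofReal δ) + (0 + 0)) ?_ (fun _ h => h)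
      (by omega) (by simp)
    refine Prog.Ensures.bind
      (hG.ensures_nodes (hj.trans hn) hρ hc hj hε hδ hδ1 hF hρκ hεκ hκ) fun s hs => ?_
    refine Prog.Ensures.bind (ensures_charge (by omega)) fun _ _ => Prog.Ensures.pure ?_
    rw [List.length_append, List.length_singleton, hlen]
    exact hG.next (hj.trans hn) hs

end

/-! ### Models -/

section

variable {n : ℕ} {F₀ F : Finset (Ranking n)} {p : PMF (Ranking n)} {κ ρ : ℝ}

lemma IsModel.sum_compl_le (h : IsModel κ ρ F₀ F p) : ∑ π ∈ Fᶜ, (p π).toReal ≤ ρ := by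
  classical
  refine le_trans (le_of_eq ?_) h.rare_total
  symm
  refine Finset.sum_subset ?_ ?_
  · intro π hπ
    simpa using (Finset.mem_filter.1 hπ).2.2
  · intro π hπ hπ'
    by_contra h0
    refine hπ' (Finset.mem_filter.2 ⟨Finset.mem_univ _, ?_, by simpa using hπ⟩)
    exact lt_of_le_of_ne ENNReal.toReal_nonneg (Ne.symm h0)

lemma IsModel.card_mul_le_one (h : IsModel κ ρ F₀ F p) : F.card * κ ≤ 1 := by
  classical
  rw [← sum_toReal_eq_one p, ← nsmul_eq_mul]
  exact (Finset.card_nsmul_le_sum F _ κ h.frequent).trans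
    (Finset.sum_le_sum_of_subset_of_nonneg (Finset.subset_univ _)
      fun _ _ _ => ENNReal.toReal_nonneg)

/-- Some type is frequent, because the rare types cannot carry the entire probability. -/
lemma IsModel.nonempty (h : IsModel κ ρ F₀ F p) (hρ : ρ < 1) : F.Nonempty := by
  classical
  by_contra hF
  rw [Finset.not_nonempty_iff_eq_empty] at hF
  have h1 := h.sum_compl_le
  rw [hF, Finset.compl_empty, sum_toReal_eq_one] at h1
  linarith

/-- The single failure probabilities `δ / (α n² K)` add up to at most `δ`, since `α n = n₀`. -/
lemma ensures_algDAG {n₀ K c : ℕ} {α ε δ : ℝ} (hn : 0 < n) (hα₀ : 0 < α) (hα₁ : α < 1)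
    (hn₀ : (n₀ : ℝ) = α * n) (hκ : 0 < κ) (hκ1 : κ < 1) (hρ : ρ < κ / 4) (hε : 0 < ε)
    (hδ : 0 < δ) (hδ1 : δ < 1) (hK : F₀.card ≤ K) (h : IsModel κ ρ F₀ F p)
    (hc : CoverBound F n₀ c) :
    (algDAG n n₀ K α κ ε δ).Ensures p (IsAccurate n₀ ε ρ F p)
      (dagSteps n n₀ F.card c (sampleSize c (min (ε / n₀) (κ / 4)) (δ / (α * n ^ 2 * K))))
      (ENNReal.ofReal δ) := by
  have hn' : (0 : ℝ) < n := by exact_mod_cast hn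
  have hn₀' : (0 : ℝ) < n₀ := by rw [hn₀]; positivity
  have hn₀pos : 0 < n₀ := by exact_mod_cast hn₀'
  have hlt : n₀ < n := by
    have : (n₀ : ℝ) < n := by rw [hn₀]; nlinarith
    exact_mod_cast this
  have hne : F.Nonempty := h.nonempty (by linarith)
  have hFK : F.card ≤ K := (Finset.card_le_card h.subset).trans hK
  have hKpos : 0 < K := (Finset.card_pos.2 hne).trans_le hFK
  have hden : α * n ^ 2 * K = ((n₀ * n * K : ℕ) : ℝ) := by
    push_cast; rw [hn₀]; ring
  have hden1 : (1 : ℝ) ≤ ((n₀ * n * K : ℕ) : ℝ) := by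
    exact_mod_cast Nat.mul_pos (Nat.mul_pos hn₀pos hn) hKpos
  have hδ' : 0 < δ / (α * n ^ 2 * K) := by rw [hden]; positivity
  have hδ'1 : δ / (α * n ^ 2 * K) < 1 := by
    rw [hden, div_lt_one (by linarith)]
    linarith
  have hmain := ensures_levels (ε := min (ε / n₀) (κ / 4)) hlt h.sum_compl_le hc
    (lt_min (by positivity) (by positivity)) hδ' hδ'1 h.frequent hρ (min_le_right _ _) hκ hne
  refine Prog.Ensures.mono hmain
    (fun G hG => hG.isAccurate hn₀pos hlt.le h.sum_compl_le hε.le (min_le_left _ _)) le_rfl ?_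
  have h1 : (n₀ : ℝ≥0∞) * (F.card * (n * ENNReal.ofReal (δ / (α * n ^ 2 * K))))
      ≤ n₀ * (K * (n * ENNReal.ofReal (δ / (α * n ^ 2 * K)))) := by
    gcongr
  refine h1.trans (le_of_eq ?_)
  rw [hden, ← ENNReal.ofReal_natCast n₀, ← ENNReal.ofReal_natCast n, ← ENNReal.ofReal_natCast K,
    ← ENNReal.ofReal_mul hn'.le, ← ENNReal.ofReal_mul (by positivity),
    ← ENNReal.ofReal_mul (by positivity)]
  congr 1
  have hK' : (0 : ℝ) < K := by exact_mod_cast hKpos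
  push_cast
  field_simp

/-- Accuracy needs no particular bound for the covers: there are only finitely many sets. -/
lemma exists_coverBound (F : Finset (Ranking n)) (n₀ : ℕ) : ∃ c, CoverBound F n₀ c := by
  refine ⟨Fintype.card (Finset (Fin n)), fun A z P _ _ _ hP => ?_⟩
  refine (?_ : _ ≤ P.length).trans hP.1.length_le_card
  have key : ∀ (k : ℕ) (U : List (Finset (Fin n))), (∀ A' ∈ U, A' ⊂ A) →
      (greedyAux A k U).val.length ≤ k := by
    intro k
    induction k with
    | zero => intro U _; exact le_rfl
    | succ k ih =>
      intro U hU
      by_cases hne : U = []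
      · subst hne; simp [greedyAux_nil]
      · obtain ⟨x, -, hx, -, -⟩ := bestItem_spec hU hne
        rw [(greedyAux_of_bestItem (k := k) hne hx).1, List.length_cons]
        exact Nat.succ_le_succ (ih _ fun A' hA' => hU A' (List.mem_filter.1 hA').1)
  exact key _ _ fun A' hA' => (hP.2 A' hA').1

/-- The accuracy guarantee in the general model. -/
theorem accuracy_general {n₀ K : ℕ} {α ε δ : ℝ} (hn : 0 < n) (hα₀ : 0 < α) (hα₁ : α < 1)
    (hn₀ : (n₀ : ℝ) = α * n) (hκ : 0 < κ) (hκ1 : κ < 1) (hρ : ρ < κ / 4) (hε : 0 < ε)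
    (hδ : 0 < δ) (hδ1 : δ < 1) (hK : F₀.card ≤ K) (h : IsModel κ ρ F₀ F p) :
    1 - δ ≤ prob ((algDAG n n₀ K α κ ε δ).run p) {o | IsAccurate n₀ ε ρ F p o.val} := by
  obtain ⟨c, hc⟩ := exists_coverBound F n₀
  refine one_sub_le_prob _ hδ.le (le_trans (MeasureTheory.measure_mono ?_)
    (ensures_algDAG hn hα₀ hα₁ hn₀ hκ hκ1 hρ hε hδ hδ1 hK h hc))
  exact Set.compl_subset_compl.2 fun o ho => ho.1

end

/-! ### The size of greedy set covers -/

lemma length_filter_add_countP {n : ℕ} (U : List (Finset (Fin n))) (x : Fin n) :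
    (U.filter fun A' => x ∈ A').length + U.countP (fun A' => x ∉ A') = U.length := by
  rw [← List.countP_eq_length_filter, U.length_eq_countP_add_countP (fun A' => x ∈ A')]
  simp

/-- If every subfamily has an item that is missing from a quarter of its members, then each round
of the greedy algorithm removes at least a quarter of the remaining sets. -/
lemma length_greedyAux_of_quarter {n : ℕ} {A : Finset (Fin n)} (k : ℕ)
    (U : List (Finset (Fin n))) (hU : ∀ A' ∈ U, A' ⊂ A)
    (H : ∀ V : List (Finset (Fin n)), V ⊆ U → V ≠ [] →
      ∃ x ∈ A, V.length ≤ 4 * V.countP (fun A' => x ∉ A')) :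
    (greedyAux A k U).val.length = 0 ∨ U = [] ∨
      4 ^ ((greedyAux A k U).val.length - 1)
        ≤ U.length * 3 ^ ((greedyAux A k U).val.length - 1) := by
  induction k generalizing U with
  | zero => exact Or.inl rfl
  | succ k ih =>
    by_cases hne : U = []
    · exact Or.inr (Or.inl hne)
    · right; right
      obtain ⟨x, hxA, hx, hbest, hex⟩ := bestItem_spec hU hne
      rw [(greedyAux_of_bestItem (k := k) hne hx).1, List.length_cons, Nat.add_sub_cancel]
      obtain ⟨y, hyA, hy⟩ := H U (List.Subset.refl _) hne
      have h1 := hbest y hyA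
      have h2 := length_filter_add_countP U x
      have h3 := ih (U.filter fun A' => x ∈ A') (fun A' hA' => hU A' (List.mem_filter.1 hA').1)
        fun V hV => H V fun A' hA' => (List.mem_filter.1 (hV hA')).1
      have hpos : 0 < U.length := List.length_pos_iff.2 hne
      set ℓ := (greedyAux A k (U.filter fun A' => x ∈ A')).val.length with hℓ
      rcases Nat.eq_zero_or_pos ℓ with h0 | h0
      · rw [h0, pow_zero, pow_zero, mul_one]; exact hpos
      · rcases h3 with h3 | h3 | h3
        · omega
        · rw [h3, greedyAux_nil] at hℓ
          simp at hℓ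
          omega
        · obtain ⟨e, he⟩ : ∃ e, ℓ = e + 1 := ⟨ℓ - 1, by omega⟩
          rw [he, Nat.add_sub_cancel] at h3
          rw [he]
          have h4 : 4 * (U.filter fun A' => x ∈ A').length ≤ 3 * U.length := by omega
          calc 4 ^ (e + 1) = 4 * 4 ^ e := by ring
            _ ≤ 4 * ((U.filter fun A' => x ∈ A').length * 3 ^ e) := by gcongr
            _ = (4 * (U.filter fun A' => x ∈ A').length) * 3 ^ e := by ring
            _ ≤ (3 * U.length) * 3 ^ e := by gcongr
            _ = U.length * 3 ^ (e + 1) := by ring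

/-- After `t` rounds of the greedy algorithm, all remaining sets contain the `t` selected items. -/
lemma length_greedyAux_le {n : ℕ} {A : Finset (Fin n)} {t b : ℕ} (P : List (Finset (Fin n)))
    (hP : ∀ A' ∈ P, A' ⊂ A)
    (H : ∀ V : List (Finset (Fin n)), V.Sublist P → (∀ A' ∈ V, t ≤ A'.card) →
      ∀ k, (greedyAux A k V).val.length ≤ b) (k : ℕ) :
    (greedyAux A k P).val.length ≤ t + b := by
  have key : ∀ (k : ℕ) (U : List (Finset (Fin n))) (T : Finset (Fin n)), U.Sublist P →
      (∀ A' ∈ U, T ⊆ A') → (greedyAux A k U).val.length ≤ (t - T.card) + b := by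
    intro k
    induction k with
    | zero => intro U T _ _; exact Nat.zero_le _
    | succ k ih =>
      intro U T hUP hT
      by_cases hlt : t ≤ T.card
      · refine (H U hUP (fun A' hA' => hlt.trans (Finset.card_le_card (hT A' hA'))) _).trans ?_
        omega
      · by_cases hne : U = []
        · subst hne
          simp [greedyAux_nil]
        · obtain ⟨x, hxA, hx, -, A', hA', hxA'⟩ :=
            bestItem_spec (fun A' hA' => hP A' (hUP.subset hA')) hne
          rw [(greedyAux_of_bestItem (k := k) hne hx).1, List.length_cons]
          have hxT : x ∉ T := fun h => hxA' (hT A' hA' h)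
          have h1 := ih (U.filter fun A' => x ∈ A') (insert x T)
            (List.filter_sublist.trans hUP) (fun B hB => by
              obtain ⟨hB1, hB2⟩ := List.mem_filter.1 hB
              exact Finset.insert_subset (by simpa using hB2) (hT B hB1))
          rw [Finset.card_insert_of_notMem hxT] at h1
          omega
  exact (key k P ∅ (List.Sublist.refl _) fun _ _ => Finset.empty_subset _).trans (by simp)

/-- Fewer than `r` types of `F` other than `π` have their first `t + 1` items among those in the
first `n₀` positions of `π` and one further item. (No condition if `t + 1 > n₀`.) -/
def FewOverlaps {n : ℕ} (F : Finset (Ranking n)) (n₀ r t : ℕ) : Prop :=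
  t + 1 ≤ n₀ → ∀ π ∈ F, ∀ z : Fin n,
    (F.filter fun σ => σ ≠ π ∧ prefixSet σ (t + 1) ⊆ insert z (prefixSet π n₀)).card < r

/-- Pigeonhole: one of at most four colors occurs in at least a quarter of a list. -/
lemma exists_color_quarter {β γ : Type} [DecidableEq γ] (V : List β) (hV : V ≠ []) (col : β → γ)
    (R : Finset γ) (hR : R.card ≤ 4) (hcol : ∀ b ∈ V, col b ∈ R) :
    ∃ σ ∈ R, V.length ≤ 4 * V.countP (fun b => col b = σ) := by
  have hsum : V.length = ∑ σ ∈ R, V.countP (fun b => col b = σ) := by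
    clear hV
    induction V with
    | nil => simp
    | cons b V ih =>
      simp only [List.countP_cons, Finset.sum_add_distrib, List.length_cons]
      rw [ih fun b hb => hcol b (List.mem_cons_of_mem _ hb)]
      simp [hcol b List.mem_cons_self]
  by_contra hcon
  push Not at hcon
  have hpos : 0 < V.length := List.length_pos_iff.2 hV
  have h1 : ∑ σ ∈ R, 4 * V.countP (fun b => col b = σ) ≤ R.card * (V.length - 1) := by
    rw [← smul_eq_mul, ← Finset.sum_const]
    refine Finset.sum_le_sum fun σ hσ => ?_
    have := hcon σ hσ
    omega
  rw [← Finset.mul_sum, ← hsum] at h1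
  have h2 : R.card * (V.length - 1) ≤ 4 * (V.length - 1) := Nat.mul_le_mul_right _ hR
  omega

/-- If few types overlap, then all interferers with at least `t` items lie in at most four chains
of at most `L` sets each, so that they are covered in logarithmically many rounds. -/
lemma coverBound_of_fewOverlaps {n : ℕ} {F : Finset (Ranking n)} {n₀ t L b : ℕ}
    (ht : FewOverlaps F n₀ 5 t) (hL : FewOverlaps F n₀ 1 L)
    (hb : ∀ ℓ, 4 ^ (ℓ - 1) ≤ 4 * L * 3 ^ (ℓ - 1) → ℓ ≤ b) : CoverBound F n₀ (t + b) := by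
  classical
  intro A z P hAn hA hz hP
  obtain ⟨π, hπ, hAπ⟩ := hA
  have hAsub : A ⊆ prefixSet π n₀ := by
    rw [hAπ]; exact prefixSet_mono π hAn.le
  -- the second type of an edge `A' ⊂ A' ∪ {z}` differs from `π`, since `z ∉ A`
  have hex : ∀ A' ∈ P, ∃ σ ∈ F, insert z A' = prefixSet σ (A'.card + 1) ∧ σ ≠ π ∧
      A'.card + 1 ≤ n₀ ∧ prefixSet σ (A'.card + 1) ⊆ insert z (prefixSet π n₀) := by
    intro A' hA'
    obtain ⟨h1, σ, hσ, h2⟩ := hP.2 A' hA'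
    have hlt := Finset.card_lt_card h1
    refine ⟨σ, hσ, h2, ?_, by omega, ?_⟩
    · rintro rfl
      apply hz
      rw [hAπ]
      refine prefixSet_mono σ (by omega : A'.card + 1 ≤ A.card) ?_
      rw [← h2]
      exact Finset.mem_insert_self _ _
    · rw [← h2]
      exact Finset.insert_subset_insert _ (h1.1.trans hAsub)
  have herase : ∀ A' ∈ P, ∀ σ : Ranking n, insert z A' = prefixSet σ (A'.card + 1) →
      A' = (prefixSet σ (A'.card + 1)).erase z := by
    intro A' hA' σ h
    rw [← h, Finset.erase_insert fun h => hz ((hP.2 A' hA').1.1 h)]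
  choose! col hcolF hcol hcolne hcard hcolsub using hex
  have hsize : ∀ A' ∈ P, A'.card < L := by
    intro A' hA'
    by_contra hcon
    push Not at hcon
    have h1 := hcard A' hA'
    have h2 := hL (by omega) π hπ z
    rw [Nat.lt_one_iff, Finset.card_eq_zero] at h2
    have h3 : col A' ∈ (∅ : Finset (Ranking n)) := by
      rw [← h2]
      exact Finset.mem_filter.2 ⟨hcolF A' hA', hcolne A' hA',
        (prefixSet_mono _ (by omega)).trans (hcolsub A' hA')⟩
    simp at h3
  refine length_greedyAux_le P (fun A' hA' => (hP.2 A' hA').1) ?_ _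
  intro V hVP hVt k
  by_cases hne : V = []
  · subst hne; simp [greedyAux_nil]
  obtain ⟨A₀, hA₀⟩ := List.exists_mem_of_ne_nil V hne
  have htn : t + 1 ≤ n₀ := by
    have := hcard A₀ (hVP.subset hA₀)
    have := hVt A₀ hA₀
    omega
  set R := F.filter fun σ => σ ≠ π ∧ prefixSet σ (t + 1) ⊆ insert z (prefixSet π n₀) with hRdef
  have hR : R.card ≤ 4 := Nat.lt_succ_iff.1 (ht htn π hπ z)
  have hcolR : ∀ A' ∈ V, col A' ∈ R := by
    intro A' hA'
    have h1 := hVP.subset hA'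
    have h2 := hVt A' hA'
    exact Finset.mem_filter.2 ⟨hcolF A' h1, hcolne A' h1,
      (prefixSet_mono _ (by omega)).trans (hcolsub A' h1)⟩
  have hVlen : V.length ≤ 4 * L := by
    have hnd : V.Nodup := hP.1.sublist hVP
    rw [← List.toFinset_card_of_nodup hnd]
    refine (Finset.card_le_card_of_injOn (t := R ×ˢ Finset.range L)
      (fun A' => (col A', A'.card)) ?_ ?_).trans ?_
    · intro A' hA'
      have hA' : A' ∈ V := by simpa using hA'
      have h1 := hcolR A' hA'
      have h2 := hsize A' (hVP.subset hA')
      simp [h1, h2]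
    · intro A' hA' B' hB' hAB
      have hA' : A' ∈ V := by simpa using hA'
      have hB' : B' ∈ V := by simpa using hB'
      obtain ⟨h1, h2⟩ := Prod.mk.inj hAB
      rw [herase A' (hVP.subset hA') _ (hcol A' (hVP.subset hA')),
        herase B' (hVP.subset hB') _ (hcol B' (hVP.subset hB')), h1, h2]
    · rw [Finset.card_product, Finset.card_range]
      exact Nat.mul_le_mul_right _ hR
  have hquarter := length_greedyAux_of_quarter (A := A) k V
    (fun A' hA' => (hP.2 A' (hVP.subset hA')).1) (by
      intro W hW hWne
      obtain ⟨σ, -, hσ⟩ := exists_color_quarter W hWne col R hR fun A' hA' => hcolR A' (hW hA')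
      have hWpos : 0 < W.length := List.length_pos_iff.2 hWne
      have hcount : 0 < W.countP (fun A' => col A' = σ) := by omega
      obtain ⟨B, hB, hBσ⟩ := List.countP_pos_iff.1 hcount
      -- the largest set of the chain misses an item of `A`, and so do all others
      obtain ⟨M, hM, hmax⟩ := Finset.exists_max_image
        (W.toFinset.filter fun A' => col A' = σ) Finset.card
        ⟨B, Finset.mem_filter.2 ⟨List.mem_toFinset.2 hB, by simpa using hBσ⟩⟩
      obtain ⟨hMW, hMσ⟩ := Finset.mem_filter.1 hM
      have hMP := hVP.subset (hW (List.mem_toFinset.1 hMW))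
      obtain ⟨x, hxA, hxM⟩ := Finset.exists_of_ssubset (hP.2 M hMP).1
      refine ⟨x, hxA, hσ.trans (Nat.mul_le_mul_left _ (List.countP_mono_left ?_))⟩
      intro A' hA' hA'σ
      have hA'σ' : col A' = σ := by simpa using hA'σ
      have hA'P := hVP.subset (hW hA')
      have hle := hmax A' (Finset.mem_filter.2 ⟨List.mem_toFinset.2 hA', hA'σ'⟩)
      have hsub : A' ⊆ M := by
        rw [herase A' hA'P _ (hcol A' hA'P), herase M hMP _ (hcol M hMP), hA'σ', hMσ]
        exact Finset.erase_subset_erase _ (prefixSet_mono _ (by omega))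
      simpa using fun h => hxM (hsub h))
  rcases hquarter with h | h | h
  · omega
  · exact absurd h hne
  · exact hb _ (h.trans (Nat.mul_le_mul_right _ hVlen))

/-! ### Overlaps of random rankings -/

/-- The first `m` items of a uniformly random ranking all belong to `B` with probability at most
`(|B| / n) ^ m`. -/
lemma card_prefixSet_subset_le {n : ℕ} (B : Finset (Fin n)) (m : ℕ) (hm : m ≤ n) :
    (univ.filter fun π : Ranking n => prefixSet π m ⊆ B).card * n ^ m
      ≤ B.card ^ m * Fintype.card (Ranking n) := by
  classical
  set S : ℕ → Finset (Ranking n) := fun m =>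
    univ.filter fun π : Ranking n => prefixSet π m ⊆ B with hS
  have hmemS : ∀ (m : ℕ) (π : Ranking n), π ∈ S m ↔ ∀ i : Fin n, (i : ℕ) < m → π i ∈ B := by
    intro m π
    simp only [hS, Finset.mem_filter, Finset.mem_univ, true_and]
    constructor
    · intro h i hi
      exact h (mem_prefixSet.2 (by simpa using hi))
    · intro h x hx
      simpa using h (π.symm x) (mem_prefixSet.1 hx)
  change (S m).card * n ^ m ≤ _
  induction m with
  | zero =>
    simp only [pow_zero, mul_one, one_mul]
    exact Finset.card_le_univ _
  | succ m ih =>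
    have hm' : m < n := hm
    have ih := ih hm'.le
    set i₀ : Fin n := ⟨m, hm'⟩ with hi₀
    -- by symmetry, every position `i ≥ m` is equally likely to carry an item of `B`
    have hswap : ∀ i : Fin n, m ≤ (i : ℕ) →
        (S (m + 1)).card = ((S m).filter fun π => π i ∈ B).card := by
      intro i hi
      refine Finset.card_bij (fun π _ => (Equiv.swap i₀ i).trans π) ?_ ?_ ?_
      · intro π hπ
        rw [hmemS] at hπ
        rw [Finset.mem_filter, hmemS]
        constructor
        · intro k hk
          have h1 : k ≠ i₀ := by rintro rfl; simp [hi₀] at hk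
          have h2 : k ≠ i := by rintro rfl; omega
          rw [Equiv.trans_apply, Equiv.swap_apply_of_ne_of_ne h1 h2]
          exact hπ k (by omega)
        · rw [Equiv.trans_apply, Equiv.swap_apply_right]
          exact hπ i₀ (by simp [hi₀])
      · intro π _ σ _ h
        have := congrArg (fun τ => (Equiv.swap i₀ i).trans τ) h
        simpa [← Equiv.trans_assoc] using this
      · intro π hπ
        obtain ⟨h1, h2⟩ := Finset.mem_filter.1 hπ
        rw [hmemS] at h1
        refine ⟨(Equiv.swap i₀ i).trans π, ?_, by simp [← Equiv.trans_assoc]⟩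
        rw [hmemS]
        intro k hk
        rw [Equiv.trans_apply]
        by_cases h3 : k = i₀
        · rw [h3, Equiv.swap_apply_left]; exact h2
        · have h4 : (k : ℕ) < m := by
            have : (k : ℕ) ≠ m := fun h => h3 (Fin.ext h)
            omega
          have h5 : k ≠ i := by rintro rfl; omega
          rw [Equiv.swap_apply_of_ne_of_ne h3 h5]
          exact h1 k h4
    have hlate : ((univ : Finset (Fin n)).filter fun i : Fin n => m ≤ (i : ℕ)).card = n - m := by
      have h1 := Finset.card_filter_add_card_filter_not (s := (univ : Finset (Fin n)))
        (fun i : Fin n => (i : ℕ) < m)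
      rw [Fin.card_filter_val_lt, Finset.card_univ, Fintype.card_fin, min_eq_right hm'.le] at h1
      simp only [not_lt] at h1
      omega
    have hcount : (n - m) * (S (m + 1)).card ≤ (S m).card * (B.card - m) := by
      have h1 : (n - m) * (S (m + 1)).card
          = ∑ i ∈ univ.filter (fun i : Fin n => m ≤ (i : ℕ)),
              ((S m).filter fun π => π i ∈ B).card := by
        rw [← hlate, ← smul_eq_mul, ← Finset.sum_const]
        exact Finset.sum_congr rfl fun i hi => hswap i (Finset.mem_filter.1 hi).2
      rw [h1]
      simp only [Finset.card_filter]
      rw [Finset.sum_comm, ← smul_eq_mul, ← Finset.sum_const]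
      refine Finset.sum_le_sum fun π hπ => ?_
      rw [hmemS] at hπ
      rw [← Finset.card_filter, Finset.filter_filter]
      have h2 : (univ.filter fun i : Fin n => π i ∈ B).card = B.card := by
        rw [← Finset.card_map π.symm.toEmbedding (s := B)]
        congr 1
        ext i
        simp
      have h3 := Finset.card_filter_add_card_filter_not
        (s := univ.filter fun i : Fin n => π i ∈ B) (fun i : Fin n => (i : ℕ) < m)
      have h4 : ((univ.filter fun i : Fin n => π i ∈ B).filter
          (fun i : Fin n => (i : ℕ) < m)).card = m := by
        have h6 : (univ.filter fun i : Fin n => (i : ℕ) < m).card = m := by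
          rw [Fin.card_filter_val_lt, min_eq_right hm'.le]
        rw [← h6]
        congr 1
        ext i
        simp only [Finset.mem_filter, Finset.mem_univ, true_and, h6]
        exact ⟨fun h => h.2, fun h => ⟨hπ i h, h⟩⟩
      rw [h2, h4] at h3
      have h5 : (univ.filter fun i : Fin n => m ≤ (i : ℕ) ∧ π i ∈ B)
          = (univ.filter fun i : Fin n => π i ∈ B).filter (fun i : Fin n => ¬ (i : ℕ) < m) := by
        ext i
        simp [and_comm]
      rw [h5]
      omega
    have hBn : B.card ≤ n := by simpa using Finset.card_le_univ B
    have hratio : (B.card - m) * n ≤ B.card * (n - m) := by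
      rcases Nat.le_total B.card m with h | h
      · rw [Nat.sub_eq_zero_of_le h]; simp
      · obtain ⟨a, ha⟩ := Nat.exists_eq_add_of_le h
        obtain ⟨a', ha'⟩ := Nat.exists_eq_add_of_le hm'.le
        rw [ha, ha'] at hBn
        rw [ha, Nat.add_sub_cancel_left, ha', Nat.add_sub_cancel_left]
        nlinarith
    have hstep : (S (m + 1)).card * n ≤ (S m).card * B.card := by
      have hpos : 0 < n - m := by omega
      refine Nat.le_of_mul_le_mul_left ?_ hpos
      calc (n - m) * ((S (m + 1)).card * n) = ((n - m) * (S (m + 1)).card) * n := by ring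
        _ ≤ ((S m).card * (B.card - m)) * n := by gcongr
        _ = (S m).card * ((B.card - m) * n) := by ring
        _ ≤ (S m).card * (B.card * (n - m)) := by gcongr
        _ = (n - m) * ((S m).card * B.card) := by ring
    calc (S (m + 1)).card * n ^ (m + 1) = ((S (m + 1)).card * n) * n ^ m := by ring
      _ ≤ ((S m).card * B.card) * n ^ m := by gcongr
      _ = ((S m).card * n ^ m) * B.card := by ring
      _ ≤ (B.card ^ m * Fintype.card (Ranking n)) * B.card := by gcongr
      _ = B.card ^ (m + 1) * Fintype.card (Ranking n) := by ring

/-- Given the ranking with index `i₀`, the other rankings of an i.i.d. sample are independent. -/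
lemma card_forall_mem_le {Ω : Type} [Fintype Ω] [Nonempty Ω] [DecidableEq Ω] {K : ℕ}
    (S : Ω → Finset Ω) {q : ℝ} (hS : ∀ σ, ((S σ).card : ℝ) ≤ q * Fintype.card Ω)
    {i₀ : Fin K} {T : Finset (Fin K)} (hT : i₀ ∉ T) :
    ((univ.filter fun ω : Fin K → Ω => ∀ k ∈ T, ω k ∈ S (ω i₀)).card : ℝ)
      ≤ q ^ T.card * Fintype.card (Fin K → Ω) := by
  classical
  set N : ℝ := ((Fintype.card Ω : ℕ) : ℝ) with hN
  have hNpos : 0 < N := by simp only [hN]; exact_mod_cast Fintype.card_pos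
  -- for each value `σ` of the ranking with index `i₀`, a product set
  set X : Ω → Fin K → Finset Ω := fun σ k => if k = i₀ then {σ} else if k ∈ T then S σ else univ
    with hX
  have hsub : (univ.filter fun ω : Fin K → Ω => ∀ k ∈ T, ω k ∈ S (ω i₀)) ⊆
      univ.biUnion fun σ => Fintype.piFinset (X σ) := by
    intro ω hω
    have hω := (Finset.mem_filter.1 hω).2
    refine Finset.mem_biUnion.2 ⟨ω i₀, Finset.mem_univ _, Fintype.mem_piFinset.2 fun k => ?_⟩
    simp only [hX]
    split_ifs with h1 h2
    · rw [h1]; exact Finset.mem_singleton_self _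
    · exact hω k h2
    · exact Finset.mem_univ _
  have h1 : ((univ.filter fun ω : Fin K → Ω => ∀ k ∈ T, ω k ∈ S (ω i₀)).card : ℝ)
      ≤ ∑ σ : Ω, ∏ k, ((X σ k).card : ℝ) := by
    refine le_trans (Nat.cast_le.2 ((Finset.card_le_card hsub).trans Finset.card_biUnion_le)) ?_
    push_cast
    simp only [Fintype.card_piFinset, Nat.cast_prod]
    exact le_rfl
  have h2 : ∀ σ : Ω, ∏ k, ((X σ k).card : ℝ) ≤ N ^ K * (N⁻¹ * q ^ T.card) := by
    intro σ
    have hq : 0 ≤ q := by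
      have := (Nat.cast_nonneg _).trans (hS σ)
      exact nonneg_of_mul_nonneg_left this hNpos
    have h3 : ∏ k : Fin K, ((X σ k).card : ℝ) ≤ ∏ k : Fin K,
        (N * ((if k = i₀ then N⁻¹ else 1) * (if k ∈ T then q else 1))) := by
      refine Finset.prod_le_prod (fun _ _ => Nat.cast_nonneg _) fun k _ => ?_
      simp only [hX]
      by_cases h4 : k = i₀
      · subst h4
        simp [hT, hNpos.ne']
      · by_cases h5 : k ∈ T
        · simpa [h4, h5, mul_comm] using hS σ
        · simp [h4, h5, hN]
    refine h3.trans (le_of_eq ?_)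
    rw [Finset.prod_mul_distrib, Finset.prod_mul_distrib, Finset.prod_const, Finset.card_univ,
      Fintype.card_fin, Finset.prod_ite_eq' , if_pos (Finset.mem_univ _), Finset.prod_ite_mem,
      Finset.univ_inter, Finset.prod_const]
  refine h1.trans ((Finset.sum_le_sum fun σ _ => h2 σ).trans (le_of_eq ?_))
  rw [Finset.sum_const, nsmul_eq_mul, Finset.card_univ, Fintype.card_fun, Fintype.card_fin]
  push_cast
  rw [← hN]
  field_simp

/-- The rankings of `r` further indices overlap with the ranking of some index in the sense of
`FewOverlaps`. -/
def ManyOverlaps (n n₀ K r t : ℕ) : Set (Fin K → Ranking n) :=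
  {ω | t + 1 ≤ n₀ ∧ ∃ (i₀ : Fin K) (z : Fin n) (T : Finset (Fin K)), T.card = r ∧ i₀ ∉ T ∧
    ∀ k ∈ T, prefixSet (ω k) (t + 1) ⊆ insert z (prefixSet (ω i₀) n₀)}

/-- Distinct rankings come from distinct indices, so that repetitions in the sample do no harm, and
the frequent types may be any set of candidates. -/
lemma fewOverlaps_of_notMem {n n₀ K r t : ℕ} {ω : Fin K → Ranking n}
    (hω : ω ∉ ManyOverlaps n n₀ K r t) {F : Finset (Ranking n)} (hF : F ⊆ univ.image ω) :
    FewOverlaps F n₀ r t := by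
  classical
  intro ht π hπ z
  by_contra hcon
  push Not at hcon
  obtain ⟨Y, hY, hYcard⟩ := Finset.exists_subset_card_eq hcon
  have hidx : ∀ σ ∈ F, ∃ k, ω k = σ := fun σ hσ => by simpa using hF hσ
  obtain ⟨k₀, -⟩ := hidx π hπ
  have : Nonempty (Fin K) := ⟨k₀⟩
  choose! idx hidx using hidx
  have hYF : ∀ σ ∈ Y, σ ∈ F := fun σ hσ => (Finset.mem_filter.1 (hY hσ)).1
  refine hω ⟨ht, idx π, z, Y.image idx, ?_, ?_, ?_⟩
  · rw [Finset.card_image_of_injOn, hYcard]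
    intro σ hσ τ hτ h
    rw [← hidx σ (hYF σ hσ), ← hidx τ (hYF τ hτ), h]
  · intro h
    obtain ⟨σ, hσ, h⟩ := Finset.mem_image.1 h
    refine (Finset.mem_filter.1 (hY hσ)).2.1 ?_
    rw [← hidx σ (hYF σ hσ), h, hidx π hπ]
  · intro k hk
    obtain ⟨σ, hσ, rfl⟩ := Finset.mem_image.1 hk
    rw [hidx σ (hYF σ hσ), hidx π hπ]
    exact (Finset.mem_filter.1 (hY hσ)).2.2

/-- The union bound over the reference index, the item `z` and the `r` further indices. -/
lemma toOuterMeasure_manyOverlaps_le {n n₀ K r t : ℕ} (hn : n₀ < n) {q : ℝ}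
    (hq : t + 1 ≤ n₀ → (((n₀ + 1 : ℕ) : ℝ) / n) ^ (t + 1) ≤ q) (hq0 : 0 ≤ q) :
    (PMF.uniformOfFintype (Fin K → Ranking n)).toOuterMeasure (ManyOverlaps n n₀ K r t)
      ≤ ENNReal.ofReal (K * (n * (K ^ r * q ^ r))) := by
  classical
  by_cases ht : t + 1 ≤ n₀
  swap
  · have : ManyOverlaps n n₀ K r t = ∅ := by
      ext ω
      simp only [ManyOverlaps, ht, false_and]
      rfl
    rw [this]
    simp
  have hq := hq ht
  have hn' : (0 : ℝ) < n := by exact_mod_cast (by omega : 0 < n)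
  set N : ℝ := ((Fintype.card (Fin K → Ranking n) : ℕ) : ℝ) with hN
  have hNpos : 0 < N := by simp only [hN]; exact_mod_cast Fintype.card_pos
  set S : Fin n → Ranking n → Finset (Ranking n) := fun z π =>
    univ.filter fun σ => prefixSet σ (t + 1) ⊆ insert z (prefixSet π n₀) with hS
  have hScard : ∀ z π, ((S z π).card : ℝ) ≤ q * Fintype.card (Ranking n) := by
    intro z π
    have h1 := card_prefixSet_subset_le (insert z (prefixSet π n₀)) (t + 1) (by omega)
    have h2 : (insert z (prefixSet π n₀)).card ≤ n₀ + 1 :=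
      (Finset.card_insert_le _ _).trans (by rw [card_prefixSet π hn.le])
    have h3 : (S z π).card * n ^ (t + 1) ≤ (n₀ + 1) ^ (t + 1) * Fintype.card (Ranking n) :=
      h1.trans (by gcongr)
    have h4 : ((S z π).card : ℝ) * (n : ℝ) ^ (t + 1)
        ≤ ((n₀ + 1 : ℕ) : ℝ) ^ (t + 1) * Fintype.card (Ranking n) := by exact_mod_cast h3
    have h5 : ((S z π).card : ℝ)
        ≤ (((n₀ + 1 : ℕ) : ℝ) / n) ^ (t + 1) * Fintype.card (Ranking n) := by
      rw [div_pow, div_mul_eq_mul_div, le_div_iff₀ (by positivity)]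
      exact h4
    exact h5.trans (by gcongr)
  set E : Fin K → Fin n → Finset (Fin K) → Finset (Fin K → Ranking n) := fun i₀ z T =>
    if i₀ ∈ T then ∅ else univ.filter fun ω => ∀ k ∈ T, ω k ∈ S z (ω i₀) with hE
  have hEcard : ∀ i₀ z, ∀ T ∈ Finset.powersetCard r (univ : Finset (Fin K)),
      ((E i₀ z T).card : ℝ) ≤ q ^ r * N := by
    intro i₀ z T hT
    simp only [hE]
    split_ifs with h
    · simp only [Finset.card_empty, Nat.cast_zero]; positivity
    · rw [← (Finset.mem_powersetCard.1 hT).2]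
      exact card_forall_mem_le (S z) (hScard z) h
  set U : Finset (Fin K → Ranking n) := univ.biUnion fun i₀ => univ.biUnion fun z =>
    (Finset.powersetCard r (univ : Finset (Fin K))).biUnion fun T => E i₀ z T with hU
  have hsub : ManyOverlaps n n₀ K r t ⊆ (U : Set (Fin K → Ranking n)) := by
    rintro ω ⟨-, i₀, z, T, hT1, hT2, hT3⟩
    simp only [hU, Finset.mem_coe, Finset.mem_biUnion, Finset.mem_univ, true_and]
    refine ⟨i₀, z, T, Finset.mem_powersetCard.2 ⟨Finset.subset_univ _, hT1⟩, ?_⟩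
    simp only [hE, if_neg hT2, Finset.mem_filter, Finset.mem_univ, true_and, hS]
    exact hT3
  have hUcard : (U.card : ℝ) ≤ K * (n * (K ^ r * q ^ r)) * N := by
    have h1 : U.card ≤ ∑ i₀ : Fin K, ∑ z : Fin n,
        ∑ T ∈ Finset.powersetCard r (univ : Finset (Fin K)), (E i₀ z T).card :=
      Finset.card_biUnion_le.trans (Finset.sum_le_sum fun i₀ _ =>
        Finset.card_biUnion_le.trans (Finset.sum_le_sum fun z _ => Finset.card_biUnion_le))
    have h2 : (U.card : ℝ) ≤ ∑ i₀ : Fin K, ∑ z : Fin n,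
        ∑ T ∈ Finset.powersetCard r (univ : Finset (Fin K)), ((E i₀ z T).card : ℝ) := by
      exact_mod_cast h1
    have h3 : ∀ i₀ z, ∑ T ∈ Finset.powersetCard r (univ : Finset (Fin K)), ((E i₀ z T).card : ℝ)
        ≤ K ^ r * (q ^ r * N) := by
      intro i₀ z
      refine (Finset.sum_le_sum (hEcard i₀ z)).trans ?_
      rw [Finset.sum_const, nsmul_eq_mul, Finset.card_powersetCard, Finset.card_univ,
        Fintype.card_fin]
      have : ((K.choose r : ℕ) : ℝ) ≤ (K : ℝ) ^ r := by exact_mod_cast Nat.choose_le_pow K r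
      gcongr
    refine h2.trans ((Finset.sum_le_sum fun i₀ _ => Finset.sum_le_sum fun z _ => h3 i₀ z).trans
      (le_of_eq ?_))
    simp only [Finset.sum_const, nsmul_eq_mul, Finset.card_univ, Fintype.card_fin]
    ring
  refine (MeasureTheory.measure_mono hsub).trans ?_
  rw [PMF.toOuterMeasure_uniformOfFintype_apply]
  simp only [Finset.coe_sort_coe, Fintype.card_coe]
  rw [← ENNReal.ofReal_natCast, ← ENNReal.ofReal_natCast, ← hN,
    ← ENNReal.ofReal_div_of_pos hNpos]
  refine ENNReal.ofReal_le_ofReal ?_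
  rw [div_le_iff₀ hNpos]
  exact hUcard

/-! ### Parameters of the random model -/

/-- The solutions of `(4/3) ^ (ℓ - 1) ≤ 4 L` are at most logarithmic in `L`, hence at most a third
of a parameter in which `L` is linear, up to a constant. -/
lemma exists_log_bound (d : ℕ) : ∃ C : ℕ, ∀ u ℓ : ℕ,
    4 ^ (ℓ - 1) ≤ 4 * (5 * u + d) * 3 ^ (ℓ - 1) → ℓ ≤ (u + C) / 3 := by
  have htend : Filter.Tendsto (fun k : ℕ => (k : ℝ) ^ 1 / (4 / 3 : ℝ) ^ k) Filter.atTop (nhds 0) :=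
    tendsto_pow_const_div_const_pow_of_one_lt 1 (by norm_num)
  obtain ⟨k₀, hk₀⟩ := Filter.eventually_atTop.1
    (htend.eventually (gt_mem_nhds (show (0 : ℝ) < 1 / 60 by norm_num)))
  refine ⟨3 * k₀ + d + 6, fun u ℓ h => ?_⟩
  rw [Nat.le_div_iff_mul_le (by norm_num)]
  by_cases hk : k₀ ≤ ℓ - 1
  · have h1 := hk₀ _ hk
    rw [pow_one, div_lt_iff₀ (by positivity)] at h1
    have h2 : (4 : ℝ) ^ (ℓ - 1) ≤ 4 * (5 * u + d) * 3 ^ (ℓ - 1) := by exact_mod_cast h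
    have h3 : (4 / 3 : ℝ) ^ (ℓ - 1) ≤ 4 * (5 * u + d) := by
      rw [div_pow, div_le_iff₀ (by positivity)]
      exact h2
    have h4 : ((60 * (ℓ - 1 : ℕ) : ℕ) : ℝ) ≤ ((20 * u + 4 * d : ℕ) : ℝ) := by
      push_cast
      linarith
    have h5 := Nat.cast_le.1 h4
    omega
  · omega

lemma rpow_two_logb {a X : ℝ} (hX : 0 < X) :
    (2 : ℝ) ^ Real.logb a X = X ^ (Real.log 2 / Real.log a) := by
  rw [Real.rpow_def_of_pos (by norm_num), Real.rpow_def_of_pos hX, Real.logb]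
  congr 1
  ring

/-- The unit `u` in which the sizes of interferers and set covers are measured: `α ^ (5 u)` is
`1 / X` up to rounding. -/
noncomputable def sizeUnit (α X : ℝ) : ℕ := ⌈Real.logb (1 / α) X / 5⌉₊

lemma pow_sizeUnit_le {α X : ℝ} (hα₀ : 0 < α) (hα₁ : α < 1) (hX : 1 ≤ X) :
    α ^ (5 * sizeUnit α X) ≤ 1 / X := by
  have ha : 1 < 1 / α := by rw [lt_div_iff₀ hα₀]; linarith
  have h1 : Real.logb (1 / α) X ≤ ((5 * sizeUnit α X : ℕ) : ℝ) := by
    have := Nat.le_ceil (Real.logb (1 / α) X / 5)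
    unfold sizeUnit
    push_cast
    linarith
  rw [Real.logb_le_iff_le_rpow ha (by linarith), Real.rpow_natCast, div_pow, one_pow] at h1
  have h2 : 0 < α ^ (5 * sizeUnit α X) := by positivity
  rw [le_div_iff₀ h2] at h1
  rw [le_div_iff₀ (by linarith)]
  linarith

lemma sizeUnit_le {α X : ℝ} (hα₀ : 0 < α) (hα₁ : α < 1) (hX : 1 ≤ X) :
    (sizeUnit α X : ℝ) ≤ Real.logb (1 / α) X / 5 + 1 := by
  have ha : 1 < 1 / α := by rw [lt_div_iff₀ hα₀]; linarith
  exact (Nat.ceil_lt_add_one (div_nonneg (Real.logb_nonneg ha hX) (by norm_num))).le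

lemma two_pow_sizeUnit_le {α X : ℝ} (hα₀ : 0 < α) (hα₁ : α < 1) (hX : 1 ≤ X) :
    (2 : ℝ) ^ (10 * sizeUnit α X) ≤ 2 ^ 10 * X ^ (2 * Real.logb α (1 / 2)) := by
  have hXpos : 0 < X := by linarith
  have h1 := sizeUnit_le hα₀ hα₁ hX
  have h2 : Real.logb α (1 / 2) = Real.log 2 / Real.log (1 / α) := by
    rw [Real.logb, one_div, one_div, Real.log_inv, Real.log_inv, neg_div, div_neg]
  calc (2 : ℝ) ^ (10 * sizeUnit α X) = (2 : ℝ) ^ ((10 * sizeUnit α X : ℕ) : ℝ) :=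
        (Real.rpow_natCast _ _).symm
    _ ≤ (2 : ℝ) ^ (10 + Real.logb (1 / α) X * 2) := by
        refine Real.rpow_le_rpow_of_exponent_le (by norm_num) ?_
        push_cast
        linarith
    _ = 2 ^ 10 * X ^ (2 * Real.logb α (1 / 2)) := by
        rw [Real.rpow_add (by norm_num), Real.rpow_mul (by norm_num), rpow_two_logb hXpos,
          ← Real.rpow_mul hXpos.le, h2]
        norm_num
        ring_nf

/-- The one further item costs only a factor `(1 + 1 / n₀) ^ n₀ ≤ e`. -/
lemma ratio_pow_le {α : ℝ} {n n₀ t : ℕ} (hα₀ : 0 < α) (hn : 0 < n) (hn₀ : (n₀ : ℝ) = α * n)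
    (ht : t + 1 ≤ n₀) : (((n₀ + 1 : ℕ) : ℝ) / n) ^ (t + 1) ≤ 3 * α ^ (t + 1) := by
  have hn' : (0 : ℝ) < n := by exact_mod_cast hn
  have hn₀' : (0 : ℝ) < n₀ := by rw [hn₀]; positivity
  have h1 : ((n₀ + 1 : ℕ) : ℝ) / n = α * (1 + 1 / n₀) := by
    have : α = n₀ / n := by rw [hn₀]; field_simp
    rw [this]
    push_cast
    field_simp
  have h2 : (1 + 1 / (n₀ : ℝ)) ^ (t + 1) ≤ 3 := by
    calc (1 + 1 / (n₀ : ℝ)) ^ (t + 1) ≤ (1 + 1 / (n₀ : ℝ)) ^ n₀ :=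
          pow_le_pow_right₀ (by simp) ht
      _ ≤ (Real.exp (1 / n₀)) ^ n₀ := by
          refine pow_le_pow_left₀ (by positivity) ?_ _
          rw [add_comm]
          exact Real.add_one_le_exp _
      _ = Real.exp 1 := by
          rw [← Real.exp_nat_mul]
          congr 1
          field_simp
      _ ≤ 3 := Real.exp_one_lt_three.le
  rw [h1, mul_pow, mul_comm]
  gcongr

/-- Except with probability `δ`, few random candidates overlap: at most four in more than
`3 u + d` items, and none in more than `5 u + d` items. -/
lemma toOuterMeasure_overlaps_le {α δ : ℝ} {n n₀ K d : ℕ} (hα₀ : 0 < α) (hα₁ : α < 1)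
    (hd : 3 * α ^ d ≤ 1 / 2) (hn : 0 < n) (hn₀ : (n₀ : ℝ) = α * n) (hK : 0 < K) (hδ : 0 < δ)
    (hδ1 : δ < 1) {u : ℕ} (hu : α ^ (5 * u) ≤ 1 / ((K : ℝ) ^ 2 * n / δ)) :
    (PMF.uniformOfFintype (Fin K → Ranking n)).toOuterMeasure
      (ManyOverlaps n n₀ K 5 (3 * u + d) ∪ ManyOverlaps n n₀ K 1 (5 * u + d))
      ≤ ENNReal.ofReal δ := by
  have hn' : (1 : ℝ) ≤ n := by exact_mod_cast hn
  have hK' : (1 : ℝ) ≤ K := by exact_mod_cast hK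
  have hlt : n₀ < n := by
    have : (n₀ : ℝ) < n := by rw [hn₀]; nlinarith
    exact_mod_cast this
  have hq : ∀ v : ℕ, v + d + 1 ≤ n₀ →
      (((n₀ + 1 : ℕ) : ℝ) / n) ^ (v + d + 1) ≤ α ^ v / 2 := by
    intro v hv
    refine (ratio_pow_le hα₀ hn hn₀ hv).trans ?_
    have h1 : α ^ (v + d + 1) ≤ α ^ (v + d) := pow_le_pow_of_le_one hα₀.le hα₁.le (by omega)
    have h2 : 3 * α ^ (v + d) = (3 * α ^ d) * α ^ v := by rw [pow_add]; ring
    have h3 : 0 < α ^ v := by positivity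
    nlinarith
  have hu' : α ^ (5 * u) ≤ δ / (K ^ 2 * n) := by rwa [one_div_div] at hu
  have hupos : 0 < α ^ (5 * u) := by positivity
  rw [le_div_iff₀ (by positivity)] at hu'
  refine (MeasureTheory.measure_union_le _ _).trans ((add_le_add
    (toOuterMeasure_manyOverlaps_le hlt (hq (3 * u)) (by positivity))
    (toOuterMeasure_manyOverlaps_le hlt (hq (5 * u)) (by positivity))).trans ?_)
  rw [← ENNReal.ofReal_add (by positivity) (by positivity)]
  refine ENNReal.ofReal_le_ofReal ?_
  have h1 : K * (n * ((K : ℝ) ^ 1 * (α ^ (5 * u) / 2) ^ 1)) = (α ^ (5 * u) * (K ^ 2 * n)) / 2 := by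
    ring
  have h2 : K * (n * ((K : ℝ) ^ 5 * (α ^ (3 * u) / 2) ^ 5))
      = (α ^ (5 * u) * (K ^ 2 * n)) ^ 3 / (32 * n ^ 2) := by
    have : (α ^ (3 * u)) ^ 5 = (α ^ (5 * u)) ^ 3 := by rw [← pow_mul, ← pow_mul]; ring_nf
    rw [div_pow, this]
    field_simp
    ring
  have h3 : (α ^ (5 * u) * (K ^ 2 * n)) ^ 3 ≤ δ := by
    calc (α ^ (5 * u) * ((K : ℝ) ^ 2 * n)) ^ 3 ≤ δ ^ 3 :=
          pow_le_pow_left₀ (by positivity) hu' 3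
      _ ≤ δ := pow_le_of_le_one hδ.le hδ1.le (by norm_num)
  have h4 : (α ^ (5 * u) * ((K : ℝ) ^ 2 * n)) ^ 3 / (32 * n ^ 2) ≤ δ / 2 := by
    rw [div_le_iff₀ (by positivity)]
    nlinarith [one_le_pow₀ hn' (n := 2)]
  rw [h1, h2]
  linarith

/-! ### The cost bound -/

/-- The cost of the main algorithm in natural numbers, sorted into computation and queries. -/
lemma dagSteps_le {n n₀ f c m : ℕ} (hn : 0 < n) (hn₀ : n₀ ≤ n) (hf : 0 < f) :
    dagSteps n n₀ f c m
      ≤ n ^ 2 * f * (34 * (n ^ 2 * f ^ 2 * ((c + 1) * 2 ^ c)) + 4 * (2 ^ c * m)) := by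
  have hE : 1 ≤ 2 ^ c := Nat.one_le_two_pow
  set E := 2 ^ c with hEdef
  set M := n ^ 2 * f ^ 2 * ((c + 1) * E) with hM
  have hn1 : 1 ≤ n := hn
  have hf1 : 1 ≤ f := hf
  have hw1 : 1 ≤ (c + 1) * E := Nat.mul_pos (by omega) hE
  have hnf : n ^ 2 * f ^ 2 ≤ M := Nat.le_mul_of_pos_right _ hw1
  have hn2 : n ≤ n ^ 2 := by nlinarith
  have hf2 : f ≤ f ^ 2 := by nlinarith
  have e1 : n * f * (n * f) ≤ M := by nlinarith
  have e2 : n * n * f ≤ M := by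
    refine le_trans ?_ hnf
    rw [← pow_two]; gcongr
  have e3 : n * f ≤ M := le_trans (by gcongr) hnf
  have e4 : 1 ≤ M := le_trans (Nat.mul_pos hn hf) e3
  have hnM : n ≤ M := le_trans (Nat.le_mul_of_pos_right _ hf) e3
  have e5 : ∀ x, x ≤ n ^ 2 * f ^ 2 → c * x ≤ M := by
    intro x hx
    calc c * x ≤ ((c + 1) * E) * (n ^ 2 * f ^ 2) := by
          gcongr
          exact (Nat.le_succ c).trans (Nat.le_mul_of_pos_right _ hE)
      _ = M := by rw [hM]; ring
  have b1 : n * n * f ≤ n ^ 2 * f ^ 2 := by rw [← pow_two]; gcongr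
  have b2 : n * f ≤ n ^ 2 * f ^ 2 := by gcongr
  have b3 : n ≤ n ^ 2 * f ^ 2 := le_trans (Nat.le_mul_of_pos_right _ hf) b2
  have b4 : 1 ≤ n ^ 2 * f ^ 2 := le_trans hn1 b3
  have e6 : E * ((c + 1) * n) ≤ M := by
    calc E * ((c + 1) * n) ≤ E * ((c + 1) * (n ^ 2 * f ^ 2)) := by gcongr
      _ = M := by rw [hM]; ring
  have e7 : E * (c + 1) ≤ E * ((c + 1) * n) := by
    gcongr; exact Nat.le_mul_of_pos_right _ hn
  have e8 : E * n ≤ E * ((c + 1) * n) := by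
    gcongr; exact Nat.le_mul_of_pos_left _ (by omega)
  have e9 : E ≤ E * n := Nat.le_mul_of_pos_right _ hn
  have e10 : m ≤ E * m := Nat.le_mul_of_pos_left _ hE
  have hedge : edgeSteps n (n * f) f c m ≤ 27 * M + 4 * (E * m) := by
    have c1 := e5 _ b1
    have c2 := e5 _ b2
    have c3 := e5 _ b3
    have c4 := e5 _ b4
    have hexp : edgeSteps n (n * f) f c m
        = (n * f * (n * f) + 3 * (n * n * f) + 3 * (n * f) + 1)
          + (2 * (c * (n * n * f)) + 3 * (c * n) + 2 * (c * (n * f)) + 3 * (c * 1) + 1)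
          + (c * 1 + 1) + (n + 1 + 2 * m)
          + (E * ((c + 1) * n) + E * (c + 1) + E * n + E + 2 * (E * m)) := by
      unfold edgeSteps
      rw [← hEdef]
      ring
    rw [hexp]
    omega
  have hinner : edgeSteps n (n * f) f c m + (n * (f + 2) + 1) ≤ 31 * M + 4 * (E * m) := by
    have : n * (f + 2) = n * f + 2 * n := by ring
    omega
  unfold dagSteps
  calc n₀ * (f * (n + 1 + n * (edgeSteps n (n * f) f c m + (n * (f + 2) + 1))) + n)
      ≤ n * (f * (n + n + n * (31 * M + 4 * (E * m))) + n * f) := by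
        gcongr
        exact Nat.le_mul_of_pos_right _ hf
    _ = n ^ 2 * f * (3 * 1 + (31 * M + 4 * (E * m))) := by ring
    _ ≤ n ^ 2 * f * (3 * M + (31 * M + 4 * (E * m))) := by gcongr
    _ = n ^ 2 * f * (34 * M + 4 * (E * m)) := by ring

/-- The cost of the main algorithm in terms of a bound `c` for the sizes of the set covers. -/
lemma dagSteps_le_real {n n₀ f K c : ℕ} {α κ ε δ C : ℝ} (hα₀ : 0 < α) (hα₁ : α < 1) (hn : 0 < n)
    (hn₀ : (n₀ : ℝ) = α * n) (hf : 0 < f) (hfK : f ≤ K) (hκ : 0 < κ) (hκ1 : κ < 1)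
    (hfκ : f * κ ≤ 1) (hε : 0 < ε) (hδ : 0 < δ) (hδ1 : δ < 1)
    (hc : (c : ℝ) + 1 ≤ C * Real.log (n * K / δ)) :
    (dagSteps n n₀ f c (sampleSize c (min (ε / n₀) (κ / 4)) (δ / (α * n ^ 2 * K))) : ℝ)
      ≤ (72 + 66 * C) * (8 ^ c * (K * n ^ 4 * Real.log (n * K / δ)) / min ε κ ^ 2) := by
  have hn1 : (1 : ℝ) ≤ n := by exact_mod_cast hn
  have hf1 : (1 : ℝ) ≤ f := by exact_mod_cast hf
  have hfK' : (f : ℝ) ≤ K := by exact_mod_cast hfK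
  have hK1 : (1 : ℝ) ≤ K := hf1.trans hfK'
  have hn₀' : (0 : ℝ) < n₀ := by rw [hn₀]; positivity
  have hlt' : (n₀ : ℝ) < n := by rw [hn₀]; nlinarith
  have hlt : n₀ < n := by exact_mod_cast hlt'
  have hn2 : (2 : ℝ) ≤ n := by
    have : 0 < n₀ := by exact_mod_cast hn₀'
    exact_mod_cast (by omega : 2 ≤ n)
  set ℓ := Real.log (n * K / δ) with hℓ
  set μ := min ε κ with hμ
  have hμpos : 0 < μ := lt_min hε hκ
  have hμ1 : μ ≤ 1 := (min_le_right _ _).trans hκ1.le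
  have hnKδ : 2 ≤ n * K / δ := by
    rw [le_div_iff₀ hδ]; nlinarith
  have hℓ1 : 1 / 2 ≤ ℓ := by
    have h1 := Real.log_le_log (by norm_num) hnKδ
    have h2 := Real.log_two_gt_d9
    linarith
  have hε' : μ / (4 * n) ≤ min (ε / n₀) (κ / 4) := by
    refine le_min ?_ ?_
    · calc μ / (4 * n) ≤ ε / (4 * n) := by gcongr; exact min_le_left _ _
        _ ≤ ε / n₀ := by
          apply div_le_div_of_nonneg_left hε.le hn₀'
          linarith
    · calc μ / (4 * n) ≤ κ / (4 * n) := by gcongr; exact min_le_right _ _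
        _ ≤ κ / 4 := by
          apply div_le_div_of_nonneg_left hκ.le (by norm_num)
          linarith
  have hlogδ : Real.log (1 / (δ / (α * n ^ 2 * K))) ≤ 2 * ℓ := by
    have h1 : 2 * ℓ = Real.log ((n * K / δ) ^ 2) := by
      rw [hℓ, Real.log_pow, Nat.cast_ofNat]
    rw [h1, one_div_div]
    refine Real.log_le_log (by positivity) ?_
    rw [div_pow, div_le_div_iff₀ hδ (by positivity)]
    have h2 : α * n ^ 2 * K ≤ (n * K) ^ 2 := by
      calc α * (n : ℝ) ^ 2 * K ≤ 1 * (n : ℝ) ^ 2 * K := by gcongr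
        _ = (n : ℝ) ^ 2 * ((K : ℝ) * 1) := by ring
        _ ≤ (n : ℝ) ^ 2 * ((K : ℝ) * K) := by gcongr
        _ = ((n : ℝ) * K) ^ 2 := by ring
    have h3 : δ ^ 2 ≤ δ := pow_le_of_le_one hδ.le hδ1.le (by norm_num)
    exact mul_le_mul h2 h3 (by positivity) (by positivity)
  have hlog2 : Real.log 2 ≤ 1 := by have := Real.log_two_lt_d9; linarith
  have hlog2' : 0 ≤ Real.log 2 := Real.log_nonneg (by norm_num)
  set m := sampleSize c (min (ε / n₀) (κ / 4)) (δ / (α * n ^ 2 * K)) with hm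
  have hpow : (2 : ℝ) ^ c * 4 ^ c = 8 ^ c := by rw [← mul_pow]; norm_num
  have hm1 : (m : ℝ) ≤ 4 ^ c * ((8 * C + 16) * ℓ * n ^ 2 / μ ^ 2) + 1 := by
    have h0 : (2 : ℝ) ^ (2 * (c : ℤ) - 1) = 4 ^ c / 2 := by
      rw [zpow_sub₀ (by norm_num), zpow_one, zpow_mul, zpow_natCast]
      norm_num
    have hδpos : 0 ≤ Real.log (1 / (δ / (α * n ^ 2 * K))) := by
      have hn₀1 : (1 : ℝ) ≤ n₀ := by exact_mod_cast (by exact_mod_cast hn₀' : 0 < n₀)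
      refine Real.log_nonneg ?_
      rw [one_div_div, le_div_iff₀ hδ]
      have : α * n ^ 2 * K = n₀ * n * K := by rw [hn₀]; ring
      rw [this]
      have : (1 : ℝ) ≤ n₀ * n * K := one_le_mul_of_one_le_of_one_le
        (one_le_mul_of_one_le_of_one_le hn₀1 hn1) hK1
      linarith
    have hsum : Real.log (1 / (δ / (α * n ^ 2 * K))) + (c + 1) * Real.log 2 ≤ 2 * ℓ + C * ℓ := by
      refine add_le_add hlogδ (le_trans ?_ hc)
      exact mul_le_of_le_one_right (by positivity) hlog2
    have hsum0 : 0 ≤ 2 * ℓ + C * ℓ := le_trans (by positivity) hsum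
    rw [hm, sampleSize]
    refine (Nat.ceil_lt_add_one (by positivity)).le.trans (add_le_add_left ?_ 1)
    rw [h0]
    calc (4 : ℝ) ^ c / 2 * (Real.log (1 / (δ / (α * n ^ 2 * K))) + (c + 1) * Real.log 2)
          / min (ε / n₀) (κ / 4) ^ 2
        ≤ (4 : ℝ) ^ c / 2 * (2 * ℓ + C * ℓ) / (μ / (4 * n)) ^ 2 := by
          gcongr
      _ = 4 ^ c * ((8 * C + 16) * ℓ * n ^ 2 / μ ^ 2) := by
          field_simp
          ring
  -- there are at most `1 / κ` frequent types
  have hfμ : (f : ℝ) ^ 2 ≤ 1 / μ ^ 2 := by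
    rw [le_div_iff₀ (by positivity), ← mul_pow]
    refine pow_le_one₀ (by positivity) (le_trans ?_ hfκ)
    gcongr
    exact min_le_right _ _
  have h2c : (2 : ℝ) ^ c ≤ 8 ^ c := pow_le_pow_left₀ (by norm_num) (by norm_num) _
  set Z : ℝ := 8 ^ c * ℓ * n ^ 2 / μ ^ 2 with hZ
  have hZ1 : (2 : ℝ) ^ c ≤ 2 * Z := by
    have h1 : (1 : ℝ) ≤ n ^ 2 / μ ^ 2 := by
      rw [le_div_iff₀ (by positivity), one_mul]
      exact pow_le_pow_left₀ hμpos.le (hμ1.trans hn1) 2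
    have h2 : (1 : ℝ) ≤ 2 * ℓ := by linarith
    calc (2 : ℝ) ^ c ≤ 8 ^ c * (1 * 1) := by simpa using h2c
      _ ≤ 8 ^ c * ((2 * ℓ) * (n ^ 2 / μ ^ 2)) := by gcongr
      _ = 2 * Z := by rw [hZ]; ring
  have hEm : (2 : ℝ) ^ c * m ≤ (8 * C + 18) * Z := by
    calc (2 : ℝ) ^ c * m ≤ 2 ^ c * (4 ^ c * ((8 * C + 16) * ℓ * n ^ 2 / μ ^ 2) + 1) := by gcongr
      _ = (2 ^ c * 4 ^ c) * ((8 * C + 16) * ℓ * n ^ 2 / μ ^ 2) + 2 ^ c := by ring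
      _ = (8 * C + 16) * Z + 2 ^ c := by rw [hpow, hZ]; ring
      _ ≤ (8 * C + 18) * Z := by linarith
  have hCℓ : 0 ≤ C * ℓ := le_trans (by positivity) hc
  have hM : (n : ℝ) ^ 2 * f ^ 2 * ((c + 1) * 2 ^ c) ≤ C * Z := by
    calc (n : ℝ) ^ 2 * f ^ 2 * ((c + 1) * 2 ^ c)
        ≤ n ^ 2 * (1 / μ ^ 2) * ((C * ℓ) * 8 ^ c) := by gcongr
      _ = C * Z := by rw [hZ]; ring
  have hZpos : 0 ≤ Z := by rw [hZ]; positivity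
  have hC : 0 ≤ C := by
    have h1 : (0 : ℝ) < C * ℓ := lt_of_lt_of_le (by positivity) hc
    exact (pos_of_mul_pos_left h1 (by linarith)).le
  have hdag : (dagSteps n n₀ f c m : ℝ) ≤ n ^ 2 * f *
      (34 * (n ^ 2 * f ^ 2 * ((c + 1) * 2 ^ c)) + 4 * (2 ^ c * m)) := by
    exact_mod_cast dagSteps_le hn hlt.le hf
  calc (dagSteps n n₀ f c m : ℝ) ≤ n ^ 2 * f *
      (34 * (n ^ 2 * f ^ 2 * ((c + 1) * 2 ^ c)) + 4 * (2 ^ c * m)) := hdag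
    _ ≤ n ^ 2 * K * (34 * (C * Z) + 4 * ((8 * C + 18) * Z)) := by gcongr
    _ = (72 + 66 * C) * (8 ^ c * (K * n ^ 4 * ℓ) / μ ^ 2) := by rw [hZ]; ring

/-- The size of the set covers that the random model allows, and what it amounts to. -/
lemma exists_cover_size {α : ℝ} (hα₀ : 0 < α) (hα₁ : α < 1) (d C₀ : ℕ) :
    ∃ C₁ C₂ : ℝ, 0 < C₁ ∧ 0 < C₂ ∧ ∀ (n K : ℕ) (δ : ℝ), 2 ≤ n → 0 < K → 0 < δ → δ < 1 →
      ∀ u : ℕ, u = sizeUnit α ((K : ℝ) ^ 2 * n / δ) →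
      ∀ c : ℕ, c = 3 * u + d + (u + C₀) / 3 →
        (c : ℝ) + 1 ≤ C₁ * Real.log (n * K / δ) ∧
        (8 : ℝ) ^ c ≤ C₂ * ((K : ℝ) ^ 2 * n / δ) ^ (2 * Real.logb α (1 / 2)) := by
  have hlogα : 0 < Real.log (1 / α) := Real.log_pos (by rw [lt_div_iff₀ hα₀]; linarith)
  refine ⟨8 / (5 * Real.log (1 / α)) + 2 * (d + C₀ + 5), 2 ^ (3 * d + C₀ + 10),
    by positivity, by positivity, ?_⟩
  intro n K δ hn hK hδ hδ1 u hu c hc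
  have hn2 : (2 : ℝ) ≤ n := by exact_mod_cast hn
  have hK1 : (1 : ℝ) ≤ K := by exact_mod_cast hK
  set X : ℝ := (K : ℝ) ^ 2 * n / δ with hX
  have hX1 : 1 ≤ X := by
    rw [hX, le_div_iff₀ hδ]
    nlinarith [one_le_pow₀ hK1 (n := 2)]
  set ℓ := Real.log (n * K / δ) with hℓ
  have hnKδ : 2 ≤ n * K / δ := by
    rw [le_div_iff₀ hδ]; nlinarith
  have hℓ1 : 1 / 2 ≤ ℓ := by
    have h1 := Real.log_le_log (by norm_num) hnKδ
    have h2 := Real.log_two_gt_d9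
    linarith
  have hlogX : Real.log X ≤ 2 * ℓ := by
    have h1 : 2 * ℓ = Real.log ((n * K / δ) ^ 2) := by
      rw [hℓ, Real.log_pow, Nat.cast_ofNat]
    rw [h1]
    refine Real.log_le_log (by linarith) ?_
    rw [hX, div_pow, div_le_div_iff₀ hδ (by positivity)]
    have h3 : δ ^ 2 ≤ δ := pow_le_of_le_one hδ.le hδ1.le (by norm_num)
    have h2 : (K : ℝ) ^ 2 * n ≤ (n * K) ^ 2 := by
      have h4 : (K : ℝ) ^ 2 * (n * 1) ≤ K ^ 2 * (n * n) := by gcongr; linarith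
      nlinarith
    exact mul_le_mul h2 h3 (by positivity) (by positivity)
  have hu1 := sizeUnit_le hα₀ hα₁ hX1
  rw [← hu, Real.logb] at hu1
  constructor
  · have hcN : c ≤ 4 * u + d + C₀ := by omega
    have hcR : (c : ℝ) ≤ 4 * u + d + C₀ := by exact_mod_cast hcN
    have h1 : Real.log X / Real.log (1 / α) ≤ 2 * ℓ / Real.log (1 / α) := by gcongr
    have h2 : (8 / (5 * Real.log (1 / α)) + 2 * (d + C₀ + 5)) * ℓ
        = 4 * (2 * ℓ / Real.log (1 / α) / 5) + (d + C₀ + 5) * (2 * ℓ) := by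
      field_simp
      ring
    have h3 : ((d : ℝ) + C₀ + 5) * 1 ≤ (d + C₀ + 5) * (2 * ℓ) := by gcongr; linarith
    rw [h2]
    linarith
  · have h1 : 3 * c ≤ (3 * d + C₀) + 10 * u := by omega
    calc (8 : ℝ) ^ c = 2 ^ (3 * c) := by rw [pow_mul]; norm_num
      _ ≤ 2 ^ ((3 * d + C₀) + 10 * u) := pow_le_pow_right₀ (by norm_num) h1
      _ = 2 ^ (3 * d + C₀) * 2 ^ (10 * sizeUnit α X) := by rw [pow_add, hu]
      _ ≤ 2 ^ (3 * d + C₀) * (2 ^ 10 * X ^ (2 * Real.logb α (1 / 2))) := by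
        gcongr
        exact two_pow_sizeUnit_le hα₀ hα₁ hX1
      _ = 2 ^ (3 * d + C₀ + 10) * X ^ (2 * Real.logb α (1 / 2)) := by
        rw [pow_add _ (3 * d + C₀)]; ring

lemma rpow_bound_eq {n K ν δ ℓ μ : ℝ} (hn : 0 < n) (hK : 0 < K) (hδ : 0 < δ) :
    (K ^ 2 * n / δ) ^ (2 * ν) * (K * n ^ 4 * ℓ) / μ ^ 2
      = K ^ (1 + 4 * ν) * n ^ (4 + 2 * ν) * ℓ / (δ ^ (2 * ν) * μ ^ 2) := by
  have h1 : (K ^ 2) ^ (2 * ν) = K ^ (4 * ν) := by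
    rw [← Real.rpow_natCast, ← Real.rpow_mul hK.le]
    congr 1
    push_cast
    ring
  have h2 : n ^ (4 : ℝ) = n ^ 4 := by exact_mod_cast Real.rpow_natCast n 4
  rw [Real.div_rpow (by positivity) hδ.le, Real.mul_rpow (by positivity) hn.le, h1,
    Real.rpow_add hK, Real.rpow_add hn, Real.rpow_one, h2]
  have : 0 < δ ^ (2 * ν) := by positivity
  field_simp

/-- The cost guarantee in the random model. -/
theorem cost_random {α : ℝ} (hα₀ : 0 < α) (hα₁ : α < 1) :
    ∃ c : ℝ, 0 < c ∧
      ∀ (n n₀ K : ℕ) (κ ρ ε δ : ℝ), 0 < n → (n₀ : ℝ) = α * n →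
      0 < κ → κ < 1 → ρ < κ / 4 → 0 < ε → 0 < δ → δ < 1 →
      ∀ (F : (Fin K → Ranking n) → Finset (Ranking n)) (p : (Fin K → Ranking n) → PMF (Ranking n)),
        (∀ ω, IsModel κ ρ (Finset.univ.image ω) (F ω) (p ω)) →
        ∀ bound : ℝ, bound = c * ((K : ℝ) ^ (1 + 4 * Real.logb α (1 / 2)) *
            (n : ℝ) ^ (4 + 2 * Real.logb α (1 / 2)) *
            Real.log (n * K / δ) / (δ ^ (2 * Real.logb α (1 / 2)) * min ε κ ^ 2)) →
          1 - 2 * δ ≤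
            prob ((PMF.uniformOfFintype (Fin K → Ranking n)).bind fun ω =>
                (algDAG n n₀ K α κ ε δ).run (p ω))
              {o | (o.queries : ℝ) ≤ bound ∧ (o.steps : ℝ) ≤ bound} := by
  classical
  -- `α ^ d` absorbs the factor `3` of `ratio_pow_le` and leaves a factor `1 / 2`
  obtain ⟨d, hd⟩ := exists_pow_lt_of_lt_one (show (0 : ℝ) < 1 / 6 by norm_num) hα₁
  obtain ⟨C₀, hC₀⟩ := exists_log_bound d
  obtain ⟨C₁, C₂, hC₁, hC₂, hsize⟩ := exists_cover_size hα₀ hα₁ d C₀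
  refine ⟨(72 + 66 * C₁) * C₂, by positivity, ?_⟩
  intro n n₀ K κ ρ ε δ hn hn₀ hκ hκ1 hρ hε hδ hδ1 F p hmodel bound hbound
  have hn' : (0 : ℝ) < n := by exact_mod_cast hn
  have hn₀' : (0 : ℝ) < n₀ := by rw [hn₀]; positivity
  have hn2 : 2 ≤ n := by
    have h1 : 0 < n₀ := by exact_mod_cast hn₀'
    have h2 : (n₀ : ℝ) < n := by rw [hn₀]; nlinarith
    have h3 : n₀ < n := by exact_mod_cast h2
    omega
  have hcardK : ∀ ω, (F ω).card ≤ K := fun ω => (Finset.card_le_card (hmodel ω).subset).trans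
    (Finset.card_image_le.trans (by simp))
  have hne : ∀ ω, (F ω).Nonempty := fun ω => (hmodel ω).nonempty (by linarith)
  have hK : 0 < K := (Finset.card_pos.2 (hne fun _ => 1)).trans_le (hcardK _)
  have hK' : (0 : ℝ) < K := by exact_mod_cast hK
  set X : ℝ := (K : ℝ) ^ 2 * n / δ with hX
  have hX1 : 1 ≤ X := by
    have hn1 : (1 : ℝ) ≤ n := by exact_mod_cast hn
    have hK1 : (1 : ℝ) ≤ K := by exact_mod_cast hK
    rw [hX, le_div_iff₀ hδ]
    nlinarith [one_le_pow₀ hK1 (n := 2)]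
  obtain ⟨u, hu⟩ : ∃ u, u = sizeUnit α X := ⟨_, rfl⟩
  obtain ⟨c, hc⟩ : ∃ c, c = 3 * u + d + (u + C₀) / 3 := ⟨_, rfl⟩
  obtain ⟨hc1, hc2⟩ := hsize n K δ hn2 hK hδ hδ1 u hu c hc
  set Bad := ManyOverlaps n n₀ K 5 (3 * u + d) ∪ ManyOverlaps n n₀ K 1 (5 * u + d) with hBad
  have hBadprob : (PMF.uniformOfFintype (Fin K → Ranking n)).toOuterMeasure Bad
      ≤ ENNReal.ofReal δ :=
    toOuterMeasure_overlaps_le hα₀ hα₁ (by linarith) hn hn₀ hK hδ hδ1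
      (by rw [hu]; exact pow_sizeUnit_le hα₀ hα₁ hX1)
  set E : Set (Outcome (EstDAG n)) := {o | (o.queries : ℝ) ≤ bound ∧ (o.steps : ℝ) ≤ bound} with hE
  have hgood : ∀ ω ∉ Bad, ((algDAG n n₀ K α κ ε δ).run (p ω)).toOuterMeasure Eᶜ
      ≤ ENNReal.ofReal δ := by
    intro ω hω
    have h1 : ω ∉ ManyOverlaps n n₀ K 5 (3 * u + d) := fun h => hω (Or.inl h)
    have h2 : ω ∉ ManyOverlaps n n₀ K 1 (5 * u + d) := fun h => hω (Or.inr h)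
    have hcover : CoverBound (F ω) n₀ c := by
      rw [hc]
      exact coverBound_of_fewOverlaps (fewOverlaps_of_notMem h1 (hmodel ω).subset)
        (fewOverlaps_of_notMem h2 (hmodel ω).subset) (hC₀ u)
    refine le_trans (MeasureTheory.measure_mono (Set.compl_subset_compl.2 ?_))
      (ensures_algDAG hn hα₀ hα₁ hn₀ hκ hκ1 hρ hε hδ hδ1
        (Finset.card_image_le.trans (by simp)) (hmodel ω) hcover)
    rintro o ⟨-, hq, hs⟩
    have hsteps : (o.steps : ℝ) ≤ bound := by
      refine (Nat.cast_le.2 hs).trans ((dagSteps_le_real hα₀ hα₁ hn hn₀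
        (Finset.card_pos.2 (hne ω)) (hcardK ω) hκ hκ1 (hmodel ω).card_mul_le_one hε hδ hδ1
        hc1).trans ?_)
      have hlog : 0 ≤ Real.log (n * K / δ) := by
        have : (0 : ℝ) < C₁ * Real.log (n * K / δ) := lt_of_lt_of_le (by positivity) hc1
        exact (pos_of_mul_pos_right this hC₁.le).le
      rw [hbound, ← rpow_bound_eq hn' hK' hδ]
      calc (72 + 66 * C₁) * (8 ^ c * (K * n ^ 4 * Real.log (n * K / δ)) / min ε κ ^ 2)
          ≤ (72 + 66 * C₁) * ((C₂ * X ^ (2 * Real.logb α (1 / 2)))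
            * (K * n ^ 4 * Real.log (n * K / δ)) / min ε κ ^ 2) := by gcongr
        _ = _ := by ring
    exact ⟨(Nat.cast_le.2 hq).trans hsteps, hsteps⟩
  refine one_sub_le_prob _ (by positivity) ?_
  rw [PMF.toOuterMeasure_bind_apply]
  have h3 : ∀ ω, ((algDAG n n₀ K α κ ε δ).run (p ω)).toOuterMeasure Eᶜ
      ≤ Bad.indicator 1 ω + ENNReal.ofReal δ := by
    intro ω
    by_cases hω : ω ∈ Bad
    · refine (toOuterMeasure_le_one _ _).trans ?_
      simp [hω]
    · exact (hgood ω hω).trans le_add_self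
  refine (expect_mono (PMF.uniformOfFintype (Fin K → Ranking n)) h3).trans ?_
  rw [expect_add, expect_const, ← toOuterMeasure_eq_expect, two_mul,
    ENNReal.ofReal_add hδ.le hδ.le]
  gcongr

end ChoiceDAG

theorem mainTheorem5 (α : ℝ) (hα₀ : 0 < α) (hα₁ : α < 1) :
    (∀ (n n₀ K : ℕ) (κ ρ ε δ : ℝ), 0 < n → (n₀ : ℝ) = α * n →
      0 < κ → κ < 1 → 0 ≤ ρ → ρ < κ / 4 → 0 < ε → 0 < δ → δ < 1 →
      ∀ (F₀ F : Finset (Ranking n)) (p : PMF (Ranking n)), F₀.card ≤ K → IsModel κ ρ F₀ F p →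
        1 - δ ≤ prob ((algDAG n n₀ K α κ ε δ).run p) {o | IsAccurate n₀ ε ρ F p o.val}) ∧
    ∃ c : ℝ, 0 < c ∧
      ∀ (n n₀ K : ℕ) (κ ρ ε δ : ℝ), 0 < n → (n₀ : ℝ) = α * n →
      0 < κ → κ < 1 → 0 ≤ ρ → ρ < κ / 4 → 0 < ε → 0 < δ → δ < 1 →
      ∀ (F : (Fin K → Ranking n) → Finset (Ranking n)) (p : (Fin K → Ranking n) → PMF (Ranking n)),
        (∀ ω, IsModel κ ρ (Finset.univ.image ω) (F ω) (p ω)) →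
        ∀ ν : ℝ, ν = Real.logb α (1 / 2) →
        ∀ bound : ℝ, bound = c * ((K : ℝ) ^ (1 + 4 * ν) * (n : ℝ) ^ (4 + 2 * ν) *
            Real.log (n * K / δ) / (δ ^ (2 * ν) * min ε κ ^ 2)) →
          1 - 2 * δ ≤
            prob ((PMF.uniformOfFintype (Fin K → Ranking n)).bind fun ω =>
                (algDAG n n₀ K α κ ε δ).run (p ω))
              {o | (o.queries : ℝ) ≤ bound ∧ (o.steps : ℝ) ≤ bound} := by
  refine ⟨?_, ?_⟩
  · intro n n₀ K κ ρ ε δ hn hn₀ hκ hκ1 _ hρ hε hδ hδ1 F₀ F p hK hmodel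
    exact accuracy_general hn hα₀ hα₁ hn₀ hκ hκ1 hρ hε hδ hδ1 hK hmodel
  · obtain ⟨c, hc, hcost⟩ := cost_random hα₀ hα₁
    refine ⟨c, hc, ?_⟩
    intro n n₀ K κ ρ ε δ hn hn₀ hκ hκ1 _ hρ hε hδ hδ1 F p hmodel ν hν bound hbound
    subst hν
    exact hcost n n₀ K κ ρ ε δ hn hn₀ hκ hκ1 hρ hε hδ hδ1 F p hmodel bound hbound
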